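/- Let $p\ge 1$, let $A_1,\dots,A_p\ge 1$ and $n_1,\dots,n_p\ge 0$ be integers, and let $P\in\mathbb{Q}[X_1,\dots,X_p]$. Write $(\alpha)_m=\alpha(\alpha+1)\cdots(\alpha+m-1)$ and put $D_j=\big(\sum_{i=1}^{j}A_i(n_i+1)\big)-j-1$ for $1\le j\le p$. A function $g$ on the open unit disc is said to be at most logarithmically divergent at $1$ if there are a polynomial $Q\in\mathbb{C}[t]$ and a real $\varepsilon>0$ with $g(w)=Q(\log(1-w))+O(|1-w|^{\varepsilon})$ as $w\to1$, $|w|<1$; then $Q$ is unique, and $Q(0)$ is the regularized value of $g$ at $1$. A function $f(z)$ defined for $|z|>1$ is said to be at most logarithmically divergent at $z=1$, with a given regularized value there, if this holds for $w\mapsto f(1/w)$ at $w=1$ (that is, the expansion is in powers of $\log(1-1/z)$). For integers $s_1,\dots,s_q\ge 1$, the shuffle-regularized multiple zeta value $\zeta^{sh}(s_1,\dots,s_q)$ is the regularized value at $1$ of $$\mathrm{Li}_{s_1,\dots,s_q}(w)=\sum_{k_1>\cdots>k_q\ge1}\frac{w^{k_1}}{k_1^{s_1}\cdots k_q^{s_q}},$$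 with value $1$ when $q=0$. Theorem. Suppose that $\sum_{i=1}^{j}\deg_{X_i}P\le D_j+1$ for all $j\in\{1,\dots,p\}$. Then the series $$f(z)=\sum_{k_1\ge\cdots\ge k_p\ge1}\frac{P(k_1,\dots,k_p)}{(k_1)_{n_1+1}^{A_1}\cdots(k_p)_{n_p+1}^{A_p}}\,z^{-k_1}$$ converges absolutely for $|z|>1$, it is at most logarithmically divergent at $z=1$, and its regularized value there is a linear combination with rational coefficients of the values $\zeta^{sh}(s_1,\dots,s_q)$ with $0\le q\le p$, $s_i\ge1$ for all $i$, and $\sum_{i=1}^{q}s_i\le\sum_{j=1}^{p}A_j$. Moreover, such a linear combination can be computed explicitly: there is an algorithm (a computable function, in the sense of recursion theory) which, given $p$, $(A_j)$, $(n_j)$ and the list of coefficients and exponents of a polynomial $P$ satisfying the degree conditions, outputs a finite list of rational coefficients and of indices $(s_1,\dots,s_q)$ satisfying these constraints, such that the corresponding combination of the $\zeta^{sh}(s_1,\dots,s_q)$ equals the regularized value of $f$ at $z=1$. -/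

import Mathlib

namespace HypergeomMZV

/-- A polynomial `Q` is a logarithmic expansion at `1` of a function `g` on the open unit disc:
`g w = Q (log (1 - w)) + O(|1 - w| ^ ε)` for some `ε > 0`, as `w → 1` with `‖w‖ < 1`.
There the real part of `1 - w` is positive, so `Complex.log` is the usual holomorphic branch. -/
def IsLogExpansion (g : ℂ → ℂ) (Q : Polynomial ℂ) : Prop :=
  ∃ ε : ℝ, 0 < ε ∧
    Asymptotics.IsBigO (nhdsWithin (1 : ℂ) (Metric.ball 0 1))
      (fun w => g w - Q.eval (Complex.log (1 - w))) (fun w => ‖1 - w‖ ^ ε)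

/-- `g`, a function on the open unit disc, is at most logarithmically divergent at `1`. -/
def AtMostLogDivergent (g : ℂ → ℂ) : Prop :=
  ∃ Q : Polynomial ℂ, IsLogExpansion g Q

open Classical in
/-- The regularized value at `1` of a function on the open unit disc that is at most
logarithmically divergent there: the constant coefficient of its expansion polynomial, which is
unique since `log (1 - w)` is unbounded. -/
noncomputable def regValue (g : ℂ → ℂ) : ℂ :=
  if h : AtMostLogDivergent g then h.choose.eval 0 else 0

/-- The entry `k₁` of a tuple `(k₁, …, k_q)`; it is `0` for the empty tuple. -/
def firstEntry {q : ℕ} (k : Fin q → ℕ) : ℕ :=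
  if h : 0 < q then k ⟨0, h⟩ else 0

/-- The multiple polylogarithm in one variable
`Li_s(w) = ∑_{k₁ > ⋯ > k_q ≥ 1} w ^ k₁ / (k₁ ^ s₁ ⋯ k_q ^ s_q)`, where `s = [s₁, …, s_q]`.
For the empty list it is the constant function `1`. -/
noncomputable def polylog (s : List ℕ) (w : ℂ) : ℂ :=
  ∑' k : {k : Fin s.length → ℕ // StrictAnti k ∧ ∀ i, 1 ≤ k i},
    w ^ firstEntry k.1 / ∏ i, (k.1 i : ℂ) ^ s.get i

/-- The shuffle-regularized multiple zeta value `ζ^sh(s₁, …, s_q)`: the regularized value at `1`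
of `Li_s`. -/
noncomputable def zetaSh (s : List ℕ) : ℂ := regValue (polylog s)

/-- `D_j = (∑_{i ≤ j} A_i (n_i + 1)) - j - 1`; the index `j : Fin p` stands for the number
`j + 1` in `{1, …, p}`. -/
def D {p : ℕ} (A n : Fin p → ℕ) (j : Fin p) : ℤ :=
  (∑ i ∈ Finset.Iic j, (A i : ℤ) * ((n i : ℤ) + 1)) - ((j : ℤ) + 1) - 1

/-- The degree conditions `∑_{i ≤ j} deg_{X_i} P ≤ D_j + 1` for all `j`. -/
def DegreeCondition {p : ℕ} (A n : Fin p → ℕ) (P : MvPolynomial (Fin p) ℚ) : Prop :=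
  ∀ j : Fin p, ∑ i ∈ Finset.Iic j, (P.degreeOf i : ℤ) ≤ D A n j + 1

/-- The tuples `k₁ ≥ ⋯ ≥ k_p ≥ 1`. -/
abbrev WideTuple (p : ℕ) : Type := {k : Fin p → ℕ // Antitone k ∧ ∀ i, 1 ≤ k i}

/-- The general term `P(k₁, …, k_p) / ((k₁)_{n₁+1} ^ A₁ ⋯ (k_p)_{n_p+1} ^ A_p) * z ^ (-k₁)`, where
`(α)_m = α (α + 1) ⋯ (α + m - 1)`. -/
noncomputable def seriesTerm {p : ℕ} (A n : Fin p → ℕ) (P : MvPolynomial (Fin p) ℚ) (z : ℂ)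
    (k : WideTuple p) : ℂ :=
  ((MvPolynomial.eval (fun i => (k.1 i : ℚ)) P /
      ∏ i, ((ascPochhammer ℚ (n i + 1)).eval (k.1 i : ℚ)) ^ A i : ℚ) : ℂ) *
    z ^ (-(firstEntry k.1 : ℤ))

/-- The sum over `k₁ ≥ ⋯ ≥ k_p ≥ 1` of the general term; it is meant for `1 < ‖z‖`. -/
noncomputable def series {p : ℕ} (A n : Fin p → ℕ) (P : MvPolynomial (Fin p) ℚ) (z : ℂ) : ℂ :=
  ∑' k : WideTuple p, seriesTerm A n P z k

/-- The series as a function of `w = 1 / z`, on the open unit disc. Divergence at `z = 1` and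
the regularized value there are read in `log (1 - w) = log (1 - 1 / z)`. -/
noncomputable def seriesInv {p : ℕ} (A n : Fin p → ℕ) (P : MvPolynomial (Fin p) ℚ) (w : ℂ) : ℂ :=
  series A n P w⁻¹

/-- The lists `[s₁, …, s_q]` with `0 ≤ q ≤ p`, all `s_i ≥ 1` and `∑ s_i ≤ ∑ A_j`. -/
def Admissible {p : ℕ} (A : Fin p → ℕ) (s : List ℕ) : Prop :=
  s.length ≤ p ∧ (∀ a ∈ s, 1 ≤ a) ∧ s.sum ≤ ∑ j, A j

/-- The rational number `a / (b + 1)` coded by `(a, b)`. -/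
def ratOfCode (c : ℤ × ℕ) : ℚ := (c.1 : ℚ) / ((c.2 : ℚ) + 1)

/-- Finite lists of pairs (code of a rational number, list of natural numbers). They serve as
codes both of polynomials (coefficients and exponents) and of formal rational linear
combinations of the values `zetaSh s` (coefficients and indices). -/
abbrev Code : Type := List ((ℤ × ℕ) × List ℕ)

/-- The polynomial in `p` variables coded by a list: the sum of the monomials
`c * X₁ ^ e₁ ⋯ X_p ^ e_p` (missing exponents are `0`). -/
noncomputable def polyOfCode (p : ℕ) (c : Code) : MvPolynomial (Fin p) ℚ :=
  (c.map fun t =>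
    MvPolynomial.C (ratOfCode t.1) * ∏ i : Fin p, MvPolynomial.X i ^ t.2.getD i 0).sum

/-- The value of the formal linear combination of regularized multiple zeta values coded by a
list. -/
noncomputable def zetaCombination (c : Code) : ℂ :=
  (c.map fun t => (ratOfCode t.1 : ℂ) * zetaSh t.2).sum

end HypergeomMZV

/-! Sequences u(k), k ≥ 1, carry the operators X (multiplication by k), Y a (division by k + a), E
(backward shift) and S (partial sums). For each monomial of P, the coefficient of z^(-k) in the
series is a word in X, Y a and S applied to the indicator of k = 1. A short list of relations
between the operators, abstracted in `SummationModule`, suffices for the reduction.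

Algebra. Partial fractions replace each factor by powers of X and powers of single operators Y a,
with pole orders at most A_j, whence the bound on the weight. A power of X under a summation is
absorbed by summation by parts with Bernoulli polynomials, which raises the degree by one; `excess`
tracks the degree that accumulates from the inner sums outwards. The degree conditions make it
vanish, so that only nested sums of products of 1 / (k_i + a_i)^s_i remain (`nested_mem_stdSpan`).
Since E^a * Y a = Y 0 * E^a, all a_i can be moved to 0, up to powers of E and terms of smaller depth
(`stdSpan_le_shiftSpan`). A linear map that ignores E therefore sends the nested sum to a
combination of the images of strictly nested zeta sums.

Analysis. On generating functions in w = 1/z, E is multiplication by w, which does not change the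
logarithmic expansion at 1; so the regularized value ignores E. The expansions exist because Y a * S
preserves the span of the Taylor coefficients of powers of log (1 - w) and of the sequences
O(k^(-3/2)) (`divOp_sumOp_mem_logSpan`).

Algorithm. The same algebra, applied to the universal module of words modulo relations, shows that
each reduction has a finite certificate: an equality of multisets of words (`exists_certificate`).
Correctness of a certificate is primitive recursive, so a search finds one
(`exists_computable_choice`), and a correct certificate implies the identity of regularized values
(`Certificate.sound`). -/

namespace HypergeomMZV

/-! ### The algebra of summation operators -/

/-- A rational vector space with a vector `base` and operators satisfying the relations of the
following operators on sequences `u(k)`, `k ≥ 1`: multiplication `X` by `k`, multiplication `Y a`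
by `1 / (k + a)`, backward shift `E` and summation `S`; `base` is the indicator of `k = 1`. -/
structure SummationModule (M : Type*) [AddCommGroup M] [Module ℚ M] where
  X : Module.End ℚ M
  E : Module.End ℚ M
  S : Module.End ℚ M
  Y : ℕ → Module.End ℚ M
  base : M
  X_mul_Y : ∀ a, X * Y a = 1 - (a : ℚ) • Y a
  Y_mul_X : ∀ a, Y a * X = 1 - (a : ℚ) • Y a
  E_mul_S : E * S = S - 1
  S_mul_E : S * E = S - 1
  X_mul_E : X * E = E * X + E
  X_base : X base = base

namespace SummationModule

open Submodule

variable {M : Type*} [AddCommGroup M] [Module ℚ M] (O : SummationModule M)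

theorem commute_X_Y (a : ℕ) : Commute O.X (O.Y a) := (O.X_mul_Y a).trans (O.Y_mul_X a).symm

/-- With `X_add_mul_Y`, this makes `Y a` a two-sided inverse of `X + a`. The rules for `Y a * Y b`
and `Y a * E` follow by inserting and cancelling such factors. -/
theorem Y_mul_X_add (a : ℕ) : O.Y a * (O.X + (a : ℚ) • 1) = 1 := by
  rw [mul_add, Y_mul_X, mul_smul_comm, mul_one, sub_add_cancel]

theorem X_add_mul_Y (a : ℕ) : (O.X + (a : ℚ) • 1) * O.Y a = 1 := by
  rw [add_mul, X_mul_Y, smul_mul_assoc, one_mul, sub_add_cancel]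

/-- The resolvent identity, the elementary step of partial fractions. -/
theorem Y_mul_Y_of_ne {a b : ℕ} (h : a ≠ b) :
    O.Y a * O.Y b = ((b : ℚ) - a)⁻¹ • (O.Y a - O.Y b) := by
  have hba : (b : ℚ) - a ≠ 0 := sub_ne_zero.2 (by exact_mod_cast h.symm)
  have h1 : O.Y a - O.Y b = ((b : ℚ) - a) • (O.Y a * O.Y b) := by
    calc O.Y a - O.Y b
        = O.Y a * ((O.X + (b : ℚ) • 1) * O.Y b) - O.Y a * (O.X + (a : ℚ) • 1) * O.Y b := by
          rw [X_add_mul_Y, Y_mul_X_add, mul_one, one_mul]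
      _ = ((b : ℚ) - a) • (O.Y a * O.Y b) := by
          rw [mul_assoc, ← mul_sub, ← sub_mul, add_sub_add_left_eq_sub, ← sub_smul,
            smul_mul_assoc, one_mul, mul_smul_comm]
  rw [h1, smul_smul, inv_mul_cancel₀ hba, one_smul]

/-- Since `X * E = E * (X + 1)`, moving `X + a` across `E` raises `a` by one, and the same holds for
the inverses. This lets a shift move the pole of `Y a`. -/
theorem Y_mul_E (a : ℕ) : O.Y a * O.E = O.E * O.Y (a + 1) := by
  have h : (O.X + (a : ℚ) • 1) * O.E = O.E * (O.X + ((a + 1 : ℕ) : ℚ) • 1) := by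
    rw [add_mul, mul_add, O.X_mul_E, smul_mul_assoc, mul_smul_comm, one_mul, mul_one]
    push_cast
    rw [add_smul, one_smul]
    abel
  calc O.Y a * O.E = O.Y a * (O.E * ((O.X + ((a + 1 : ℕ) : ℚ) • 1) * O.Y (a + 1))) := by
        rw [X_add_mul_Y, mul_one]
    _ = O.Y a * ((O.X + (a : ℚ) • 1) * O.E) * O.Y (a + 1) := by rw [h]; simp only [mul_assoc]
    _ = O.E * O.Y (a + 1) := by rw [← mul_assoc (O.Y a), Y_mul_X_add, one_mul]

theorem Y_pow_mul_E_pow (a s i : ℕ) :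
    O.Y a ^ s * O.E ^ i = O.E ^ i * O.Y (a + i) ^ s := by
  have h1 : ∀ b, O.Y b ^ s * O.E = O.E * O.Y (b + 1) ^ s := by
    intro b
    exact (SemiconjBy.pow_right (show SemiconjBy O.E (O.Y (b + 1)) (O.Y b) from
      (O.Y_mul_E b).symm) s).eq.symm
  induction i generalizing a with
  | zero => simp
  | succ i ih =>
    rw [pow_succ', ← mul_assoc, h1, mul_assoc, ih, ← mul_assoc, add_right_comm, add_assoc]

theorem commute_S_E : Commute O.S O.E := O.S_mul_E.trans O.E_mul_S.symm

/-- `S` is the inverse of `1 - E`; this is its geometric series, cut after `N` terms. -/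
theorem S_eq_sum (N : ℕ) : O.S = ∑ i ∈ Finset.range N, O.E ^ i + O.E ^ N * O.S := by
  induction N with
  | zero => simp
  | succ N ih =>
    rw [Finset.sum_range_succ, pow_succ, mul_assoc, E_mul_S, mul_sub, mul_one]
    nth_rewrite 1 [ih]
    abel

theorem Y_base (a : ℕ) : O.Y a O.base = ((a : ℚ) + 1)⁻¹ • O.base := by
  have h := LinearMap.congr_fun (O.Y_mul_X a) O.base
  simp only [Module.End.mul_apply, O.X_base, LinearMap.sub_apply, Module.End.one_apply,
    LinearMap.smul_apply] at h
  have h2 : ((a : ℚ) + 1) • O.Y a O.base = O.base := by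
    rw [add_smul, one_smul]; nth_rewrite 2 [h]; abel
  have : (a : ℚ) + 1 ≠ 0 := by positivity
  rw [← h2, smul_smul, inv_mul_cancel₀ this, one_smul, h2]

/-! ### Partial fractions -/

/-- The span of the powers `X ^ l` with `l < D` and of the partial fractions `Y a ^ s`,
`1 ≤ s ≤ m a`. -/
def fractions (D : ℕ) (m : ℕ → ℕ) : Submodule ℚ (Module.End ℚ M) :=
  span ℚ ({T | ∃ l < D, T = O.X ^ l} ∪ {T | ∃ a s, s < m a ∧ T = O.Y a ^ (s + 1)})

theorem X_pow_mem_fractions {D l : ℕ} (m : ℕ → ℕ) (h : l < D) :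
    O.X ^ l ∈ O.fractions D m := subset_span (Or.inl ⟨l, h, rfl⟩)

theorem Y_pow_mem_fractions (D : ℕ) {m : ℕ → ℕ} {a s : ℕ} (h : s < m a) :
    O.Y a ^ (s + 1) ∈ O.fractions D m := subset_span (Or.inr ⟨a, s, h, rfl⟩)

theorem fractions_mono {D D' : ℕ} {m m' : ℕ → ℕ} (hD : D ≤ D') (hm : m ≤ m') :
    O.fractions D m ≤ O.fractions D' m' := by
  refine span_mono (Set.union_subset_union ?_ ?_)
  · rintro _ ⟨l, hl, rfl⟩; exact ⟨l, hl.trans_le hD, rfl⟩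
  · rintro _ ⟨a, s, hs, rfl⟩; exact ⟨a, s, hs.trans_le (hm a), rfl⟩

theorem Y_mem_fractions (D : ℕ) {m : ℕ → ℕ} {b : ℕ} (h : 0 < m b) :
    O.Y b ∈ O.fractions D m := by
  have := O.Y_pow_mem_fractions D h
  rwa [zero_add, pow_one] at this

theorem Y_mul_X_pow_mem_fractions (b l : ℕ) :
    O.Y b * O.X ^ l ∈ O.fractions l (Pi.single b 1) := by
  have hb : ∀ D, O.Y b ∈ O.fractions D (Pi.single b 1) := fun D =>
    O.Y_mem_fractions D (by simp)
  induction l with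
  | zero => simpa using hb 0
  | succ l ih =>
    rw [pow_succ', ← mul_assoc, Y_mul_X, sub_mul, one_mul, smul_mul_assoc]
    exact sub_mem (O.X_pow_mem_fractions _ l.lt_succ_self)
      (smul_mem _ _ (O.fractions_mono l.le_succ le_rfl ih))

theorem Y_mul_Y_pow_mem_fractions {a b : ℕ} (h : a ≠ b) (s : ℕ) :
    O.Y b * O.Y a ^ (s + 1) ∈ O.fractions 0 (Pi.single b 1 + Pi.single a (s + 1)) := by
  have hb : ∀ t, O.Y b ∈ O.fractions 0 (Pi.single b 1 + Pi.single a t) := fun t =>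
    O.Y_mem_fractions 0 (by simp)
  have ha : ∀ t, O.Y a ^ (t + 1) ∈ O.fractions 0 (Pi.single b 1 + Pi.single a (t + 1)) :=
    fun t => O.Y_pow_mem_fractions 0 (by simp; omega)
  induction s with
  | zero =>
    rw [zero_add, pow_one, O.Y_mul_Y_of_ne h.symm]
    exact smul_mem _ _ (sub_mem (hb _) (O.Y_mem_fractions 0 (by simp)))
  | succ s ih =>
    rw [pow_succ', ← mul_assoc, O.Y_mul_Y_of_ne h.symm, smul_mul_assoc, sub_mul, ← pow_succ']
    refine smul_mem _ _ (sub_mem (O.fractions_mono le_rfl ?_ ih) (ha _))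
    gcongr
    exact s.le_succ

/-- Division by a linear factor lowers the degree of the polynomial part, whence the truncated `D -
1`, and can raise the pole order only at `b`. -/
theorem Y_mul_mem_fractions {D : ℕ} {m : ℕ → ℕ} {T : Module.End ℚ M} (b : ℕ)
    (hT : T ∈ O.fractions D m) : O.Y b * T ∈ O.fractions (D - 1) (m + Pi.single b 1) := by
  induction hT using span_induction with
  | mem T hT =>
    rcases hT with ⟨l, hl, rfl⟩ | ⟨a, s, hs, rfl⟩
    · exact O.fractions_mono (Nat.le_sub_one_of_lt hl) (by simp) (O.Y_mul_X_pow_mem_fractions b l)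
    · by_cases hab : a = b
      · subst hab
        rw [← pow_succ']
        exact O.Y_pow_mem_fractions _ (by simpa using hs)
      · refine O.fractions_mono (Nat.zero_le _) ?_ (O.Y_mul_Y_pow_mem_fractions hab s)
        rw [add_comm]
        gcongr
        intro c
        by_cases hc : c = a
        · subst hc; simpa using hs
        · simp [hc]
  | zero => simp
  | add T U _ _ hT hU => rw [mul_add]; exact add_mem hT hU
  | smul c T _ hT => rw [mul_smul_comm]; exact smul_mem _ _ hT

/-- Partial fraction decomposition of a monomial over a product of linear factors. -/
theorem X_pow_mul_prod_mem_fractions (e : ℕ) (L : List ℕ) :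
    O.X ^ e * (L.map O.Y).prod ∈ O.fractions (e + 1 - L.length) (fun a => L.count a) := by
  induction L with
  | nil => simpa using O.X_pow_mem_fractions (fun _ => 0) e.lt_succ_self
  | cons b L ih =>
    rw [List.map_cons, List.prod_cons, ← mul_assoc, ((O.commute_X_Y b).pow_left e).eq, mul_assoc]
    refine O.fractions_mono ?_ ?_ (O.Y_mul_mem_fractions b ih)
    · simp only [List.length_cons]; omega
    · intro a
      by_cases h : a = b
      · subst h; simp
      · simp [h, Ne.symm h]

/-! ### Standard vectors -/

/-- The vector `Y a₁ ^ (s₁ + 1) S Y a₂ ^ (s₂ + 1) S ⋯ S base`. -/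
def std : List (ℕ × ℕ) → M
  | [] => O.base
  | (a, s) :: l => (O.Y a ^ (s + 1)) (O.S (std l))

/-- The sum of the exponents of the vector `O.std l`. -/
def stdWeight (l : List (ℕ × ℕ)) : ℕ := (l.map fun x => x.2 + 1).sum

/-- The span of the vectors `O.std l` of depth at most `d` and weight at most `w`. -/
def stdSpan (d w : ℕ) : Submodule ℚ M :=
  span ℚ (O.std '' {l | l.length ≤ d ∧ stdWeight l ≤ w})

theorem std_mem_stdSpan {d w : ℕ} {l : List (ℕ × ℕ)} (hd : l.length ≤ d) (hw : stdWeight l ≤ w) :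
    O.std l ∈ O.stdSpan d w := subset_span ⟨l, ⟨hd, hw⟩, rfl⟩

theorem stdSpan_mono {d d' w w' : ℕ} (hd : d ≤ d') (hw : w ≤ w') :
    O.stdSpan d w ≤ O.stdSpan d' w' :=
  span_mono (Set.image_mono fun _ h => ⟨h.1.trans hd, h.2.trans hw⟩)

theorem base_mem_stdSpan (d w : ℕ) : O.base ∈ O.stdSpan d w :=
  O.std_mem_stdSpan (l := []) (by simp) (by simp [stdWeight])

theorem Y_pow_S_mem_stdSpan {d w : ℕ} {v : M} (hv : v ∈ O.stdSpan d w) (a s : ℕ) :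
    (O.Y a ^ (s + 1)) (O.S v) ∈ O.stdSpan (d + 1) (w + (s + 1)) := by
  induction hv using span_induction with
  | mem x hx =>
    obtain ⟨l, ⟨hl, hw⟩, rfl⟩ := hx
    refine O.std_mem_stdSpan (l := (a, s) :: l) (by simpa using hl) ?_
    simp only [stdWeight, List.map_cons, List.sum_cons] at hw ⊢
    omega
  | zero => simp
  | add x y _ _ hx hy => simpa only [map_add] using add_mem hx hy
  | smul c x _ hx => simpa only [map_smul] using smul_mem _ c hx

/-- Each partial fraction has a single pole, so without polynomial part the weight grows only by the
largest pole order, however many poles there are. -/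
theorem fractions_zero_apply_S {m : ℕ → ℕ} {k d w : ℕ} (hm : ∀ a, m a ≤ k)
    {T : Module.End ℚ M} (hT : T ∈ O.fractions 0 m) {v : M} (hv : v ∈ O.stdSpan d w) :
    T (O.S v) ∈ O.stdSpan (d + 1) (w + k) := by
  induction hT using span_induction with
  | mem T hT =>
    rcases hT with ⟨l, hl, rfl⟩ | ⟨a, s, hs, rfl⟩
    · simp at hl
    · exact O.stdSpan_mono le_rfl (by have := hm a; omega) (O.Y_pow_S_mem_stdSpan hv a s)
  | zero => simp
  | add T U _ _ hT hU => exact add_mem hT hU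
  | smul c T _ hT => exact smul_mem _ _ hT

/-! ### Summation of polynomial factors -/

/-- The span of the vectors `X ^ i' S v` with `i' ≤ i` and `v` in `O.stdSpan d w`. -/
def polySpan (i d w : ℕ) : Submodule ℚ M :=
  span ℚ {x | ∃ i' ≤ i, ∃ v ∈ O.stdSpan d w, x = (O.X ^ i') (O.S v)}

theorem X_pow_S_mem_polySpan {i i' d w : ℕ} (h : i' ≤ i) {v : M} (hv : v ∈ O.stdSpan d w) :
    (O.X ^ i') (O.S v) ∈ O.polySpan i d w := subset_span ⟨i', h, v, hv, rfl⟩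

theorem S_mem_polySpan (i : ℕ) {d w : ℕ} {v : M} (hv : v ∈ O.stdSpan d w) :
    O.S v ∈ O.polySpan i d w := by
  simpa using O.X_pow_S_mem_polySpan (Nat.zero_le i) hv

theorem polySpan_mono {i i' d d' w w' : ℕ} (hi : i ≤ i') (hd : d ≤ d') (hw : w ≤ w') :
    O.polySpan i d w ≤ O.polySpan i' d' w' := by
  refine span_mono ?_
  rintro _ ⟨j, hj, v, hv, rfl⟩
  exact ⟨j, hj.trans hi, v, O.stdSpan_mono hd hw hv, rfl⟩

theorem aeval_comp_mul_E (p : Polynomial ℚ) :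
    O.E * Polynomial.aeval O.X (p.comp (1 + Polynomial.X)) = Polynomial.aeval O.X p * O.E := by
  rw [Polynomial.aeval_comp]
  have h : SemiconjBy O.E (Polynomial.aeval O.X (1 + Polynomial.X : Polynomial ℚ)) O.X := by
    show O.E * Polynomial.aeval O.X (1 + Polynomial.X : Polynomial ℚ) = O.X * O.E
    simp only [map_add, map_one, Polynomial.aeval_X, mul_add, mul_one, O.X_mul_E]
    abel
  revert h
  generalize Polynomial.aeval O.X (1 + Polynomial.X : Polynomial ℚ) = T
  intro h
  induction p using Polynomial.induction_on' with
  | add p q hp hq => simp only [map_add, mul_add, add_mul, hp, hq]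
  | monomial n c =>
    simp only [Polynomial.aeval_monomial, ← Algebra.smul_def, smul_mul_assoc, mul_smul_comm]
    rw [(h.pow_right n).eq]

theorem aeval_bernoulli_comp (e : ℕ) :
    Polynomial.aeval O.X ((Polynomial.bernoulli (e + 1)).comp (1 + Polynomial.X)) =
      Polynomial.aeval O.X (Polynomial.bernoulli (e + 1)) + ((e : ℚ) + 1) • O.X ^ e := by
  rw [Polynomial.bernoulli_comp_one_add_X, map_add, map_nsmul, map_pow, Polynomial.aeval_X,
    Nat.add_sub_cancel, ← Nat.cast_smul_eq_nsmul ℚ, Nat.cast_add_one]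

/-- Summation of powers, through Bernoulli polynomials. -/
theorem S_mul_X_pow_mul_S (e : ℕ) :
    ((e : ℚ) + 1) • (O.S * O.X ^ e * O.S) =
      (Polynomial.aeval O.X (Polynomial.bernoulli (e + 1)) + ((e : ℚ) + 1) • O.X ^ e) * O.S
        - O.S * Polynomial.aeval O.X (Polynomial.bernoulli (e + 1)) := by
  have h1 := O.aeval_comp_mul_E (Polynomial.bernoulli (e + 1))
  rw [aeval_bernoulli_comp] at h1
  set B := Polynomial.aeval O.X (Polynomial.bernoulli (e + 1))
  set B' := B + ((e : ℚ) + 1) • O.X ^ e with hB'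
  -- `B'` is the Bernoulli polynomial at `X + 1`, so `E * B' = B * E`. With `E * S = S - 1`, the
  -- difference equation of `B` leaves the power of `X` and a boundary term `B`.
  have h2 : B' * O.S - O.E * B' * O.S = ((e : ℚ) + 1) • (O.X ^ e * O.S) + B := by
    rw [h1, mul_assoc B, O.E_mul_S, hB', add_mul, mul_sub, mul_one, smul_mul_assoc]
    abel
  -- `S` undoes `1 - E`: summation by parts.
  have h3 : O.S * (B' * O.S - O.E * B' * O.S) = B' * O.S := by
    rw [mul_sub, ← mul_assoc, ← mul_assoc, ← mul_assoc, O.S_mul_E, sub_mul, sub_mul, one_mul]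
    abel
  rw [h2, mul_add, mul_smul_comm, ← mul_assoc] at h3
  exact eq_sub_of_add_eq h3

theorem aeval_bernoulli_eq_sum (e : ℕ) : ∃ c : ℕ → ℚ,
    Polynomial.aeval O.X (Polynomial.bernoulli (e + 1)) =
      ∑ i ∈ Finset.range (e + 2), c i • O.X ^ i := by
  refine ⟨fun i => bernoulli (e + 1 - i) * (e + 1).choose i, ?_⟩
  simp only [Polynomial.bernoulli_def, map_sum, Polynomial.aeval_monomial, ← Algebra.smul_def]

/-- As in Faulhaber's formula, the outer summation raises the degree by one. In the boundary term
the inner `S` has disappeared, and the hypothesis `h` covers it. -/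
theorem S_X_pow_S_mem_polySpan {l d w : ℕ}
    (h : ∀ i, ∀ v ∈ O.stdSpan d w, O.S ((O.X ^ i) v) ∈ O.polySpan i d w)
    {v : M} (hv : v ∈ O.stdSpan d w) :
    O.S ((O.X ^ l) (O.S v)) ∈ O.polySpan (l + 1) d w := by
  obtain ⟨c, hc⟩ := O.aeval_bernoulli_eq_sum l
  have h1 := LinearMap.congr_fun (O.S_mul_X_pow_mul_S l) v
  rw [hc] at h1
  have h2 : ((l : ℚ) + 1) ≠ 0 := by positivity
  have h3 : ((l : ℚ) + 1) • O.S ((O.X ^ l) (O.S v)) ∈ O.polySpan (l + 1) d w := by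
    refine (show ((l : ℚ) + 1) • O.S ((O.X ^ l) (O.S v)) = _ from h1) ▸ ?_
    simp only [LinearMap.sub_apply, Module.End.mul_apply, LinearMap.add_apply,
      LinearMap.sum_apply, LinearMap.smul_apply, map_sum, map_smul]
    refine sub_mem (add_mem (sum_mem fun i hi => smul_mem _ _ ?_) (smul_mem _ _ ?_))
      (sum_mem fun i hi => smul_mem _ _ ?_)
    · exact O.X_pow_S_mem_polySpan (Nat.lt_succ_iff.1 (Finset.mem_range.1 hi)) hv
    · exact O.X_pow_S_mem_polySpan l.le_succ hv
    · exact O.polySpan_mono (Nat.lt_succ_iff.1 (Finset.mem_range.1 hi)) le_rfl le_rfl (h i v hv)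
  exact (smul_mem_iff _ h2).1 h3

theorem S_fractions_S_mem_polySpan {d w : ℕ}
    (h : ∀ i, ∀ v ∈ O.stdSpan d w, O.S ((O.X ^ i) v) ∈ O.polySpan i d w)
    {D k : ℕ} {m : ℕ → ℕ} (hm : ∀ a, m a ≤ k) {T : Module.End ℚ M} (hT : T ∈ O.fractions D m)
    {v : M} (hv : v ∈ O.stdSpan d w) :
    O.S (T (O.S v)) ∈ O.polySpan D (d + 1) (w + k) := by
  induction hT using span_induction with
  | mem T hT =>
    rcases hT with ⟨l, hl, rfl⟩ | ⟨a, s, hs, rfl⟩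
    · exact O.polySpan_mono hl d.le_succ (Nat.le_add_right _ _) (O.S_X_pow_S_mem_polySpan h hv)
    · exact O.S_mem_polySpan D
        (O.stdSpan_mono le_rfl (by have := hm a; omega) (O.Y_pow_S_mem_stdSpan hv a s))
  | zero => simp
  | add T U _ _ hT hU => simpa only [LinearMap.add_apply, map_add] using add_mem hT hU
  | smul c T _ hT => simpa only [LinearMap.smul_apply, map_smul] using smul_mem _ c hT

theorem X_pow_base (i : ℕ) : (O.X ^ i) O.base = O.base := by
  induction i with
  | zero => rfl
  | succ i ih => rw [pow_succ, Module.End.mul_apply, O.X_base, ih]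

/-- Induction on the depth: `X ^ i` is merged by partial fractions with the outermost power of `Y
a`, and summation by parts then acts on a vector of smaller depth. At depth zero only multiples of
`base` occur, which `X` fixes. -/
theorem S_X_pow_mem_polySpan (i : ℕ) {d w : ℕ} {v : M} (hv : v ∈ O.stdSpan d w) :
    O.S ((O.X ^ i) v) ∈ O.polySpan i d w := by
  induction d generalizing i w v with
  | zero =>
    induction hv using span_induction with
    | mem x hx =>
      obtain ⟨l, ⟨hl, -⟩, rfl⟩ := hx
      obtain rfl := List.length_eq_zero_iff.1 (Nat.le_zero.1 hl)
      rw [std, X_pow_base]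
      exact O.S_mem_polySpan i (O.base_mem_stdSpan _ _)
    | zero => simp
    | add x y _ _ hx hy => simpa only [map_add] using add_mem hx hy
    | smul c x _ hx => simpa only [map_smul] using smul_mem _ c hx
  | succ d ih =>
    induction hv using span_induction with
    | mem x hx =>
      obtain ⟨l, ⟨hl, hw⟩, rfl⟩ := hx
      rcases l with _ | ⟨⟨a, s⟩, l⟩
      · rw [std, X_pow_base]
        exact O.S_mem_polySpan i (O.base_mem_stdSpan _ _)
      · have hT := O.X_pow_mul_prod_mem_fractions i (List.replicate (s + 1) a)
        rw [List.map_replicate, List.prod_replicate] at hT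
        simp only [stdWeight, List.map_cons, List.sum_cons] at hw
        have := O.S_fractions_S_mem_polySpan (fun i v hv => ih (w := w - (s + 1)) i hv)
          (k := s + 1) (fun b => (List.count_le_length).trans (by simp)) hT
          (O.std_mem_stdSpan (l := l) (by simpa using hl) (by simp only [stdWeight]; omega))
        exact O.polySpan_mono (by simp) le_rfl (by omega) this
    | zero => simp
    | add x y _ _ hx hy => simpa only [map_add] using add_mem hx hy
    | smul c x _ hx => simpa only [map_smul] using smul_mem _ c hx

/-! ### Nested sums under the degree condition -/

/-- The list of the shifts in `(k)_{n+1} ^ A`, with multiplicities. -/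
def shifts (A n : ℕ) : List ℕ := (List.replicate A (List.range (n + 1))).flatten

theorem length_shifts (A n : ℕ) : (shifts A n).length = A * (n + 1) := by
  simp [shifts]

/-- The shifts `0, …, n` are distinct, so each pole has order at most `A`. Hence the weight is
bounded by the sum of the `A_j`, and not by the number of linear factors. -/
theorem count_shifts_le (A n a : ℕ) : (shifts A n).count a ≤ A := by
  rw [shifts, List.count_flatten, List.map_replicate, List.sum_replicate, smul_eq_mul]
  exact (Nat.mul_le_mul_left A (List.nodup_iff_count_le_one.1 List.nodup_range a)).trans
    (mul_one A).le

/-- The vector of the nested sum attached to a list of factors `(A, n, e)`, each of which stands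
for `k ^ e / (k)_{n+1} ^ A`. -/
def nested : List (ℕ × ℕ × ℕ) → M
  | [] => O.base
  | (A, n, e) :: l => (O.X ^ e * ((shifts A n).map O.Y).prod) (O.S (nested l))

/-- The growth exponent of the nested sum of a list of factors. -/
def excess : List (ℕ × ℕ × ℕ) → ℕ
  | [] => 0
  | (A, n, e) :: l => e + 1 + excess l - A * (n + 1)

/-- The sum of the exponents `A` of a list of factors. -/
def factorWeight (l : List (ℕ × ℕ × ℕ)) : ℕ := (l.map Prod.fst).sum

theorem commute_X_prod (L : List ℕ) : Commute O.X (L.map O.Y).prod := by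
  refine Commute.list_prod_right _ _ fun T hT => ?_
  obtain ⟨a, -, rfl⟩ := List.mem_map.1 hT
  exact O.commute_X_Y a

/-- The inner sum has degree at most `excess l`; the numerator adds `e`, the denominator removes `A
* (n + 1)`, and the outer summation adds one. This is the recursion of `excess`. -/
theorem S_nested_mem_polySpan (l : List (ℕ × ℕ × ℕ)) :
    O.S (O.nested l) ∈ O.polySpan (excess l) l.length (factorWeight l) := by
  induction l with
  | nil => exact O.S_mem_polySpan _ (O.base_mem_stdSpan _ _)
  | cons f l ih =>
    obtain ⟨A, n, e⟩ := f
    rw [nested]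
    generalize O.S (O.nested l) = x at ih
    induction ih using span_induction with
    | mem x hx =>
      obtain ⟨i, hi, v, hv, rfl⟩ := hx
      have hT := O.X_pow_mul_prod_mem_fractions (e + i) (shifts A n)
      have := O.S_fractions_S_mem_polySpan (fun i v hv => O.S_X_pow_mem_polySpan i hv)
        (count_shifts_le A n) hT hv
      rw [← Module.End.mul_apply (_ * _), mul_assoc, ← ((O.commute_X_prod _).pow_left i).eq, ← mul_assoc,
        ← pow_add]
      refine O.polySpan_mono ?_ le_rfl ?_ this
      · rw [length_shifts, excess]; omega
      · simp [factorWeight, add_comm]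
    | zero => simp
    | add x y _ _ hx hy => simpa only [map_add] using add_mem hx hy
    | smul c x _ hx => simpa only [map_smul] using smul_mem _ c hx

/-- Under the degree condition, the nested sum is a combination of sums of partial fractions. -/
theorem nested_mem_stdSpan {l : List (ℕ × ℕ × ℕ)} (h : excess l = 0) :
    O.nested l ∈ O.stdSpan l.length (factorWeight l) := by
  rcases l with _ | ⟨⟨A, n, e⟩, l⟩
  · exact O.base_mem_stdSpan _ _
  · rw [nested]
    have hx := O.S_nested_mem_polySpan l
    generalize O.S (O.nested l) = x at hx
    induction hx using span_induction with
    | mem x hx =>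
      obtain ⟨i, hi, v, hv, rfl⟩ := hx
      have hT := O.X_pow_mul_prod_mem_fractions (e + i) (shifts A n)
      -- As `i` is at most the excess of the tail, vanishing of the total excess leaves no
      -- polynomial part.
      rw [length_shifts, show e + i + 1 - A * (n + 1) = 0 by rw [excess] at h; omega] at hT
      have := O.fractions_zero_apply_S (count_shifts_le A n) hT hv
      rw [← Module.End.mul_apply (_ * _), mul_assoc, ← ((O.commute_X_prod _).pow_left i).eq, ← mul_assoc,
        ← pow_add]
      refine O.stdSpan_mono le_rfl ?_ this
      simp [factorWeight, add_comm]
    | zero => simp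
    | add x y _ _ hx hy => simpa only [map_add] using add_mem hx hy
    | smul c x _ hx => simpa only [map_smul] using smul_mem _ c hx

/-- `Y a` merges with the outermost partial fraction, so the depth does not grow. -/
theorem Y_mem_stdSpan {d w : ℕ} {v : M} (hv : v ∈ O.stdSpan d w) (a : ℕ) :
    O.Y a v ∈ O.stdSpan d (w + 1) := by
  induction hv using span_induction with
  | mem x hx =>
    obtain ⟨l, ⟨hl, hw⟩, rfl⟩ := hx
    rcases l with _ | ⟨⟨b, s⟩, l⟩
    · rw [std, Y_base]
      exact smul_mem _ _ (O.base_mem_stdSpan _ _)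
    · have hT := O.Y_mul_mem_fractions a
        (O.Y_pow_mem_fractions 0 (m := Pi.single b (s + 1)) (a := b) (s := s) (by simp))
      simp only [stdWeight, List.map_cons, List.sum_cons, List.length_cons] at hw hl
      refine O.stdSpan_mono hl (w := stdWeight l + (s + 2)) ?_
        (O.fractions_zero_apply_S (fun c => ?_) hT (O.std_mem_stdSpan (l := l) le_rfl le_rfl))
      · simp only [stdWeight]; omega
      · have h1 : (Pi.single b (s + 1) : ℕ → ℕ) c ≤ s + 1 := by
          rw [Pi.single_apply]; split_ifs <;> omega
        have h2 : (Pi.single a 1 : ℕ → ℕ) c ≤ 1 := by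
          rw [Pi.single_apply]; split_ifs <;> omega
        exact (add_le_add h1 h2).trans_eq rfl
  | zero => simp
  | add x y _ _ hx hy => simpa only [map_add] using add_mem hx hy
  | smul c x _ hx => simpa only [map_smul] using smul_mem _ c hx

theorem Y_pow_mem_stdSpan {d w : ℕ} {v : M} (hv : v ∈ O.stdSpan d w) (a s : ℕ) :
    (O.Y a ^ s) v ∈ O.stdSpan d (w + s) := by
  induction s with
  | zero => simpa using hv
  | succ s ih =>
    rw [pow_succ']
    exact O.Y_mem_stdSpan ih a

theorem E_S_apply (v : M) : O.E (O.S v) = O.S v - v := LinearMap.congr_fun O.E_mul_S v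

theorem E_pow_S_apply (N : ℕ) (v : M) :
    (O.E ^ N) (O.S v) = O.S v - ∑ i ∈ Finset.range N, (O.E ^ i) v := by
  have h := LinearMap.congr_fun (O.S_eq_sum N) v
  simp only [LinearMap.add_apply, LinearMap.sum_apply, Module.End.mul_apply] at h
  exact eq_sub_of_add_eq' h.symm

theorem S_E_pow_apply (N : ℕ) (v : M) : O.S ((O.E ^ N) v) = (O.E ^ N) (O.S v) :=
  LinearMap.congr_fun (O.commute_S_E.pow_right N).eq v

theorem Y_pow_E_pow_apply (a s i : ℕ) (v : M) :
    (O.Y a ^ s) ((O.E ^ i) v) = (O.E ^ i) ((O.Y (a + i) ^ s) v) :=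
  LinearMap.congr_fun (O.Y_pow_mul_E_pow a s i) v

/-! ### Moving all poles to zero -/

/-- The vector of the strictly nested sum with exponents `s₁, …, s_q`. -/
def zetaVec : List ℕ → M
  | [] => O.base
  | [s] => (O.Y 0 ^ s) (O.S O.base)
  | s :: t :: l => (O.Y 0 ^ s) (O.E (O.S (zetaVec (t :: l))))

/-- The span of the shifts of the vectors `O.zetaVec s` of depth at most `d` and weight at most
`w`. -/
def zetaSpan (d w : ℕ) : Submodule ℚ M :=
  span ℚ {x | ∃ j l, l.length ≤ d ∧ (∀ a ∈ l, 1 ≤ a) ∧ l.sum ≤ w ∧ x = (O.E ^ j) (O.zetaVec l)}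

theorem zetaVec_mem_zetaSpan {d w : ℕ} {l : List ℕ} (hd : l.length ≤ d) (hl : ∀ a ∈ l, 1 ≤ a)
    (hw : l.sum ≤ w) : O.zetaVec l ∈ O.zetaSpan d w :=
  subset_span ⟨0, l, hd, hl, hw, by simp⟩

theorem zetaSpan_mono {d d' w w' : ℕ} (hd : d ≤ d') (hw : w ≤ w') :
    O.zetaSpan d w ≤ O.zetaSpan d' w' := by
  refine span_mono ?_
  rintro _ ⟨j, l, h1, h2, h3, rfl⟩
  exact ⟨j, l, h1.trans hd, h2, h3.trans hw, rfl⟩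

theorem E_pow_mem_zetaSpan {d w : ℕ} {v : M} (hv : v ∈ O.zetaSpan d w) (n : ℕ) :
    (O.E ^ n) v ∈ O.zetaSpan d w := by
  induction hv using span_induction with
  | mem x hx =>
    obtain ⟨j, l, h1, h2, h3, rfl⟩ := hx
    exact subset_span ⟨n + j, l, h1, h2, h3, by rw [pow_add, Module.End.mul_apply]⟩
  | zero => simp
  | add x y _ _ hx hy => simpa only [map_add] using add_mem hx hy
  | smul c x _ hx => simpa only [map_smul] using smul_mem _ c hx

theorem Y_pow_S_mem_stdSpan' {d w s : ℕ} (hs : 1 ≤ s) {v : M} (hv : v ∈ O.stdSpan d w) (a : ℕ) :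
    (O.Y a ^ s) (O.S v) ∈ O.stdSpan (d + 1) (s + w) := by
  obtain ⟨s, rfl⟩ := Nat.exists_eq_add_of_le' hs
  rw [add_comm (s + 1)]
  exact O.Y_pow_S_mem_stdSpan hv a s

/-- A strict inequality is `E * S = S - 1`: the weak one minus the diagonal, which has smaller depth
and the same total weight. -/
theorem zetaVec_mem_stdSpan {l : List ℕ} (hl : ∀ a ∈ l, 1 ≤ a) :
    O.zetaVec l ∈ O.stdSpan l.length l.sum := by
  induction l with
  | nil => exact O.base_mem_stdSpan _ _
  | cons s l ih =>
    have hs : 1 ≤ s := hl s List.mem_cons_self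
    rcases l with _ | ⟨t, l⟩
    · exact O.Y_pow_S_mem_stdSpan' hs (O.base_mem_stdSpan 0 0) 0
    · have ih := ih fun a ha => hl a (List.mem_cons_of_mem _ ha)
      rw [zetaVec, E_S_apply, map_sub, List.sum_cons]
      refine sub_mem (O.Y_pow_S_mem_stdSpan' hs ih 0) ?_
      exact O.stdSpan_mono (Nat.le_succ _) (add_comm _ _).le (O.Y_pow_mem_stdSpan ih 0 s)

/-- For nonempty `l` this is a zeta vector by definition. For empty `l`, `zetaVec [s]` has `S` in
place of `E * S`; the difference is `base`, which `Y 0` fixes. -/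
theorem Y_pow_E_S_zetaVec_mem_zetaSpan {s : ℕ} (hs : 1 ≤ s) {l : List ℕ} (hl : ∀ a ∈ l, 1 ≤ a) :
    (O.Y 0 ^ s) (O.E (O.S (O.zetaVec l))) ∈ O.zetaSpan (l.length + 1) (s + l.sum) := by
  rcases l with _ | ⟨t, l⟩
  · rw [E_S_apply, map_sub]
    refine sub_mem (O.zetaVec_mem_zetaSpan (l := [s]) le_rfl (by simpa using hs) (by simp)) ?_
    have h : ∀ n, (O.Y 0 ^ n) O.base = O.base := by
      intro n
      induction n with
      | zero => rfl
      | succ n ih => rw [pow_succ, Module.End.mul_apply, Y_base]; simpa using ih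
    rw [zetaVec, h]
    exact O.zetaVec_mem_zetaSpan (l := []) (by simp) (by simp) (by simp)
  · exact O.zetaVec_mem_zetaSpan (l := s :: t :: l) le_rfl
      (by rintro a (_ | ⟨_, h⟩); exacts [hs, hl a h]) (by simp)

/-- The vectors some shift of which lies in `O.zetaSpan d w`. -/
def shiftSpan (d w : ℕ) : Submodule ℚ M where
  carrier := {v | ∃ N, (O.E ^ N) v ∈ O.zetaSpan d w}
  zero_mem' := ⟨0, by simp⟩
  add_mem' := by
    rintro x y ⟨N, hx⟩ ⟨N', hy⟩
    refine ⟨N + N', ?_⟩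
    rw [map_add]
    refine add_mem ?_ ?_
    · rw [add_comm, pow_add]; exact O.E_pow_mem_zetaSpan hx N'
    · rw [pow_add]; exact O.E_pow_mem_zetaSpan hy N
  smul_mem' := by
    rintro c x ⟨N, hx⟩
    exact ⟨N, by rw [map_smul]; exact smul_mem _ _ hx⟩

theorem zetaSpan_le_shiftSpan (d w : ℕ) : O.zetaSpan d w ≤ O.shiftSpan d w :=
  fun x hx => ⟨0, by simpa using hx⟩

theorem shiftSpan_mono {d d' w w' : ℕ} (hd : d ≤ d') (hw : w ≤ w') :
    O.shiftSpan d w ≤ O.shiftSpan d' w' := fun _ ⟨N, h⟩ => ⟨N, O.zetaSpan_mono hd hw h⟩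

theorem E_pow_mem_shiftSpan_iff {d w n : ℕ} {v : M} :
    (O.E ^ n) v ∈ O.shiftSpan d w ↔ v ∈ O.shiftSpan d w := by
  constructor
  · rintro ⟨N, h⟩
    exact ⟨N + n, by rwa [pow_add]⟩
  · rintro ⟨N, h⟩
    refine ⟨N, ?_⟩
    rw [← Module.End.mul_apply, ← pow_add, add_comm, pow_add]
    exact O.E_pow_mem_zetaSpan h n

/-- Induction on the depth. `E ^ a` turns the outermost `Y a` into `Y 0`, and `S v` differs from its
shifts by finite sums of shifts of `v`, where a summation has been lost. -/
theorem stdSpan_le_shiftSpan (d w : ℕ) : O.stdSpan d w ≤ O.shiftSpan d w := by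
  induction d generalizing w with
  | zero =>
    refine span_le.2 ?_
    rintro _ ⟨l, ⟨hl, -⟩, rfl⟩
    obtain rfl := List.length_eq_zero_iff.1 (Nat.le_zero.1 hl)
    exact O.zetaSpan_le_shiftSpan _ _
      (O.zetaVec_mem_zetaSpan (l := []) (by simp) (by simp) (by simp))
  | succ d ih =>
    refine span_le.2 ?_
    rintro _ ⟨l, ⟨hl, hw⟩, rfl⟩
    rcases l with _ | ⟨⟨a, s⟩, l⟩
    · exact O.zetaSpan_le_shiftSpan _ _
        (O.zetaVec_mem_zetaSpan (l := []) (by simp) (by simp) (by simp))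
    simp only [stdWeight, List.map_cons, List.sum_cons, List.length_cons] at hw hl
    obtain ⟨u, rfl⟩ := Nat.exists_eq_add_of_le hw
    set w' := (List.map (fun x => x.2 + 1) l).sum + u
    have hv : O.std l ∈ O.stdSpan d w' :=
      O.std_mem_stdSpan (by omega) (by simp only [stdWeight]; omega)
    set v := O.std l
    -- Terms that lost the outer summation: moving `E ^ i` to the left gives `Y i ^ (s + 1)` on `x`,
    -- which keeps the depth at most `d`.
    have lower : ∀ x ∈ O.stdSpan d w', ∀ i,
        (O.Y 0 ^ (s + 1)) ((O.E ^ i) x) ∈ O.shiftSpan (d + 1) (w' + (s + 1)) := by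
      intro x hx i
      rw [Y_pow_E_pow_apply, E_pow_mem_shiftSpan_iff]
      exact O.shiftSpan_mono d.le_succ le_rfl (ih _ (O.Y_pow_mem_stdSpan hx _ _))
    obtain ⟨N, hN⟩ := ih _ hv
    -- The term of full depth: `E ^ N` brings `v` into the span of shifted zeta vectors, and the
    -- extra `E` makes the outer inequality strict.
    have top : (O.Y 0 ^ (s + 1)) ((O.E ^ 1) (O.S ((O.E ^ N) v))) ∈
        O.shiftSpan (d + 1) (w' + (s + 1)) := by
      generalize (O.E ^ N) v = y at hN
      induction hN using span_induction with
      | mem y hy =>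
        obtain ⟨j, f, h1, h2, h3, rfl⟩ := hy
        have hj : (O.E ^ 1) ((O.E ^ j) (O.S (O.zetaVec f))) =
            O.E (O.S (O.zetaVec f)) - ∑ i ∈ Finset.range j, (O.E ^ (i + 1)) (O.zetaVec f) := by
          rw [← Module.End.mul_apply, ← pow_add, add_comm, E_pow_S_apply, Finset.sum_range_succ',
            E_S_apply, pow_zero, Module.End.one_apply]
          abel
        have hf : O.zetaVec f ∈ O.stdSpan d w' :=
          O.stdSpan_mono h1 h3 (O.zetaVec_mem_stdSpan h2)
        rw [S_E_pow_apply, hj, map_sub, map_sum]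
        refine sub_mem ?_ (sum_mem fun i _ => lower _ hf (i + 1))
        refine O.zetaSpan_le_shiftSpan _ _ (O.zetaSpan_mono ?_ ?_
          (O.Y_pow_E_S_zetaVec_mem_zetaSpan (s := s + 1) (by omega) h2))
        · omega
        · omega
      | zero => simp
      | add x y _ _ hx hy => simpa only [map_add] using add_mem hx hy
      | smul c x _ hx => simpa only [map_smul] using smul_mem _ c hx
    -- `E ^ a * S` is `S` without its first `a` shifts; `S` is then expanded to order `N + 1`, so
    -- that `E ^ N v` appears under a strict sum.
    have key : (O.E ^ a) (O.std ((a, s) :: l)) =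
        (O.Y 0 ^ (s + 1)) ((O.E ^ 1) (O.S ((O.E ^ N) v))) +
          ∑ i ∈ Finset.range (N + 1), (O.Y 0 ^ (s + 1)) ((O.E ^ i) v) -
          ∑ i ∈ Finset.range a, (O.Y 0 ^ (s + 1)) ((O.E ^ i) v) := by
      have h1 := O.Y_pow_E_pow_apply 0 (s + 1) a (O.S v)
      rw [zero_add] at h1
      rw [std, ← h1, E_pow_S_apply, S_E_pow_apply, ← Module.End.mul_apply (O.E ^ 1), ← pow_add,
        add_comm 1, E_pow_S_apply, map_sub, map_sub, map_sum, map_sum, sub_add_cancel]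
    have hw' : (List.map (fun x => x.2 + 1) l).sum + u + (s + 1) =
        s + 1 + (List.map (fun x => x.2 + 1) l).sum + u := by ring
    rw [SetLike.mem_coe, ← hw', ← O.E_pow_mem_shiftSpan_iff (n := a), key]
    exact sub_mem (add_mem top (sum_mem fun i _ => lower v hv i))
      (sum_mem fun i _ => lower v hv i)

/-! ### Linear maps that ignore shifts -/

variable {N : Type*} [AddCommGroup N] [Module ℚ N]

/-- Invariance is required on the vectors `O.std l` only: for words it is then a list of explicit
relations, and for sequences it concerns only generating functions with a known logarithmic
expansion. -/
theorem map_E_pow_eq {φ : M →ₗ[ℚ] N}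
    (hφ : ∀ j l, φ ((O.E ^ (j + 1)) (O.std l)) = φ ((O.E ^ j) (O.std l))) {d w : ℕ} {v : M}
    (hv : v ∈ O.stdSpan d w) (j : ℕ) : φ ((O.E ^ j) v) = φ v := by
  induction hv using span_induction with
  | mem x hx =>
    obtain ⟨l, -, rfl⟩ := hx
    induction j with
    | zero => simp
    | succ j ih => rw [hφ, ih]
  | zero => simp
  | add x y _ _ hx hy => simp only [map_add, hx, hy]
  | smul c x _ hx => simp only [map_smul, hx]

/-- A linear map that is invariant under the shifts of the vectors `O.std l` sends them to
combinations of the images of the vectors `O.zetaVec s`. -/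
theorem map_mem_span_zetaVec {φ : M →ₗ[ℚ] N}
    (hφ : ∀ j l, φ ((O.E ^ (j + 1)) (O.std l)) = φ ((O.E ^ j) (O.std l))) {d w : ℕ} {v : M}
    (hv : v ∈ O.stdSpan d w) :
    φ v ∈ span ℚ ((fun l => φ (O.zetaVec l)) ''
      {l | l.length ≤ d ∧ (∀ a ∈ l, 1 ≤ a) ∧ l.sum ≤ w}) := by
  obtain ⟨n, hn⟩ := O.stdSpan_le_shiftSpan d w hv
  rw [← O.map_E_pow_eq hφ hv n]
  generalize (O.E ^ n) v = x at hn
  induction hn using span_induction with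
  | mem x hx =>
    obtain ⟨j, l, h1, h2, h3, rfl⟩ := hx
    rw [O.map_E_pow_eq hφ (O.zetaVec_mem_stdSpan h2)]
    exact subset_span ⟨l, ⟨h1, h2, h3⟩, rfl⟩
  | zero => simp
  | add x y _ _ hx hy => simpa only [map_add] using add_mem hx hy
  | smul c x _ hx => simpa only [map_smul] using smul_mem _ c hx

theorem map_nested_mem_span_zetaVec {φ : M →ₗ[ℚ] N}
    (hφ : ∀ j l, φ ((O.E ^ (j + 1)) (O.std l)) = φ ((O.E ^ j) (O.std l)))
    {l : List (ℕ × ℕ × ℕ)} (h : excess l = 0) :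
    φ (O.nested l) ∈ span ℚ ((fun l => φ (O.zetaVec l)) ''
      {s | s.length ≤ l.length ∧ (∀ a ∈ s, 1 ≤ a) ∧ s.sum ≤ factorWeight l}) :=
  O.map_mem_span_zetaVec hφ (O.nested_mem_stdSpan h)

end SummationModule

/-! ### Words and relations -/

/-- Numerical codes of relations between words: a number that selects a relation, a prefix, a
suffix, and the parameters of the relation. -/
abbrev RelCode : Type := ℕ × (List ℕ × List ℕ) × ℕ × List (ℕ × ℕ)

/-- The word of the vector `SummationModule.std l`. The letters are `0` for `X`, `1` for `E`, `2`
for `S` and `a + 3` for `Y a`. -/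
def stdWord (l : List (ℕ × ℕ)) : List ℕ :=
  l.flatMap fun x => List.replicate (x.2 + 1) (x.1 + 3) ++ [2]

/-- The word of the vector `SummationModule.zetaVec s`. -/
def zetaWord (s : List ℕ) : List ℕ :=
  s.foldr (fun a w => List.replicate a 3 ++ if w = [] then [2] else 1 :: 2 :: w) []

/-- The word of the vector `SummationModule.nested l`. -/
def nestedWord (l : List (ℕ × ℕ × ℕ)) : List ℕ :=
  l.flatMap fun f => List.replicate f.2.2 0 ++
    ((SummationModule.shifts f.1 f.2.1).map (· + 3) ++ [2])

/-- The relations with given parameters; each says that a word equals the sum of some others. -/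
def relations (p : (List ℕ × List ℕ) × ℕ × List (ℕ × ℕ)) : List (List ℕ × List (List ℕ)) :=
  [(p.1.1 ++ p.1.2, (p.1.1 ++ 0 :: (p.2.1 + 3) :: p.1.2) ::
      List.replicate p.2.1 (p.1.1 ++ (p.2.1 + 3) :: p.1.2)),
    (p.1.1 ++ p.1.2, (p.1.1 ++ (p.2.1 + 3) :: 0 :: p.1.2) ::
      List.replicate p.2.1 (p.1.1 ++ (p.2.1 + 3) :: p.1.2)),
    (p.1.1 ++ 2 :: p.1.2, [p.1.1 ++ 1 :: 2 :: p.1.2, p.1.1 ++ p.1.2]),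
    (p.1.1 ++ 2 :: p.1.2, [p.1.1 ++ 2 :: 1 :: p.1.2, p.1.1 ++ p.1.2]),
    (p.1.1 ++ 0 :: 1 :: p.1.2, [p.1.1 ++ 1 :: 0 :: p.1.2, p.1.1 ++ 1 :: p.1.2]),
    (p.1.1 ++ [0], [p.1.1]),
    (List.replicate (p.2.1 + 1) 1 ++ stdWord p.2.2, [List.replicate p.2.1 1 ++ stdWord p.2.2])]

/-- The relation with a given code. -/
def relation (q : RelCode) : List ℕ × List (List ℕ) := (relations q.2).getD q.1 ([], [[]])

namespace SummationModule

open Submodule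

section Eval

variable {M : Type*} [AddCommGroup M] [Module ℚ M] (O : SummationModule M)

/-- The operator of a letter. -/
def letter : ℕ → Module.End ℚ M
  | 0 => O.X
  | 1 => O.E
  | 2 => O.S
  | a + 3 => O.Y a

/-- The operator of a word. -/
def wordOp (w : List ℕ) : Module.End ℚ M := (w.map O.letter).prod

/-- The vector of a word. -/
def eval (w : List ℕ) : M := O.wordOp w O.base

theorem wordOp_append (l r : List ℕ) : O.wordOp (l ++ r) = O.wordOp l * O.wordOp r := by
  simp [wordOp]

theorem wordOp_cons (c : ℕ) (r : List ℕ) : O.wordOp (c :: r) = O.letter c * O.wordOp r := by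
  simp [wordOp]

theorem wordOp_replicate (n c : ℕ) : O.wordOp (List.replicate n c) = O.letter c ^ n := by
  simp [wordOp]

theorem eval_append (l r : List ℕ) : O.eval (l ++ r) = O.wordOp l (O.eval r) := by
  rw [eval, wordOp_append]; rfl

theorem eval_cons (c : ℕ) (r : List ℕ) : O.eval (c :: r) = O.letter c (O.eval r) := by
  rw [eval, wordOp_cons]; rfl

theorem eval_nil : O.eval [] = O.base := rfl

theorem eval_stdWord (l : List (ℕ × ℕ)) : O.eval (stdWord l) = O.std l := by
  induction l with
  | nil => rfl
  | cons x l ih =>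
    rw [stdWord, List.flatMap_cons, List.append_assoc, eval_append, wordOp_replicate,
      List.singleton_append, eval_cons, ← stdWord, ih]
    rfl

theorem zetaWord_cons (a : ℕ) (s : List ℕ) :
    zetaWord (a :: s) = List.replicate a 3 ++ if s = [] then [2] else 1 :: 2 :: zetaWord s := by
  have h : zetaWord s = [] ↔ s = [] := by
    cases s with
    | nil => simp [zetaWord]
    | cons b s =>
      simp only [zetaWord, List.foldr_cons, List.append_eq_nil_iff, reduceCtorEq, iff_false,
        not_and]
      intro _
      split_ifs <;> simp
  rw [← if_congr h rfl rfl]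
  rfl

theorem eval_zetaWord (s : List ℕ) : O.eval (zetaWord s) = O.zetaVec s := by
  induction s with
  | nil => rfl
  | cons a s ih =>
    rw [zetaWord_cons, eval_append, wordOp_replicate]
    cases s with
    | nil => rfl
    | cons b s =>
      rw [if_neg (List.cons_ne_nil _ _), eval_cons, eval_cons, ih]
      rfl

theorem eval_nestedWord (l : List (ℕ × ℕ × ℕ)) : O.eval (nestedWord l) = O.nested l := by
  induction l with
  | nil => rfl
  | cons f l ih =>
    rw [nestedWord, List.flatMap_cons, List.append_assoc, List.append_assoc, eval_append,
      wordOp_replicate, eval_append, List.singleton_append, eval_cons, ← nestedWord, ih]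
    simp only [wordOp, List.map_map]
    rfl

/-- Kinds 0 to 5 hold in `M` itself. Kind 6 is the invariance of `φ`, which is known only for
outermost shifts, hence its lack of a prefix; larger kinds are the trivial default. Subtraction is
avoided and coefficients are repetitions, so that relations can be compared as multisets of words.
-/
theorem eval_relation {N : Type*} [AddCommGroup N] [Module ℚ N] {φ : M →ₗ[ℚ] N}
    (hφ : ∀ j l, φ ((O.E ^ (j + 1)) (O.std l)) = φ ((O.E ^ j) (O.std l))) (q : RelCode) :
    φ (O.eval (relation q).1) = ((relation q).2.map fun w => φ (O.eval w)).sum := by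
  obtain ⟨t, ⟨l, r⟩, a, m⟩ := q
  have key : ∀ U V : Module.End ℚ M, O.wordOp l (U (O.eval r)) + O.wordOp l (V (O.eval r)) =
      O.wordOp l ((U + V) (O.eval r)) := fun U V => by rw [LinearMap.add_apply, map_add]
  match t with
  | 0 =>
    have h : O.eval r = O.X (O.Y a (O.eval r)) + (a : ℚ) • O.Y a (O.eval r) := by
      have := LinearMap.congr_fun (O.X_add_mul_Y a) (O.eval r)
      simpa using this.symm
    simp only [relation, relations, List.getD_cons_zero, List.map_cons, List.map_replicate,
      List.sum_cons, List.sum_replicate, eval_append, eval_cons, letter]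
    conv_lhs => rw [h]
    rw [map_add, map_add, map_smul, map_smul, Nat.cast_smul_eq_nsmul]
  | 1 =>
    have h : O.eval r = O.Y a (O.X (O.eval r)) + (a : ℚ) • O.Y a (O.eval r) := by
      have := LinearMap.congr_fun (O.Y_mul_X_add a) (O.eval r)
      simpa using this.symm
    simp only [relation, relations, List.getD_cons_zero, List.getD_cons_succ, List.map_cons,
      List.map_replicate,
      List.sum_cons, List.sum_replicate, eval_append, eval_cons, letter]
    conv_lhs => rw [h]
    rw [map_add, map_add, map_smul, map_smul, Nat.cast_smul_eq_nsmul]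
  | 2 =>
    have h : O.S (O.eval r) = O.E (O.S (O.eval r)) + O.eval r := by rw [E_S_apply, sub_add_cancel]
    simp only [relation, relations, List.getD_cons_zero, List.getD_cons_succ, List.map_cons,
      List.map_nil, List.sum_cons, List.sum_nil, add_zero, eval_append, eval_cons, letter]
    conv_lhs => rw [h]
    rw [map_add, map_add]
  | 3 =>
    have h : O.S (O.eval r) = O.S (O.E (O.eval r)) + O.eval r := by
      have := LinearMap.congr_fun O.S_mul_E (O.eval r)
      exact (sub_eq_iff_eq_add.1 this.symm)
    simp only [relation, relations, List.getD_cons_zero, List.getD_cons_succ, List.map_cons,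
      List.map_nil, List.sum_cons, List.sum_nil, add_zero, eval_append, eval_cons, letter]
    conv_lhs => rw [h]
    rw [map_add, map_add]
  | 4 =>
    have h : O.X (O.E (O.eval r)) = O.E (O.X (O.eval r)) + O.E (O.eval r) :=
      LinearMap.congr_fun O.X_mul_E (O.eval r)
    simp only [relation, relations, List.getD_cons_zero, List.getD_cons_succ, List.map_cons,
      List.map_nil, List.sum_cons, List.sum_nil, add_zero, eval_append, eval_cons, letter]
    rw [h, map_add, map_add]
  | 5 =>
    simp only [relation, relations, List.getD_cons_zero, List.getD_cons_succ, List.map_cons,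
      List.map_nil, List.sum_cons, List.sum_nil, add_zero, eval_append, eval_cons, letter,
      eval_nil, O.X_base]
    rfl
  | 6 =>
    simp only [relation, relations, List.getD_cons_zero, List.getD_cons_succ, List.map_cons,
      List.map_nil, List.sum_cons, List.sum_nil, add_zero, eval_append, wordOp_replicate, letter,
      eval_stdWord, hφ]
  | t + 7 =>
    simp [relation, relations]

end Eval

/-! ### The universal summation module -/

section Formal

/-- The formal vector of a relation. -/
noncomputable def relVec (q : RelCode) : List ℕ →₀ ℚ :=
  Finsupp.single (relation q).1 1 - ((relation q).2.map fun w => Finsupp.single w 1).sum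

/-- The span of the relations that hold in all summation modules. -/
noncomputable def moduleRels : Submodule ℚ (List ℕ →₀ ℚ) := span ℚ (relVec '' {q | q.1 < 6})

/-- The span of all relations. -/
noncomputable def allRels : Submodule ℚ (List ℕ →₀ ℚ) := span ℚ (Set.range relVec)

theorem moduleRels_le_allRels : moduleRels ≤ allRels := span_mono (Set.image_subset_range _ _)

/-- The operator that puts a letter in front of a word. -/
noncomputable def consOp (c : ℕ) : (List ℕ →₀ ℚ) →ₗ[ℚ] (List ℕ →₀ ℚ) :=
  Finsupp.lmapDomain ℚ ℚ (List.cons c)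

theorem consOp_single (c : ℕ) (w : List ℕ) :
    consOp c (Finsupp.single w 1) = Finsupp.single (c :: w) 1 := by
  simp [consOp]

/-- These kinds of relations are stable under prefixing a letter, so letters act on the quotient by
`moduleRels`. Kind 6 has no prefix and is imposed only in `allRels`. -/
theorem consOp_relVec (c : ℕ) {t : ℕ} (ht : t < 6) (l r : List ℕ) (a : ℕ) (m : List (ℕ × ℕ)) :
    consOp c (relVec (t, (l, r), a, m)) = relVec (t, (c :: l, r), a, m) := by
  rw [relVec, map_sub, map_list_sum, List.map_map, consOp_single]
  interval_cases t <;> simp [relVec, relation, relations, consOp_single]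

theorem moduleRels_le_comap (c : ℕ) : moduleRels ≤ moduleRels.comap (consOp c) := by
  refine span_le.2 ?_
  rintro _ ⟨⟨t, ⟨l, r⟩, a, m⟩, ht, rfl⟩
  rw [SetLike.mem_coe, mem_comap, consOp_relVec c ht]
  exact subset_span ⟨(t, (c :: l, r), a, m), ht, rfl⟩

/-- The operator of a letter on the formal module. -/
noncomputable def formalOp (c : ℕ) : Module.End ℚ ((List ℕ →₀ ℚ) ⧸ moduleRels) :=
  moduleRels.mapQ moduleRels (consOp c) (moduleRels_le_comap c)

/-- The class of a word in the formal module. -/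
noncomputable def formalWord (w : List ℕ) : (List ℕ →₀ ℚ) ⧸ moduleRels :=
  moduleRels.mkQ (Finsupp.single w 1)

theorem formalOp_formalWord (c : ℕ) (w : List ℕ) :
    formalOp c (formalWord w) = formalWord (c :: w) := by
  rw [formalWord, formalOp, mkQ_apply, mapQ_apply, consOp_single]
  rfl

theorem formal_ext {P : Type*} [AddCommGroup P] [Module ℚ P]
    {f g : ((List ℕ →₀ ℚ) ⧸ moduleRels) →ₗ[ℚ] P} (h : ∀ w, f (formalWord w) = g (formalWord w)) :
    f = g := by
  refine linearMap_qext _ (Finsupp.lhom_ext' fun w => LinearMap.ext_ring ?_)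
  exact h w

theorem formalWord_relation (q : RelCode) (hq : q.1 < 6) :
    formalWord (relation q).1 = ((relation q).2.map formalWord).sum := by
  have h : moduleRels.mkQ (relVec q) = 0 :=
    (Quotient.mk_eq_zero _).2 (subset_span ⟨q, hq, rfl⟩)
  rw [relVec, map_sub, sub_eq_zero, map_list_sum, List.map_map] at h
  exact h

/-- The universal summation module. -/
noncomputable def formal : SummationModule ((List ℕ →₀ ℚ) ⧸ moduleRels) where
  X := formalOp 0
  E := formalOp 1
  S := formalOp 2
  Y a := formalOp (a + 3)
  base := formalWord []
  X_mul_Y a := formal_ext fun w => by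
    have h := formalWord_relation (0, ([], w), a, []) (by simp)
    simp only [relation, relations, List.getD_cons_zero, List.map_cons, List.map_replicate,
      List.sum_cons, List.sum_replicate, List.nil_append, ← Nat.cast_smul_eq_nsmul ℚ] at h
    simp only [Module.End.mul_apply, formalOp_formalWord, LinearMap.sub_apply,
      Module.End.one_apply, LinearMap.smul_apply]
    exact eq_sub_of_add_eq h.symm
  Y_mul_X a := formal_ext fun w => by
    have h := formalWord_relation (1, ([], w), a, []) (by simp)
    simp only [relation, relations, List.getD_cons_zero, List.getD_cons_succ, List.map_cons,
      List.map_replicate,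
      List.sum_cons, List.sum_replicate, List.nil_append, ← Nat.cast_smul_eq_nsmul ℚ] at h
    simp only [Module.End.mul_apply, formalOp_formalWord, LinearMap.sub_apply,
      Module.End.one_apply, LinearMap.smul_apply]
    exact eq_sub_of_add_eq h.symm
  E_mul_S := formal_ext fun w => by
    have h := formalWord_relation (2, ([], w), 0, []) (by simp)
    simp only [relation, relations, List.getD_cons_zero, List.getD_cons_succ, List.map_cons,
      List.map_nil, List.sum_cons, List.sum_nil, List.nil_append, add_zero] at h
    simp only [Module.End.mul_apply, formalOp_formalWord, LinearMap.sub_apply,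
      Module.End.one_apply]
    exact eq_sub_of_add_eq h.symm
  S_mul_E := formal_ext fun w => by
    have h := formalWord_relation (3, ([], w), 0, []) (by simp)
    simp only [relation, relations, List.getD_cons_zero, List.getD_cons_succ, List.map_cons,
      List.map_nil, List.sum_cons, List.sum_nil, List.nil_append, add_zero] at h
    simp only [Module.End.mul_apply, formalOp_formalWord, LinearMap.sub_apply,
      Module.End.one_apply]
    exact eq_sub_of_add_eq h.symm
  X_mul_E := formal_ext fun w => by
    have h := formalWord_relation (4, ([], w), 0, []) (by simp)
    simp only [relation, relations, List.getD_cons_zero, List.getD_cons_succ, List.map_cons,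
      List.map_nil, List.sum_cons, List.sum_nil, List.nil_append, add_zero] at h
    simp only [Module.End.mul_apply, formalOp_formalWord, LinearMap.add_apply]
    exact h
  X_base := by
    have h := formalWord_relation (5, ([], []), 0, []) (by simp)
    simp only [relation, relations, List.getD_cons_zero, List.getD_cons_succ, List.map_cons,
      List.map_nil, List.sum_cons, List.sum_nil, List.nil_append, add_zero] at h
    rw [formalOp_formalWord]
    exact h

theorem formal_letter (c : ℕ) : formal.letter c = formalOp c := by
  match c with
  | 0 => rfl
  | 1 => rfl
  | 2 => rfl
  | a + 3 => rfl

theorem formal_eval (w : List ℕ) : formal.eval w = formalWord w := by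
  induction w with
  | nil => rfl
  | cons c w ih => rw [eval_cons, ih, formal_letter, formalOp_formalWord]

/-- The reduction is applied to the universal module, with the quotient map that imposes kind 6 as
the shift-invariant map. It thereby becomes a statement about words alone. -/
theorem single_nestedWord_mem {l : List (ℕ × ℕ × ℕ)} (h : excess l = 0) :
    (Finsupp.single (nestedWord l) 1 : List ℕ →₀ ℚ) ∈
      span ℚ ((fun s => Finsupp.single (zetaWord s) 1) ''
        {s : List ℕ | s.length ≤ l.length ∧ (∀ a ∈ s, 1 ≤ a) ∧ s.sum ≤ factorWeight l}) ⊔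
      allRels := by
  set φ : ((List ℕ →₀ ℚ) ⧸ moduleRels) →ₗ[ℚ] ((List ℕ →₀ ℚ) ⧸ allRels) :=
    moduleRels.mapQ allRels LinearMap.id moduleRels_le_allRels
  have hw : ∀ w, φ (formal.eval w) = allRels.mkQ (Finsupp.single w 1) := fun w => by
    rw [formal_eval]; rfl
  have hφ : ∀ j m, φ ((formal.E ^ (j + 1)) (formal.std m)) = φ ((formal.E ^ j) (formal.std m)) := by
    intro j m
    have hE : ∀ i, (formal.E ^ i) (formal.std m) =
        formal.eval (List.replicate i 1 ++ stdWord m) := fun i => by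
      rw [eval_append, wordOp_replicate, eval_stdWord]; rfl
    rw [hE, hE, hw, hw, ← sub_eq_zero, ← map_sub]
    refine (Quotient.mk_eq_zero _).2 (subset_span ⟨(6, ([], []), j, m), ?_⟩)
    simp [relVec, relation, relations]
  have := formal.map_nested_mem_span_zetaVec hφ h
  rw [← eval_nestedWord, hw] at this
  simp only [← eval_zetaWord, hw] at this
  rw [sup_comm, ← comap_map_mkQ, mem_comap, map_span, Set.image_image]
  exact this

end Formal

end SummationModule

/-! ### Certificates -/

-- Denominators are cleared and signs are separated, so a rational combination becomes two lists.
-- The free factor `k` serves to bring two such representations to a common multiple.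
open Submodule in
theorem exists_lists_of_mem_span {V ι : Type*} [AddCommGroup V] [Module ℚ V] {f : ι → V}
    {s : Set ι} {x : V} (hx : x ∈ span ℚ (f '' s)) :
    ∃ N : ℕ, 0 < N ∧ ∀ k : ℕ, ∃ l l' : List ι, (∀ i ∈ l, i ∈ s) ∧ (∀ i ∈ l', i ∈ s) ∧
      (k * N) • x = (l.map f).sum - (l'.map f).sum := by
  have rep : ∀ (k : ℕ) (l : List ι), (∀ i ∈ l, i ∈ s) → ∃ m : List ι, (∀ i ∈ m, i ∈ s) ∧
      (m.map f).sum = k • (l.map f).sum := by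
    intro k l hl
    refine ⟨(List.replicate k l).flatten, ?_, ?_⟩
    · intro i hi
      obtain ⟨m, hm, hi⟩ := List.mem_flatten.1 hi
      exact hl i ((List.eq_of_mem_replicate hm) ▸ hi)
    · simp [List.map_flatten, List.sum_flatten]
  suffices h : ∃ N : ℕ, 0 < N ∧ ∃ l l' : List ι, (∀ i ∈ l, i ∈ s) ∧ (∀ i ∈ l', i ∈ s) ∧
      N • x = (l.map f).sum - (l'.map f).sum by
    obtain ⟨N, hN, l, l', hl, hl', h⟩ := h
    refine ⟨N, hN, fun k => ?_⟩
    obtain ⟨m, hm, hmk⟩ := rep k l hl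
    obtain ⟨m', hm', hmk'⟩ := rep k l' hl'
    exact ⟨m, m', hm, hm', by rw [mul_smul, h, hmk, hmk', smul_sub]⟩
  induction hx using span_induction with
  | mem x hx =>
    obtain ⟨i, hi, rfl⟩ := hx
    exact ⟨1, one_pos, [i], [], by simpa using hi, by simp, by simp⟩
  | zero => exact ⟨1, one_pos, [], [], by simp, by simp, by simp⟩
  | add x y _ _ hx hy =>
    obtain ⟨N, hN, l, l', hl, hl', h⟩ := hx
    obtain ⟨K, hK, m, m', hm, hm', h2⟩ := hy
    obtain ⟨a, ha, ha2⟩ := rep K l hl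
    obtain ⟨a', ha', ha2'⟩ := rep K l' hl'
    obtain ⟨b, hb, hb2⟩ := rep N m hm
    obtain ⟨b', hb', hb2'⟩ := rep N m' hm'
    refine ⟨N * K, by positivity, a ++ b, a' ++ b', ?_, ?_, ?_⟩
    · simpa [or_imp, forall_and] using ⟨ha, hb⟩
    · simpa [or_imp, forall_and] using ⟨ha', hb'⟩
    · rw [smul_add, mul_smul N K y, h2, mul_comm, mul_smul, h, List.map_append, List.map_append,
        List.sum_append, List.sum_append, ha2, ha2', hb2, hb2', smul_sub, smul_sub]
      abel
  | smul c x _ hx =>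
    obtain ⟨N, hN, l, l', hl, hl', h⟩ := hx
    have hc : (c.den * N) • c • x = c.num • N • x := by
      rw [← Nat.cast_smul_eq_nsmul ℚ, ← Nat.cast_smul_eq_nsmul ℚ, ← Int.cast_smul_eq_zsmul ℚ,
        smul_smul, smul_smul]
      congr 1
      push_cast
      rw [mul_right_comm, mul_comm (c.den : ℚ), Rat.mul_den_eq_num]
    refine ⟨c.den * N, Nat.mul_pos c.den_pos hN, ?_⟩
    rw [hc, h]
    obtain ⟨n, hn | hn⟩ := Int.eq_nat_or_neg c.num
    · obtain ⟨a, ha, ha2⟩ := rep n l hl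
      obtain ⟨a', ha', ha2'⟩ := rep n l' hl'
      exact ⟨a, a', ha, ha', by rw [hn, natCast_zsmul, ha2, ha2', smul_sub]⟩
    · obtain ⟨a, ha, ha2⟩ := rep n l hl
      obtain ⟨a', ha', ha2'⟩ := rep n l' hl'
      exact ⟨a', a, ha', ha, by rw [hn, neg_smul, natCast_zsmul, ha2, ha2', ← smul_sub, ← smul_neg,
        neg_sub]⟩

/-- Certificates `(b, (s, s'), (r, r'))` of an expression of a word, multiplied by `b + 1`, as the
difference of the sums of the words `zetaWord` of two lists, modulo relations. -/
abbrev Certificate : Type :=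
  ℕ × (List (List ℕ) × List (List ℕ)) × (List RelCode × List RelCode)

/-- The left-hand side of the identity claimed by a certificate for the word `w`. -/
def Certificate.lhs (w : List ℕ) (c : Certificate) : List (List ℕ) :=
  List.replicate (c.1 + 1) w ++ (c.2.1.2.map zetaWord ++
    (c.2.2.1.flatMap (fun q => (relation q).2) ++ c.2.2.2.map fun q => (relation q).1))

/-- The right-hand side of the identity claimed by a certificate. -/
def Certificate.rhs (c : Certificate) : List (List ℕ) :=
  c.2.1.1.map zetaWord ++
    (c.2.2.1.map (fun q => (relation q).1) ++ c.2.2.2.flatMap fun q => (relation q).2)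

/-- A permutation preserves the sum of the values of `v`, and both sides of a relation have the same
sum, so the relations cancel. -/
theorem Certificate.sound {N : Type*} [AddCommGroup N] {v : List ℕ → N}
    (hv : ∀ q : RelCode, v (relation q).1 = ((relation q).2.map v).sum) {w : List ℕ}
    {c : Certificate} (hc : (Certificate.lhs w c).Perm c.rhs) :
    (c.1 + 1) • v w = (c.2.1.1.map fun s => v (zetaWord s)).sum -
      (c.2.1.2.map fun s => v (zetaWord s)).sum := by
  have h := (hc.map v).sum_eq
  have h1 : ∀ r : List RelCode, ((r.flatMap fun q => (relation q).2).map v).sum =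
      (r.map fun q => v (relation q).1).sum := by
    intro r
    induction r with
    | nil => simp
    | cons q r ih => simp [ih, hv q]
  simp only [Certificate.lhs, Certificate.rhs, List.map_append, List.sum_append, h1,
    List.map_replicate, List.sum_replicate, List.map_map, Function.comp_def] at h
  rw [eq_sub_iff_add_eq]
  refine add_right_cancel (b := (c.2.2.1.map fun q => v (relation q).1).sum +
    (c.2.2.2.map fun q => v (relation q).1).sum) ?_
  rw [← h]
  abel

theorem exists_certificate {l : List (ℕ × ℕ × ℕ)} (h : SummationModule.excess l = 0) :
    ∃ c : Certificate, (Certificate.lhs (nestedWord l) c).Perm c.rhs ∧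
      ∀ s ∈ c.2.1.1 ++ c.2.1.2, s.length ≤ l.length ∧ (∀ a ∈ s, 1 ≤ a) ∧
        s.sum ≤ SummationModule.factorWeight l := by
  obtain ⟨y, hy, z, hz, hyz⟩ := Submodule.mem_sup.1 (SummationModule.single_nestedWord_mem h)
  rw [SummationModule.allRels, ← Set.image_univ] at hz
  obtain ⟨N, hN, hNy⟩ := exists_lists_of_mem_span hy
  obtain ⟨K, hK, hKz⟩ := exists_lists_of_mem_span hz
  obtain ⟨s, s', hs, hs', hss⟩ := hNy K
  obtain ⟨r, r', -, -, hrr⟩ := hKz N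
  -- A certificate stores the multiplier minus one, which keeps the multiplier positive.
  have hNK : K * N - 1 + 1 = K * N := Nat.sub_add_cancel (Nat.mul_pos hK hN)
  refine ⟨(K * N - 1, (s, s'), (r, r')), ?_, ?_⟩
  -- The coefficient of a word in a formal sum is its multiplicity, so an identity of formal sums is
  -- a permutation of lists.
  · have hsum : ∀ L : List (List ℕ), ∀ x, (L.map fun w => (Finsupp.single w 1 : List ℕ →₀ ℚ)).sum x
        = L.count x := by
      intro L x
      induction L with
      | nil => simp
      | cons w L ih =>
        rw [List.map_cons, List.sum_cons, Finsupp.add_apply, ih, List.count_cons,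
          Finsupp.single_apply, add_comm]
        simp
    have hrel : ∀ r : List RelCode, (r.map SummationModule.relVec).sum =
        (r.map fun q => (Finsupp.single (relation q).1 1 : List ℕ →₀ ℚ)).sum -
        ((r.flatMap fun q => (relation q).2).map fun w => Finsupp.single w 1).sum := by
      intro r
      induction r with
      | nil => simp
      | cons q r ih =>
        simp only [List.map_cons, List.sum_cons, ih, List.flatMap_cons, List.map_append,
          List.sum_append, SummationModule.relVec]
        abel
    have hmain : ((Certificate.lhs (nestedWord l) (K * N - 1, (s, s'), (r, r'))).map
          fun w => (Finsupp.single w 1 : List ℕ →₀ ℚ)).sum =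
        ((Certificate.rhs (K * N - 1, (s, s'), (r, r'))).map fun w => Finsupp.single w 1).sum := by
      have h1 := congrArg ((K * N) • ·) hyz
      simp only [smul_add, hss] at h1
      rw [mul_comm K N, hrr, hrel, hrel] at h1
      simp only [Certificate.lhs, Certificate.rhs, List.map_append, List.sum_append,
        List.map_replicate, List.sum_replicate, List.map_map, Function.comp_def, hNK]
      rw [mul_comm K N, ← h1]
      abel
    refine List.perm_iff_count.2 fun x => ?_
    have := DFunLike.congr_fun hmain x
    rw [hsum, hsum] at this
    exact_mod_cast this
  · intro t ht
    rcases List.mem_append.1 ht with ht | ht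
    · exact hs t ht
    · exact hs' t ht

/-! ### Logarithmic expansions at 1 -/

section Regularization

open Filter Topology Asymptotics

theorem nhdsWithin_ball_neBot : (𝓝[Metric.ball (0 : ℂ) 1] 1).NeBot := by
  rw [← mem_closure_iff_nhdsWithin_neBot, closure_ball _ one_ne_zero]
  simp

theorem tendsto_norm_one_sub :
    Tendsto (fun w : ℂ => ‖1 - w‖) (𝓝[Metric.ball (0 : ℂ) 1] 1) (𝓝[>] 0) := by
  refine tendsto_nhdsWithin_iff.2 ⟨?_, ?_⟩
  · have : Continuous fun w : ℂ => ‖1 - w‖ := by fun_prop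
    simpa using (this.tendsto 1).mono_left nhdsWithin_le_nhds
  · filter_upwards [self_mem_nhdsWithin] with w hw
    refine norm_pos_iff.2 (sub_ne_zero.2 ?_)
    rintro rfl
    simp at hw

theorem isBigO_norm_one_sub_rpow {a b : ℝ} (h : a ≤ b) :
    (fun w : ℂ => ‖1 - w‖ ^ b) =O[𝓝[Metric.ball (0 : ℂ) 1] 1] fun w => ‖1 - w‖ ^ a := by
  have h1 : ∀ᶠ x : ℝ in 𝓝[>] 0, ‖x ^ b‖ ≤ 1 * ‖x ^ a‖ := by
    filter_upwards [Ioo_mem_nhdsGT (zero_lt_one' ℝ)] with x hx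
    rw [one_mul, Real.norm_of_nonneg (Real.rpow_nonneg hx.1.le _),
      Real.norm_of_nonneg (Real.rpow_nonneg hx.1.le _)]
    exact Real.rpow_le_rpow_of_exponent_ge hx.1 hx.2.le h
  exact (IsBigO.of_bound 1 h1).comp_tendsto tendsto_norm_one_sub

theorem tendsto_norm_one_sub_rpow {a : ℝ} (h : 0 < a) :
    Tendsto (fun w : ℂ => ‖1 - w‖ ^ a) (𝓝[Metric.ball (0 : ℂ) 1] 1) (𝓝 0) := by
  have h1 : Tendsto (fun x : ℝ => x ^ a) (𝓝[>] 0) (𝓝 0) := by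
    have := (Real.continuousAt_rpow_const 0 a (Or.inr h.le)).tendsto
    rw [Real.zero_rpow h.ne'] at this
    exact this.mono_left nhdsWithin_le_nhds
  exact h1.comp tendsto_norm_one_sub

theorem tendsto_norm_log_one_sub :
    Tendsto (fun w : ℂ => ‖Complex.log (1 - w)‖) (𝓝[Metric.ball (0 : ℂ) 1] 1) atTop := by
  have h : Tendsto (fun w : ℂ => |Real.log ‖1 - w‖|) (𝓝[Metric.ball (0 : ℂ) 1] 1) atTop :=
    tendsto_abs_atBot_atTop.comp (Real.tendsto_log_nhdsGT_zero.comp tendsto_norm_one_sub)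
  refine tendsto_atTop_mono (fun w => ?_) h
  rw [← Complex.log_re]
  exact Complex.abs_re_le_norm _

theorem isBigO_log_one_sub {δ : ℝ} (hδ : 0 < δ) :
    (fun w : ℂ => Complex.log (1 - w)) =O[𝓝[Metric.ball (0 : ℂ) 1] 1]
      fun w => ‖1 - w‖ ^ (-δ) := by
  have h1 : (fun w : ℂ => Real.log ‖1 - w‖) =O[𝓝[Metric.ball (0 : ℂ) 1] 1]
      fun w => ‖1 - w‖ ^ (-δ) :=
    ((isLittleO_log_rpow_nhdsGT_zero (neg_lt_zero.2 hδ)).comp_tendsto tendsto_norm_one_sub).isBigO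
  have h2 : (fun _ : ℂ => Real.pi) =O[𝓝[Metric.ball (0 : ℂ) 1] 1] fun w => ‖1 - w‖ ^ (-δ) := by
    refine IsBigO.trans ?_ (isBigO_norm_one_sub_rpow (neg_nonpos.2 hδ.le))
    simpa using isBigO_const_const Real.pi (one_ne_zero' ℝ) _
  refine IsBigO.trans (IsBigO.of_bound 1 (Eventually.of_forall fun w => ?_))
    (h1.norm_left.add h2)
  rw [one_mul, Real.norm_of_nonneg (add_nonneg (norm_nonneg _) Real.pi_pos.le)]
  refine (Complex.norm_le_abs_re_add_abs_im _).trans (add_le_add ?_ ?_)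
  · rw [Complex.log_re]; rfl
  · rw [Complex.log_im]; exact Complex.abs_arg_le_pi _

theorem isBigO_eval_log_one_sub (Q : Polynomial ℂ) {δ : ℝ} (hδ : 0 < δ) :
    (fun w : ℂ => Q.eval (Complex.log (1 - w))) =O[𝓝[Metric.ball (0 : ℂ) 1] 1]
      fun w => ‖1 - w‖ ^ (-δ) := by
  induction Q using Polynomial.induction_on' with
  | add P Q hP hQ => simpa only [Polynomial.eval_add] using hP.add hQ
  | monomial n c =>
    simp only [Polynomial.eval_monomial]
    refine IsBigO.const_mul_left ?_ c
    have hn : (0 : ℝ) < n + 1 := by positivity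
    -- Dividing by `n + 1` instead of `n` includes `n = 0`; the `n` factors still cost at most `δ`.
    have h := (isBigO_log_one_sub (div_pos hδ hn)).pow n
    refine h.trans (IsBigO.trans (IsBigO.of_bound 1 ?_)
      (isBigO_norm_one_sub_rpow (a := -δ) (b := -(δ / (n + 1)) * n) ?_))
    · refine Eventually.of_forall fun w => ?_
      rw [one_mul, Real.rpow_mul (norm_nonneg _), Real.rpow_natCast]
    · rw [neg_mul, neg_le_neg_iff, div_mul_eq_mul_div, div_le_iff₀ hn]
      nlinarith

/-- A nonconstant polynomial in `log (1 - w)` is unbounded near 1, so a difference of expansion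
polynomials that tends to zero must vanish. -/
theorem IsLogExpansion.unique {g : ℂ → ℂ} {Q R : Polynomial ℂ} (hQ : IsLogExpansion g Q)
    (hR : IsLogExpansion g R) : Q = R := by
  obtain ⟨ε, hε, hQ⟩ := hQ
  obtain ⟨ε', hε', hR⟩ := hR
  have := nhdsWithin_ball_neBot
  have h : Tendsto (fun w : ℂ => (Q - R).eval (Complex.log (1 - w)))
      (𝓝[Metric.ball (0 : ℂ) 1] 1) (𝓝 0) := by
    have := (hR.trans_tendsto (tendsto_norm_one_sub_rpow hε')).sub
      (hQ.trans_tendsto (tendsto_norm_one_sub_rpow hε))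
    simpa using this
  by_cases hd : 0 < (Q - R).degree
  · exact absurd h.norm (not_tendsto_nhds_of_tendsto_atTop
      ((Q - R).tendsto_norm_atTop hd tendsto_norm_log_one_sub) _)
  · rw [Polynomial.eq_C_of_degree_le_zero (not_lt.1 hd)] at h
    simp only [Polynomial.eval_C] at h
    have h0 := tendsto_nhds_unique tendsto_const_nhds h
    have := Polynomial.eq_C_of_degree_le_zero (not_lt.1 hd)
    rw [h0, map_zero] at this
    exact sub_eq_zero.1 this

theorem IsLogExpansion.regValue_eq {g : ℂ → ℂ} {Q : Polynomial ℂ} (h : IsLogExpansion g Q) :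
    regValue g = Q.eval 0 := by
  have hg : AtMostLogDivergent g := ⟨Q, h⟩
  rw [regValue, dif_pos hg, hg.choose_spec.unique h]

theorem IsLogExpansion.add {f g : ℂ → ℂ} {Q R : Polynomial ℂ} (hf : IsLogExpansion f Q)
    (hg : IsLogExpansion g R) : IsLogExpansion (fun w => f w + g w) (Q + R) := by
  obtain ⟨ε, hε, hQ⟩ := hf
  obtain ⟨ε', hε', hR⟩ := hg
  refine ⟨min ε ε', lt_min hε hε', ?_⟩
  refine ((hQ.trans (isBigO_norm_one_sub_rpow (min_le_left ε ε'))).add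
    (hR.trans (isBigO_norm_one_sub_rpow (min_le_right ε ε')))).congr_left fun w => ?_
  rw [Polynomial.eval_add]
  ring

theorem IsLogExpansion.const_mul {f : ℂ → ℂ} {Q : Polynomial ℂ} (hf : IsLogExpansion f Q)
    (c : ℂ) : IsLogExpansion (fun w => c * f w) (Polynomial.C c * Q) := by
  obtain ⟨ε, hε, hQ⟩ := hf
  refine ⟨ε, hε, (hQ.const_mul_left c).congr_left fun w => ?_⟩
  rw [Polynomial.eval_mul, Polynomial.eval_C]
  ring

theorem isLogExpansion_zero : IsLogExpansion (fun _ => 0) 0 :=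
  ⟨1, one_pos, by simpa using isBigO_zero _ _⟩

theorem isLogExpansion_one : IsLogExpansion (fun _ => 1) 1 :=
  ⟨1, one_pos, by simpa using isBigO_zero _ _⟩

theorem IsLogExpansion.congr {f g : ℂ → ℂ} {Q : Polynomial ℂ} (hf : IsLogExpansion f Q)
    (h : f =ᶠ[𝓝[Metric.ball (0 : ℂ) 1] 1] g) : IsLogExpansion g Q := by
  obtain ⟨ε, hε, hQ⟩ := hf
  exact ⟨ε, hε, hQ.congr' (h.mono fun w hw => by simp only [hw]) EventuallyEq.rfl⟩

/-- The analytic source of shift invariance: with `L = log (1 - w)`, `w * f - Q(L) = w * (f - Q(L))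
- (1 - w) * Q(L)`, and `1 - w` outweighs the logarithms. Any exponent strictly between 0 and 1 could
replace `1 / 2`. -/
theorem IsLogExpansion.mul_self {f : ℂ → ℂ} {Q : Polynomial ℂ} (hf : IsLogExpansion f Q) :
    IsLogExpansion (fun w => w * f w) Q := by
  obtain ⟨ε, hε, hQ⟩ := hf
  refine ⟨min ε (1 / 2), lt_min hε (by norm_num), ?_⟩
  have h1 : (fun w : ℂ => w) =O[𝓝[Metric.ball (0 : ℂ) 1] 1] fun _ => (1 : ℝ) :=
    (continuous_id.tendsto (1 : ℂ)).mono_left nhdsWithin_le_nhds |>.isBigO_one ℝ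
  have h2 := (h1.mul hQ).trans_eventuallyEq
    (Eventually.of_forall fun w => one_mul _ : _ =ᶠ[_] fun w : ℂ => ‖1 - w‖ ^ ε)
  have h3 : (fun w : ℂ => (1 - w) * Q.eval (Complex.log (1 - w)))
      =O[𝓝[Metric.ball (0 : ℂ) 1] 1] fun w => ‖1 - w‖ ^ (1 / 2 : ℝ) := by
    have h4 : (fun w : ℂ => 1 - w) =O[𝓝[Metric.ball (0 : ℂ) 1] 1] fun w => ‖1 - w‖ :=
      (isBigO_refl _ _).norm_right
    refine (h4.mul (isBigO_eval_log_one_sub Q (δ := 1 / 2) (by norm_num))).trans_eventuallyEq ?_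
    filter_upwards [tendsto_norm_one_sub self_mem_nhdsWithin] with w hw
    have hw : 0 < ‖1 - w‖ := hw
    nth_rewrite 1 [← Real.rpow_one ‖1 - w‖]
    rw [← Real.rpow_add hw]
    norm_num
  refine ((h2.trans (isBigO_norm_one_sub_rpow (min_le_left _ _))).sub
    (h3.trans (isBigO_norm_one_sub_rpow (min_le_right _ _)))).congr_left fun w => ?_
  ring

end Regularization

/-! ### Sequences and their generating functions -/

section Sequences

/-- Sequences bounded by a polynomial. -/
def PolyBounded (u : ℕ → ℂ) : Prop := ∃ C : ℝ, ∃ n : ℕ, ∀ j, ‖u j‖ ≤ C * ((j : ℝ) + 1) ^ n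

/-- The generating function `∑ u(k) w ^ k`; the entry `u j` is the value of the sequence at
`k = j + 1`. -/
noncomputable def genFun (u : ℕ → ℂ) (w : ℂ) : ℂ := ∑' j, u j * w ^ (j + 1)

theorem PolyBounded.exists_nonneg {u : ℕ → ℂ} (hu : PolyBounded u) :
    ∃ C : ℝ, 0 ≤ C ∧ ∃ n : ℕ, ∀ j, ‖u j‖ ≤ C * ((j : ℝ) + 1) ^ n := by
  obtain ⟨C, n, h⟩ := hu
  exact ⟨C, by simpa using (norm_nonneg _).trans (h 0), n, h⟩

theorem summable_poly_geometric {r : ℝ} (h0 : 0 ≤ r) (h1 : r < 1) (n : ℕ) :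
    Summable fun j : ℕ => ((j : ℝ) + 1) ^ n * r ^ j := by
  have hr : ‖r‖ < 1 := by rwa [Real.norm_of_nonneg h0]
  rcases h0.eq_or_lt with h0 | h0
  · subst h0
    refine summable_of_ne_finset_zero (s := {0}) fun j hj => ?_
    rw [zero_pow (Finset.notMem_singleton.1 hj), mul_zero]
  have h1 := summable_pow_mul_geometric_of_norm_lt_one (R := ℝ) n hr
  have h2 := (summable_nat_add_iff (f := fun j : ℕ => (j : ℝ) ^ n * r ^ j) 1).2 h1
  refine (h2.mul_left r⁻¹).congr fun j => ?_
  rw [Nat.cast_add_one, pow_succ r, mul_comm r⁻¹, mul_assoc, mul_assoc, mul_inv_cancel₀ h0.ne',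
    mul_one]

theorem PolyBounded.summable_norm {u : ℕ → ℂ} (hu : PolyBounded u) {w : ℂ} (hw : ‖w‖ < 1) :
    Summable fun j => ‖u j * w ^ (j + 1)‖ := by
  obtain ⟨C, n, h⟩ := hu
  refine Summable.of_nonneg_of_le (fun _ => norm_nonneg _) (fun j => ?_)
    (((summable_poly_geometric (norm_nonneg w) hw n).mul_left C).mul_right ‖w‖)
  rw [norm_mul, norm_pow, pow_succ, ← mul_assoc, ← mul_assoc]
  gcongr
  exact h j

theorem PolyBounded.summable {u : ℕ → ℂ} (hu : PolyBounded u) {w : ℂ} (hw : ‖w‖ < 1) :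
    Summable fun j => u j * w ^ (j + 1) := (hu.summable_norm hw).of_norm

theorem PolyBounded.add {u v : ℕ → ℂ} (hu : PolyBounded u) (hv : PolyBounded v) :
    PolyBounded (u + v) := by
  obtain ⟨C, hC, n, h⟩ := hu.exists_nonneg
  obtain ⟨C', hC', n', h'⟩ := hv.exists_nonneg
  refine ⟨C + C', n + n', fun j => ?_⟩
  have hj : (1 : ℝ) ≤ (j : ℝ) + 1 := by simp
  rw [add_mul]
  refine (norm_add_le _ _).trans (add_le_add ((h j).trans ?_) ((h' j).trans ?_))
  · gcongr
    omega
  · gcongr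
    omega

theorem PolyBounded.smul {u : ℕ → ℂ} (hu : PolyBounded u) (c : ℂ) : PolyBounded (c • u) := by
  obtain ⟨C, n, h⟩ := hu
  refine ⟨‖c‖ * C, n, fun j => ?_⟩
  rw [Pi.smul_apply, norm_smul, mul_assoc]
  gcongr
  exact h j

theorem polyBounded_of_le {u v : ℕ → ℂ} (hv : PolyBounded v) (h : ∀ j, ‖u j‖ ≤ ‖v j‖) :
    PolyBounded u := by
  obtain ⟨C, n, h'⟩ := hv
  exact ⟨C, n, fun j => (h j).trans (h' j)⟩

theorem genFun_add {u v : ℕ → ℂ} (hu : PolyBounded u) (hv : PolyBounded v) {w : ℂ}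
    (hw : ‖w‖ < 1) : genFun (u + v) w = genFun u w + genFun v w := by
  rw [genFun, genFun, genFun, ← (hu.summable hw).tsum_add (hv.summable hw)]
  simp only [Pi.add_apply, add_mul]

theorem genFun_smul (u : ℕ → ℂ) (c w : ℂ) : genFun (c • u) w = c * genFun u w := by
  rw [genFun, genFun, ← tsum_mul_left]
  simp only [Pi.smul_apply, smul_eq_mul, mul_assoc]

/-- Multiplication of a sequence by `k`. -/
def mulOp : (ℕ → ℂ) →ₗ[ℂ] ℕ → ℂ where
  toFun u j := ((j : ℂ) + 1) * u j
  map_add' u v := by ext j; simp [mul_add]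
  map_smul' c u := by ext j; simp [mul_left_comm]

/-- Multiplication of a sequence by `1 / (k + a)`. -/
noncomputable def divOp (a : ℕ) : (ℕ → ℂ) →ₗ[ℂ] ℕ → ℂ where
  toFun u j := u j / ((j : ℂ) + 1 + a)
  map_add' u v := by ext j; simp [add_div]
  map_smul' c u := by ext j; simp [mul_div_assoc]

/-- Partial sums of a sequence. -/
def sumOp : (ℕ → ℂ) →ₗ[ℂ] ℕ → ℂ where
  toFun u j := ∑ i ∈ Finset.range (j + 1), u i
  map_add' u v := by ext j; simp [Finset.sum_add_distrib]
  map_smul' c u := by ext j; simp [Finset.mul_sum]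

/-- Backward shift of a sequence. -/
def shiftOp : (ℕ → ℂ) →ₗ[ℂ] ℕ → ℂ where
  toFun u j := if j = 0 then 0 else u (j - 1)
  map_add' u v := by ext j; by_cases h : j = 0 <;> simp [h]
  map_smul' c u := by ext j; by_cases h : j = 0 <;> simp [h]

theorem mulOp_apply (u : ℕ → ℂ) (j : ℕ) : mulOp u j = ((j : ℂ) + 1) * u j := rfl

theorem divOp_apply (a : ℕ) (u : ℕ → ℂ) (j : ℕ) : divOp a u j = u j / ((j : ℂ) + 1 + a) := rfl

theorem sumOp_apply (u : ℕ → ℂ) (j : ℕ) : sumOp u j = ∑ i ∈ Finset.range (j + 1), u i := rfl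

theorem shiftOp_zero (u : ℕ → ℂ) : shiftOp u 0 = 0 := rfl

theorem shiftOp_succ (u : ℕ → ℂ) (j : ℕ) : shiftOp u (j + 1) = u j := rfl

theorem add_one_add_ne_zero (j a : ℕ) : (j : ℂ) + 1 + a ≠ 0 := by
  have : ((j + 1 + a : ℕ) : ℂ) ≠ 0 := Nat.cast_ne_zero.2 (by omega)
  exact_mod_cast this

theorem shiftOp_sumOp (u : ℕ → ℂ) : shiftOp (sumOp u) = sumOp u - u := by
  ext j
  cases j with
  | zero => simp [shiftOp_zero, sumOp_apply]
  | succ j => simp [shiftOp_succ, sumOp_apply, Finset.sum_range_succ _ (j + 1)]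

theorem sumOp_shiftOp (u : ℕ → ℂ) : sumOp (shiftOp u) = sumOp u - u := by
  ext j
  rw [sumOp_apply, Finset.sum_range_succ']
  simp only [shiftOp_succ, shiftOp_zero, Pi.sub_apply, sumOp_apply, Finset.sum_range_succ _ j]
  ring

/-- The summation module of complex sequences. -/
noncomputable def seqModule : SummationModule (ℕ → ℂ) where
  X := mulOp.restrictScalars ℚ
  E := shiftOp.restrictScalars ℚ
  S := sumOp.restrictScalars ℚ
  Y a := (divOp a).restrictScalars ℚ
  base := Pi.single 0 1
  X_mul_Y a := by
    ext1 u
    funext j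
    have := add_one_add_ne_zero j a
    simp only [Module.End.mul_apply, LinearMap.coe_restrictScalars, mulOp_apply, divOp_apply,
      LinearMap.sub_apply, LinearMap.smul_apply, Module.End.one_apply, Pi.sub_apply,
      Pi.smul_apply, Rat.smul_def, Rat.cast_natCast]
    field_simp
    ring
  Y_mul_X a := by
    ext1 u
    funext j
    have := add_one_add_ne_zero j a
    simp only [Module.End.mul_apply, LinearMap.coe_restrictScalars, mulOp_apply, divOp_apply,
      LinearMap.sub_apply, LinearMap.smul_apply, Module.End.one_apply, Pi.sub_apply,
      Pi.smul_apply, Rat.smul_def, Rat.cast_natCast]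
    field_simp
    ring
  E_mul_S := by ext1 u; exact shiftOp_sumOp u
  S_mul_E := by ext1 u; exact sumOp_shiftOp u
  X_mul_E := by
    ext1 u
    funext j
    simp only [Module.End.mul_apply, LinearMap.coe_restrictScalars, LinearMap.add_apply,
      Pi.add_apply, mulOp_apply]
    cases j with
    | zero => simp [shiftOp_zero]
    | succ j => simp only [shiftOp_succ, mulOp_apply]; push_cast; ring
  X_base := by
    ext j
    simp only [LinearMap.coe_restrictScalars, mulOp_apply]
    cases j with
    | zero => simp
    | succ j => simp

theorem PolyBounded.mulOp {u : ℕ → ℂ} (hu : PolyBounded u) : PolyBounded (mulOp u) := by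
  obtain ⟨C, n, h⟩ := hu
  refine ⟨C, n + 1, fun j => ?_⟩
  have hj : ‖(j : ℂ) + 1‖ = (j : ℝ) + 1 := by
    rw [← Nat.cast_add_one, Complex.norm_natCast, Nat.cast_add_one]
  rw [mulOp_apply, norm_mul, pow_succ', hj, mul_left_comm]
  gcongr
  exact h j

theorem norm_add_one_add (j a : ℕ) : ‖(j : ℂ) + 1 + a‖ = (j : ℝ) + 1 + a := by
  have : ‖((j + 1 + a : ℕ) : ℂ)‖ = ((j + 1 + a : ℕ) : ℝ) := Complex.norm_natCast _
  exact_mod_cast this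

theorem norm_divOp_le (a : ℕ) (u : ℕ → ℂ) (j : ℕ) : ‖divOp a u j‖ ≤ ‖u j‖ / ((j : ℝ) + 1) := by
  rw [divOp_apply, norm_div, norm_add_one_add]
  exact div_le_div_of_nonneg_left (norm_nonneg _) (by positivity) (by simp)

theorem PolyBounded.divOp {u : ℕ → ℂ} (hu : PolyBounded u) (a : ℕ) : PolyBounded (divOp a u) :=
  polyBounded_of_le hu fun j => (norm_divOp_le a u j).trans
    (div_le_self (norm_nonneg _) (by simp))

theorem PolyBounded.sumOp {u : ℕ → ℂ} (hu : PolyBounded u) : PolyBounded (sumOp u) := by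
  obtain ⟨C, hC, n, h⟩ := hu.exists_nonneg
  refine ⟨C, n + 1, fun j => ?_⟩
  show ‖∑ i ∈ Finset.range (j + 1), u i‖ ≤ _
  refine (norm_sum_le _ _).trans ((Finset.sum_le_card_nsmul _ _ (C * ((j : ℝ) + 1) ^ n) ?_).trans ?_)
  · intro i hi
    have : i ≤ j := Nat.lt_succ_iff.1 (Finset.mem_range.1 hi)
    refine (h i).trans ?_
    gcongr
  · rw [Finset.card_range, nsmul_eq_mul, pow_succ']
    push_cast
    exact (by ring : _ = _).le

theorem PolyBounded.shiftOp {u : ℕ → ℂ} (hu : PolyBounded u) : PolyBounded (shiftOp u) := by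
  obtain ⟨C, hC, n, h⟩ := hu.exists_nonneg
  refine ⟨C, n, fun j => ?_⟩
  cases j with
  | zero => rw [shiftOp_zero, norm_zero]; positivity
  | succ j =>
    rw [shiftOp_succ]
    refine (h j).trans ?_
    gcongr
    simp

theorem polyBounded_base : PolyBounded seqModule.base := by
  refine ⟨1, 0, fun j => ?_⟩
  cases j with
  | zero => simp [seqModule]
  | succ j => simp [seqModule]

/-- Every letter preserves polynomial growth, so the generating functions of all words converge on
the disc. -/
theorem polyBounded_eval (w : List ℕ) : PolyBounded (seqModule.eval w) := by
  induction w with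
  | nil => exact polyBounded_base
  | cons c w ih =>
    rw [SummationModule.eval_cons]
    match c with
    | 0 => exact ih.mulOp
    | 1 => exact ih.shiftOp
    | 2 => exact ih.sumOp
    | a + 3 => exact ih.divOp a

theorem genFun_shiftOp {u : ℕ → ℂ} (hu : PolyBounded u) {w : ℂ} (hw : ‖w‖ < 1) :
    genFun (shiftOp u) w = w * genFun u w := by
  rw [genFun, (hu.shiftOp.summable hw).tsum_eq_zero_add, shiftOp_zero, zero_mul, zero_add, genFun,
    ← tsum_mul_left]
  refine tsum_congr fun j => ?_
  rw [shiftOp_succ, pow_succ]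
  ring

theorem genFun_sumOp {u : ℕ → ℂ} (hu : PolyBounded u) {w : ℂ} (hw : ‖w‖ < 1) :
    (1 - w) * genFun (sumOp u) w = genFun u w := by
  have h := genFun_add hu.sumOp.shiftOp hu hw
  rw [shiftOp_sumOp, sub_add_cancel, ← shiftOp_sumOp, genFun_shiftOp hu.sumOp hw] at h
  rw [sub_mul, one_mul]
  exact sub_eq_of_eq_add' h

end Sequences

/-! ### Asymptotics of the coefficients -/

/-- The sequences that are `O(f)`. -/
def decay (f : ℕ → ℝ) : Submodule ℂ (ℕ → ℂ) where
  carrier := {u | ∃ C : ℝ, ∀ j, ‖u j‖ ≤ C * f j}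
  zero_mem' := ⟨0, fun j => by simp⟩
  add_mem' := by
    rintro u v ⟨C, hu⟩ ⟨C', hv⟩
    exact ⟨C + C', fun j => by
      rw [add_mul]; exact (norm_add_le _ _).trans (add_le_add (hu j) (hv j))⟩
  smul_mem' := by
    rintro c u ⟨C, hu⟩
    refine ⟨‖c‖ * C, fun j => ?_⟩
    rw [Pi.smul_apply, norm_smul, mul_assoc]
    exact mul_le_mul_of_nonneg_left (hu j) (norm_nonneg _)

/-- The sequence `k ^ (-1/2)`. -/
noncomputable def slow (j : ℕ) : ℝ := (√((j : ℝ) + 1))⁻¹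

/-- The sequence `k ^ (-3/2)`. -/
noncomputable def fast (j : ℕ) : ℝ := slow j / ((j : ℝ) + 1)

theorem slow_pos (j : ℕ) : 0 < slow j := inv_pos.2 (Real.sqrt_pos.2 (by positivity))

theorem fast_pos (j : ℕ) : 0 < fast j := div_pos (slow_pos j) (by positivity)

theorem slow_le_one (j : ℕ) : slow j ≤ 1 :=
  inv_le_one_of_one_le₀ (Real.one_le_sqrt.2 (by simp))

theorem fast_le_slow (j : ℕ) : fast j ≤ slow j := div_le_self (slow_pos j).le (by simp)

/-- With `fast_succ_le`, a telescoping substitute for comparison with the integrals of `x ^ (-1/2)`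
and `x ^ (-3/2)`. -/
theorem slow_le_diff_sqrt (j : ℕ) : slow j ≤ 2 * (√((j : ℝ) + 1) - √(j : ℝ)) := by
  have h1 : 0 < √((j : ℝ) + 1) := Real.sqrt_pos.2 (by positivity)
  have h2 := Real.sq_sqrt (show 0 ≤ (j : ℝ) + 1 by positivity)
  have h3 := Real.sq_sqrt (show 0 ≤ (j : ℝ) by positivity)
  rw [slow, inv_le_iff_one_le_mul₀ h1]
  nlinarith [sq_nonneg (√((j : ℝ) + 1) - √(j : ℝ))]

theorem sum_slow_le (n : ℕ) : ∑ i ∈ Finset.range n, slow i ≤ 2 * √(n : ℝ) := by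
  induction n with
  | zero => simp
  | succ n ih =>
    rw [Finset.sum_range_succ]
    have := slow_le_diff_sqrt n
    push_cast
    linarith

theorem fast_succ_le (j : ℕ) : fast (j + 1) ≤ 2 * (slow j - slow (j + 1)) := by
  have h1 : 0 < √((j : ℝ) + 1) := Real.sqrt_pos.2 (by positivity)
  have h4 : √((j : ℝ) + 1) ≤ √((j : ℝ) + 1 + 1) := Real.sqrt_le_sqrt (by simp)
  have h2 := Real.sq_sqrt (show 0 ≤ (j : ℝ) + 1 by positivity)
  have h3 := Real.sq_sqrt (show 0 ≤ (j : ℝ) + 1 + 1 by positivity)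
  rw [fast, slow, slow]
  push_cast
  set a := √((j : ℝ) + 1)
  set b := √((j : ℝ) + 1 + 1)
  have hb : 0 < b := h1.trans_le h4
  rw [← h3, inv_sub_inv h1.ne' hb.ne', mul_div_assoc', ← one_div, div_div,
    div_le_div_iff₀ (by positivity) (by positivity)]
  have h5 : (b - a) * (b + a) = 1 := by nlinarith
  have h6 : 0 ≤ b - a := sub_nonneg.2 h4
  calc 1 * (a * b) = (a * b) * ((b - a) * (b + a)) := by rw [h5, mul_one, one_mul]
    _ ≤ (b * b) * ((b - a) * (b + b)) := by gcongr
    _ = 2 * (b - a) * (b * b ^ 2) := by ring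

theorem sum_fast_le (m n : ℕ) : ∑ i ∈ Finset.range n, fast (i + (m + 1)) ≤ 2 * slow m := by
  suffices h : ∑ i ∈ Finset.range n, fast (i + (m + 1)) ≤ 2 * (slow m - slow (m + n)) by
    linarith [slow_pos (m + n)]
  induction n with
  | zero => simp
  | succ n ih =>
    rw [Finset.sum_range_succ]
    have := fast_succ_le (m + n)
    rw [show n + (m + 1) = m + n + 1 by ring, ← add_assoc]
    linarith

theorem summable_fast : Summable fast := by
  refine (summable_nat_add_iff (f := fast) 1).1 ?_
  exact summable_of_sum_range_le (fun _ => (fast_pos _).le) (sum_fast_le 0)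

theorem tsum_fast_le (m : ℕ) : ∑' i, fast (i + (m + 1)) ≤ 2 * slow m :=
  Real.tsum_le_of_sum_range_le (fun _ => (fast_pos _).le) (sum_fast_le m)

theorem decay_fast_le : decay fast ≤ decay slow := by
  rintro u ⟨C, hu⟩
  refine ⟨|C|, fun j => (hu j).trans ?_⟩
  exact mul_le_mul (le_abs_self C) (fast_le_slow j) (fast_pos j).le (abs_nonneg C)

theorem polyBounded_of_mem_decay {u : ℕ → ℂ} (hu : u ∈ decay slow) : PolyBounded u := by
  obtain ⟨C, hu⟩ := hu
  refine ⟨|C|, 0, fun j => (hu j).trans ?_⟩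
  rw [pow_zero]
  exact mul_le_mul (le_abs_self C) (slow_le_one j) (slow_pos j).le (abs_nonneg C)

theorem divOp_mem_decay_fast {u : ℕ → ℂ} (hu : u ∈ decay slow) (a : ℕ) :
    divOp a u ∈ decay fast := by
  obtain ⟨C, hu⟩ := hu
  refine ⟨C, fun j => (norm_divOp_le a u j).trans ?_⟩
  rw [fast, mul_div_assoc']
  gcongr
  exact hu j

/-- `1 / (k + a) = 1 / k - a / (k * (k + a))`: up to faster decay, `Y a` acts as `Y 0`. -/
theorem divOp_eq (a : ℕ) (u : ℕ → ℂ) :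
    divOp a u = divOp 0 u - (a : ℂ) • divOp a (divOp 0 u) := by
  ext j
  have h1 := add_one_add_ne_zero j a
  have h2 := add_one_add_ne_zero j 0
  simp only [Pi.sub_apply, Pi.smul_apply, divOp_apply, smul_eq_mul, Nat.cast_zero, add_zero]
    at h2 ⊢
  field_simp
  ring

theorem shiftOp_sumOp_apply (u : ℕ → ℂ) (j : ℕ) :
    shiftOp (sumOp u) j = ∑ i ∈ Finset.range j, u i := by
  cases j with
  | zero => rfl
  | succ j => rfl

/-- The Taylor coefficients of `(-log (1 - w)) ^ (i + 1) / (i + 1)!`. -/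
noncomputable def logCoeff : ℕ → ℕ → ℂ
  | 0 => divOp 0 1
  | i + 1 => divOp 0 (shiftOp (sumOp (logCoeff i)))

/-- The exponent `-1/2` leaves room for all powers of the logarithm: partial sums are `O(k ^
(1/2))`, and division by `k` returns to the same class. -/
theorem logCoeff_mem_decay (i : ℕ) : logCoeff i ∈ decay slow := by
  induction i with
  | zero =>
    refine ⟨1, fun j => (norm_divOp_le 0 1 j).trans ?_⟩
    rw [Pi.one_apply, norm_one, one_mul, slow, ← one_div]
    have h : (1 : ℝ) ≤ (j : ℝ) + 1 := by simp
    refine one_div_le_one_div_of_le (Real.sqrt_pos.2 (by positivity)) ?_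
    exact (Real.sqrt_le_left (by positivity)).2 (by nlinarith)
  | succ i ih =>
    obtain ⟨C, hC⟩ := ih
    have hC0 : 0 ≤ C := by
      have := (norm_nonneg _).trans (hC 0)
      exact nonneg_of_mul_nonneg_left this (slow_pos 0)
    refine ⟨C * 2, fun j => (norm_divOp_le 0 _ j).trans ?_⟩
    have h1 : ‖shiftOp (sumOp (logCoeff i)) j‖ ≤ C * (2 * √((j : ℝ) + 1)) := by
      rw [shiftOp_sumOp_apply]
      calc ‖∑ i' ∈ Finset.range j, logCoeff i i'‖ ≤ ∑ i' ∈ Finset.range j, C * slow i' :=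
            norm_sum_le_of_le _ fun i' _ => hC i'
        _ = C * ∑ i' ∈ Finset.range j, slow i' := by rw [Finset.mul_sum]
        _ ≤ C * (2 * √(j : ℝ)) := by gcongr; exact sum_slow_le j
        _ ≤ C * (2 * √((j : ℝ) + 1)) := by gcongr; simp
    have hs : 0 < √((j : ℝ) + 1) := Real.sqrt_pos.2 (by positivity)
    have h2 : C * (2 * √((j : ℝ) + 1)) / ((j : ℝ) + 1) = C * 2 * slow j := by
      rw [slow]
      nth_rewrite 2 [← Real.sq_sqrt (show 0 ≤ (j : ℝ) + 1 by positivity)]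
      field_simp
    rw [← h2]
    gcongr

/-- The sequences that are combinations of the sequences `logCoeff i` and of a sequence that is
`O(k ^ (-3/2))`. -/
noncomputable def logSpan : Submodule ℂ (ℕ → ℂ) :=
  Submodule.span ℂ (Set.range logCoeff) ⊔ decay fast

theorem logCoeff_mem_logSpan (i : ℕ) : logCoeff i ∈ logSpan :=
  Submodule.mem_sup_left (Submodule.subset_span ⟨i, rfl⟩)

theorem logSpan_le_decay : logSpan ≤ decay slow :=
  sup_le (Submodule.span_le.2 (by rintro _ ⟨i, rfl⟩; exact logCoeff_mem_decay i)) decay_fast_le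

theorem divOp_mem_logSpan {u : ℕ → ℂ} (hu : u ∈ decay slow) (a : ℕ) : divOp a u ∈ logSpan :=
  Submodule.mem_sup_right (divOp_mem_decay_fast hu a)

/-- `Y 0 * E * S` sends `logCoeff i` to `logCoeff (i + 1)`; replacing `E * S` by `S` and `Y 0` by `Y
a` costs terms `O(k ^ (-3/2))`. For a remainder, the partial sums are the total minus a tail `O(k ^
(-1/2))`, and the total contributes a multiple of `logCoeff 0`. -/
theorem divOp_sumOp_mem_logSpan {u : ℕ → ℂ} (hu : u ∈ logSpan) (a : ℕ) :
    divOp a (sumOp u) ∈ logSpan := by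
  refine (show logSpan ≤ logSpan.comap (divOp a ∘ₗ sumOp) from
    sup_le (Submodule.span_le.2 ?_) ?_) hu
  · rintro _ ⟨i, rfl⟩
    rw [SetLike.mem_coe, Submodule.mem_comap, LinearMap.comp_apply,
      show sumOp (logCoeff i) = shiftOp (sumOp (logCoeff i)) + logCoeff i by
        rw [shiftOp_sumOp, sub_add_cancel], map_add, divOp_eq]
    change logCoeff (i + 1) - (a : ℂ) • divOp a (logCoeff (i + 1)) + _ ∈ _
    exact add_mem (sub_mem (logCoeff_mem_logSpan _) (Submodule.smul_mem _ _
      (divOp_mem_logSpan (logCoeff_mem_decay _) a))) (divOp_mem_logSpan (logCoeff_mem_decay _) a)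
  · rintro r ⟨C, hC⟩
    have hs : Summable r := Summable.of_norm_bounded (summable_fast.mul_left C) hC
    have hC0 : 0 ≤ C := nonneg_of_mul_nonneg_left ((norm_nonneg _).trans (hC 0)) (fast_pos 0)
    set t : ℕ → ℂ := fun j => ∑' i, r (i + (j + 1)) with ht
    have h1 : sumOp r = (∑' i, r i) • (1 : ℕ → ℂ) - t := by
      ext j
      have := hs.sum_add_tsum_nat_add (j + 1)
      rw [sumOp_apply, Pi.sub_apply, Pi.smul_apply, Pi.one_apply, smul_eq_mul, mul_one, ← this,
        ht, add_sub_cancel_right]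
    have h2 : t ∈ decay slow := by
      refine ⟨C * 2, fun j => ?_⟩
      have h3 : Summable fun i => C * fast (i + (j + 1)) :=
        ((summable_nat_add_iff (f := fast) (j + 1)).2 summable_fast).mul_left C
      refine (tsum_of_norm_bounded h3.hasSum fun i => hC _).trans ?_
      rw [tsum_mul_left, mul_assoc]
      gcongr
      exact tsum_fast_le j
    rw [Submodule.mem_comap, LinearMap.comp_apply, h1, map_sub, map_smul, divOp_eq]
    change _ • (logCoeff 0 - (a : ℂ) • divOp a (logCoeff 0)) - _ ∈ _
    exact sub_mem (Submodule.smul_mem _ _ (sub_mem (logCoeff_mem_logSpan _)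
      (Submodule.smul_mem _ _ (divOp_mem_logSpan (logCoeff_mem_decay _) a))))
      (divOp_mem_logSpan h2 a)

theorem std_mem_logSpan (l : List (ℕ × ℕ)) : seqModule.std l ∈ logSpan := by
  induction l with
  | nil =>
    refine Submodule.mem_sup_right ⟨(fast 0)⁻¹, fun j => ?_⟩
    cases j with
    | zero => simp [SummationModule.std, seqModule, (fast_pos 0).ne']
    | succ j =>
      have := fast_pos (j + 1)
      have := fast_pos 0
      simp only [SummationModule.std, seqModule, Pi.single_apply, Nat.succ_ne_zero, if_false,
        norm_zero]
      positivity
  | cons x l ih =>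
    obtain ⟨a, s⟩ := x
    rw [SummationModule.std]
    induction s with
    | zero => exact divOp_sumOp_mem_logSpan ih a
    | succ s ih2 =>
      rw [pow_succ']
      exact divOp_mem_logSpan (logSpan_le_decay ih2) a

/-! ### Expansions of generating functions -/

theorem hasDerivAt_genFun {u : ℕ → ℂ} (hu : PolyBounded u) {w : ℂ} (hw : ‖w‖ < 1) :
    HasDerivAt (genFun u) (∑' j, mulOp u j * w ^ j) w := by
  obtain ⟨r, hr, hr1⟩ := exists_between hw
  have hr0 : 0 < r := (norm_nonneg w).trans_lt hr
  obtain ⟨C, hC, n, h⟩ := hu.mulOp.exists_nonneg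
  refine hasDerivAt_tsum_of_isPreconnected (g := fun j y => u j * y ^ (j + 1))
    (g' := fun j y => mulOp u j * y ^ j) (u := fun j : ℕ => C * (((j : ℝ) + 1) ^ n * r ^ j))
    ((summable_poly_geometric hr0.le hr1 n).mul_left C) (Metric.isOpen_ball (x := (0 : ℂ)) (ε := r))
    (convex_ball (0 : ℂ) r).isPreconnected (fun j y _ => ?_) (fun j y hy => ?_)
    (Metric.mem_ball_self hr0) ?_ (by simpa using hr)
  · have := ((hasDerivAt_pow (j + 1) y).const_mul (u j))
    refine this.congr_deriv ?_
    rw [mulOp_apply, Nat.add_sub_cancel]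
    push_cast
    ring
  · rw [norm_mul, norm_pow, ← mul_assoc]
    have : ‖y‖ ≤ r := by simpa using (Metric.mem_ball.1 hy).le
    gcongr
    exact h j
  · simp

/-- On generating functions, `Y 0 * E` is integration from 0. -/
theorem hasDerivAt_genFun_of_mulOp_eq {u v : ℕ → ℂ} (hu : PolyBounded u) (hv : PolyBounded v)
    (h : mulOp u = shiftOp v) {w : ℂ} (hw : ‖w‖ < 1) : HasDerivAt (genFun u) (genFun v w) w := by
  convert hasDerivAt_genFun hu hw using 1
  have hs : Summable fun j => shiftOp v j * w ^ j := by
    refine (summable_nat_add_iff 1).1 ?_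
    simpa only [shiftOp_succ] using hv.summable hw
  rw [h, hs.tsum_eq_zero_add, shiftOp_zero, zero_mul, zero_add]
  simp only [shiftOp_succ, genFun]

theorem mulOp_divOp_zero (u : ℕ → ℂ) : mulOp (divOp 0 u) = u := by
  ext j
  have h2 := add_one_add_ne_zero j 0
  simp only [mulOp_apply, divOp_apply, Nat.cast_zero, add_zero] at h2 ⊢
  field_simp

theorem genFun_zero_right (u : ℕ → ℂ) : genFun u 0 = 0 := by simp [genFun]

-- Induction from the Taylor series of the logarithm: both sides vanish at 0 and have the same
-- derivative, in which `S` contributes the factor `1 / (1 - w)`.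
open Nat in
theorem genFun_logCoeff (i : ℕ) {w : ℂ} (hw : ‖w‖ < 1) :
    genFun (logCoeff i) w = ((i + 1)! : ℂ)⁻¹ * (-Complex.log (1 - w)) ^ (i + 1) := by
  induction i generalizing w with
  | zero =>
    have h := Complex.hasSum_taylorSeries_neg_log hw
    have h2 := h.summable.tsum_eq_zero_add
    rw [h.tsum_eq] at h2
    simp only [zero_add, pow_one, factorial_one, Nat.cast_one, inv_one, one_mul]
    rw [h2, genFun]
    simp [logCoeff, divOp_apply, div_eq_inv_mul]
  | succ i ih =>
    have hP := polyBounded_of_mem_decay (logCoeff_mem_decay i)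
    have hf : ∀ x ∈ Metric.ball (0 : ℂ) 1, HasDerivWithinAt (fun y => genFun (logCoeff (i + 1)) y -
        ((i + 1 + 1)! : ℂ)⁻¹ * (-Complex.log (1 - y)) ^ (i + 1 + 1)) 0 (Metric.ball 0 1) x := by
      intro x hx
      have hx1 : ‖x‖ < 1 := by simpa using hx
      have hx2 : 1 - x ≠ 0 := by
        refine sub_ne_zero.2 ?_
        rintro rfl
        simp at hx1
      have h1 := hasDerivAt_genFun_of_mulOp_eq
        (polyBounded_of_mem_decay (logCoeff_mem_decay (i + 1))) hP.sumOp
        (mulOp_divOp_zero _) hx1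
      have h2 : HasDerivAt (fun y : ℂ => 1 - y) (-1) x := by
        simpa using (hasDerivAt_id x).const_sub 1
      have h3 : 1 - x ∈ Complex.slitPlane := by
        have := Complex.mem_slitPlane_of_norm_lt_one (z := -x) (by rwa [norm_neg])
        rwa [← sub_eq_add_neg] at this
      have h4 := (((h2.clog h3).neg.pow (i + 1 + 1)).const_mul ((i + 1 + 1)! : ℂ)⁻¹)
      have h5 := (h1.sub h4).hasDerivWithinAt (s := Metric.ball 0 1)
      refine h5.congr_deriv ?_
      have h6 := genFun_sumOp hP hx1
      rw [ih hx1] at h6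
      have h7 : genFun (sumOp (logCoeff i)) x =
          ((i + 1)! : ℂ)⁻¹ * (-Complex.log (1 - x)) ^ (i + 1) / (1 - x) := by
        rw [← h6]; field_simp
      rw [h7, Nat.add_sub_cancel, Nat.factorial_succ (i + 1)]
      have h8 : ((i + 1)! : ℂ) ≠ 0 := by exact_mod_cast Nat.factorial_ne_zero _
      have h9 : ((i : ℂ) + 1 + 1) ≠ 0 := by exact_mod_cast (Nat.succ_ne_zero (i + 1))
      simp only [Pi.neg_apply]
      push_cast
      field_simp
      ring
    have := Convex.norm_image_sub_le_of_norm_hasDerivWithin_le (C := 0) hf (by simp)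
      (convex_ball _ _) (Metric.mem_ball_self one_pos) (show w ∈ Metric.ball (0 : ℂ) 1 by simpa)
    rw [zero_mul, norm_le_zero_iff, sub_eq_zero] at this
    rw [← sub_eq_zero, this, genFun_zero_right]
    simp

/-- Interpolation between the bounds `k * ‖1 - w‖` and `2`. The exponent `1 / 4` keeps `k ^ (-3/2 +
1/4)` summable. -/
theorem norm_pow_sub_one_le {w : ℂ} (hw : ‖w‖ ≤ 1) (k : ℕ) :
    ‖w ^ k - 1‖ ≤ 2 * ((k : ℝ) * ‖1 - w‖) ^ (1 / 4 : ℝ) := by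
  have h1 : ‖w ^ k - 1‖ ≤ k * ‖1 - w‖ := by
    induction k with
    | zero => simp
    | succ k ih =>
      rw [show w ^ (k + 1) - 1 = w * (w ^ k - 1) - (1 - w) by ring]
      refine (norm_sub_le _ _).trans ?_
      rw [norm_mul]
      push_cast
      nlinarith [norm_nonneg (w ^ k - 1), norm_nonneg w]
  have h2 : ‖w ^ k - 1‖ ≤ 2 := by
    refine (norm_sub_le _ _).trans ?_
    rw [norm_pow, norm_one]
    linarith [pow_le_one₀ (norm_nonneg w) hw (n := k)]
  set x := (k : ℝ) * ‖1 - w‖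
  have hx : 0 ≤ x := by positivity
  rcases le_total x 1 with h | h
  · refine h1.trans ?_
    have := Real.rpow_le_rpow_of_exponent_ge' hx h (by norm_num) (show (1 / 4 : ℝ) ≤ 1 by norm_num)
    rw [Real.rpow_one] at this
    linarith [Real.rpow_nonneg hx (1 / 4)]
  · have := Real.one_le_rpow h (show (0 : ℝ) ≤ 1 / 4 by norm_num)
    linarith

theorem summable_fast_mul_rpow :
    Summable fun j : ℕ => fast j * ((j : ℝ) + 1) ^ (1 / 4 : ℝ) := by
  have h := (summable_nat_add_iff 1).2 (Real.summable_nat_rpow.2 (show (-5 / 4 : ℝ) < -1 by norm_num))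
  refine h.congr fun j => ?_
  have hj : (0 : ℝ) < (j : ℝ) + 1 := by positivity
  rw [fast, slow, Real.sqrt_eq_rpow, ← Real.rpow_neg hj.le]
  nth_rewrite 2 [← Real.rpow_one ((j : ℝ) + 1)]
  rw [← Real.rpow_sub hj, ← Real.rpow_add hj]
  push_cast
  norm_num

open Asymptotics in
theorem isLogExpansion_of_mem_decay {r : ℕ → ℂ} (hr : r ∈ decay fast) :
    IsLogExpansion (genFun r) (Polynomial.C (∑' j, r j)) := by
  have hP := polyBounded_of_mem_decay (decay_fast_le hr)
  obtain ⟨C, hC⟩ := hr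
  have hs : Summable r := Summable.of_norm_bounded (summable_fast.mul_left C) hC
  have hC0 : 0 ≤ C := nonneg_of_mul_nonneg_left ((norm_nonneg _).trans (hC 0)) (fast_pos 0)
  refine ⟨1 / 4, by norm_num, IsBigO.of_bound
    (∑' j : ℕ, C * 2 * (fast j * ((j : ℝ) + 1) ^ (1 / 4 : ℝ))) ?_⟩
  filter_upwards [self_mem_nhdsWithin] with w hw
  have hw1 : ‖w‖ < 1 := by simpa using hw
  rw [Polynomial.eval_C, genFun, ← (hP.summable hw1).tsum_sub hs,
    Real.norm_of_nonneg (Real.rpow_nonneg (norm_nonneg _) _), ← tsum_mul_right]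
  refine tsum_of_norm_bounded (((summable_fast_mul_rpow.mul_left (C * 2)).mul_right
    (‖1 - w‖ ^ (1 / 4 : ℝ))).hasSum) fun j => ?_
  rw [← mul_sub_one, norm_mul]
  have h := norm_pow_sub_one_le hw1.le (j + 1)
  rw [Real.mul_rpow (by positivity) (norm_nonneg _)] at h
  push_cast at h
  have := fast_pos j
  calc ‖r j‖ * ‖w ^ (j + 1) - 1‖
      ≤ (C * fast j) * (2 * (((j : ℝ) + 1) ^ (1 / 4 : ℝ) * ‖1 - w‖ ^ (1 / 4 : ℝ))) := by
        gcongr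
        exact hC j
    _ = _ := by ring

theorem IsLogExpansion.genFun_add {u v : ℕ → ℂ} (hu : PolyBounded u) (hv : PolyBounded v)
    {Q R : Polynomial ℂ} (hQ : IsLogExpansion (genFun u) Q) (hR : IsLogExpansion (genFun v) R) :
    IsLogExpansion (genFun (u + v)) (Q + R) := by
  refine (hQ.add hR).congr ?_
  filter_upwards [self_mem_nhdsWithin] with w hw
  exact (HypergeomMZV.genFun_add hu hv (by simpa using hw)).symm

theorem exists_isLogExpansion_of_mem_logSpan {u : ℕ → ℂ} (hu : u ∈ logSpan) :
    ∃ Q, IsLogExpansion (genFun u) Q := by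
  obtain ⟨y, hy, z, hz, rfl⟩ := Submodule.mem_sup.1 hu
  have hy' : ∃ Q, IsLogExpansion (genFun y) Q := by
    clear hu
    induction hy using Submodule.span_induction with
    | mem y hy =>
      obtain ⟨i, rfl⟩ := hy
      refine ⟨Polynomial.C ((i + 1).factorial : ℂ)⁻¹ * (-Polynomial.X) ^ (i + 1), 1, one_pos, ?_⟩
      refine (Asymptotics.isBigO_zero _ _).congr' ?_ Filter.EventuallyEq.rfl
      filter_upwards [self_mem_nhdsWithin] with w hw
      rw [genFun_logCoeff i (by simpa using hw)]
      simp
    | zero =>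
      exact ⟨0, isLogExpansion_zero.congr (Filter.Eventually.of_forall fun w => by simp [genFun])⟩
    | add x y hx hy hx' hy' =>
      have hle : Submodule.span ℂ (Set.range logCoeff) ≤ decay slow :=
        le_sup_left.trans logSpan_le_decay
      obtain ⟨Q, hQ⟩ := hx'
      obtain ⟨R, hR⟩ := hy'
      exact ⟨_, hQ.genFun_add (polyBounded_of_mem_decay (hle hx))
        (polyBounded_of_mem_decay (hle hy)) hR⟩
    | smul c x hx hx' =>
      obtain ⟨Q, hQ⟩ := hx'
      refine ⟨_, (hQ.const_mul c).congr (Filter.Eventually.of_forall fun w => ?_)⟩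
      exact (genFun_smul x c w).symm
  obtain ⟨Q, hQ⟩ := hy'
  exact ⟨_, hQ.genFun_add (polyBounded_of_mem_decay (logSpan_le_decay (Submodule.mem_sup_left hy)))
    (polyBounded_of_mem_decay (decay_fast_le hz)) (isLogExpansion_of_mem_decay hz)⟩

/-! ### The regularized value as a linear map -/

section Regularization

/-- The sequences with polynomial growth whose generating functions are at most logarithmically
divergent. -/
noncomputable def logSpace : Submodule ℚ (ℕ → ℂ) where
  carrier := {u | PolyBounded u ∧ AtMostLogDivergent (genFun u)}
  zero_mem' := ⟨⟨0, 0, by simp⟩, 0,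
    isLogExpansion_zero.congr (Filter.Eventually.of_forall fun w => by simp [genFun])⟩
  add_mem' := by
    rintro u v ⟨hu, Q, hQ⟩ ⟨hv, R, hR⟩
    exact ⟨hu.add hv, Q + R, hQ.genFun_add hu hv hR⟩
  smul_mem' := by
    rintro c u ⟨hu, Q, hQ⟩
    rw [← Rat.cast_smul_eq_qsmul ℂ]
    refine ⟨hu.smul _, _, (hQ.const_mul (c : ℂ)).congr (Filter.Eventually.of_forall fun w => ?_)⟩
    exact (genFun_smul u c w).symm

/-- Certificates pass through words whose sequences need not lie in `logSpace`, so the regularized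
value is extended arbitrarily. Linearity alone makes the extension respect the relations of the
module. -/
theorem exists_regLinear : ∃ Λ : (ℕ → ℂ) →ₗ[ℚ] ℂ, ∀ u ∈ logSpace, Λ u = regValue (genFun u) := by
  let f : logSpace →ₗ[ℚ] ℂ :=
    { toFun := fun u => regValue (genFun u.1)
      map_add' := by
        rintro ⟨u, hu, Q, hQ⟩ ⟨v, hv, R, hR⟩
        show regValue (genFun (u + v)) = regValue (genFun u) + regValue (genFun v)
        rw [(hQ.genFun_add hu hv hR).regValue_eq, hQ.regValue_eq, hR.regValue_eq,
          Polynomial.eval_add]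
      map_smul' := by
        rintro c ⟨u, hu, Q, hQ⟩
        show regValue (genFun (c • u)) = c • regValue (genFun u)
        have h : IsLogExpansion (genFun (c • u)) _ :=
          (hQ.const_mul (c : ℂ)).congr (Filter.Eventually.of_forall fun w => by
            rw [← Rat.cast_smul_eq_qsmul ℂ, genFun_smul])
        rw [h.regValue_eq, hQ.regValue_eq, Polynomial.eval_mul, Polynomial.eval_C, Rat.smul_def] }
  obtain ⟨Λ, hΛ⟩ := LinearMap.exists_extend f
  exact ⟨Λ, fun u hu => LinearMap.congr_fun hΛ ⟨u, hu⟩⟩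

/-- A linear extension to all sequences of the regularized value of the generating function. -/
noncomputable def regLinear : (ℕ → ℂ) →ₗ[ℚ] ℂ := exists_regLinear.choose

theorem regLinear_apply {u : ℕ → ℂ} (hu : u ∈ logSpace) : regLinear u = regValue (genFun u) :=
  exists_regLinear.choose_spec u hu

theorem mem_logSpace_of_mem_logSpan {u : ℕ → ℂ} (hu : u ∈ logSpan) : u ∈ logSpace :=
  ⟨polyBounded_of_mem_decay (logSpan_le_decay hu), exists_isLogExpansion_of_mem_logSpan hu⟩

theorem stdSpan_le_logSpace (d w : ℕ) : seqModule.stdSpan d w ≤ logSpace := by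
  refine Submodule.span_le.2 ?_
  rintro _ ⟨l, -, rfl⟩
  exact mem_logSpace_of_mem_logSpan (std_mem_logSpan l)

/-- `E` multiplies the generating function by `w`, which keeps the expansion polynomial. -/
theorem seqModule_E_pow_std (j : ℕ) (l : List (ℕ × ℕ)) :
    (seqModule.E ^ j) (seqModule.std l) ∈ logSpace ∧
      regLinear ((seqModule.E ^ (j + 1)) (seqModule.std l)) =
        regLinear ((seqModule.E ^ j) (seqModule.std l)) := by
  have step : ∀ u ∈ logSpace, seqModule.E u ∈ logSpace ∧ regLinear (seqModule.E u) = regLinear u := by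
    rintro u ⟨hu, Q, hQ⟩
    have h : IsLogExpansion (genFun (seqModule.E u)) Q := by
      refine hQ.mul_self.congr ?_
      filter_upwards [self_mem_nhdsWithin] with w hw
      exact (genFun_shiftOp hu (by simpa using hw)).symm
    have hE : seqModule.E u ∈ logSpace := ⟨hu.shiftOp, Q, h⟩
    exact ⟨hE, by rw [regLinear_apply hE, regLinear_apply ⟨hu, Q, hQ⟩, h.regValue_eq,
      hQ.regValue_eq]⟩
  have hmem : ∀ i, (seqModule.E ^ i) (seqModule.std l) ∈ logSpace := by
    intro i
    induction i with
    | zero => exact mem_logSpace_of_mem_logSpan (std_mem_logSpan l)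
    | succ i ih => rw [pow_succ']; exact (step _ ih).1
  refine ⟨hmem j, ?_⟩
  rw [pow_succ']
  exact (step _ (hmem j)).2

end Regularization

/-! ### Sums over chains of integers -/

section Tuples

variable (R : ℕ → ℕ → Prop)

/-- Tuples of positive integers whose successive entries are related by `R`. -/
def IsChainTuple {q : ℕ} (k : Fin (q + 1) → ℕ) : Prop :=
  (∀ i : Fin q, R (k i.succ) (k i.castSucc)) ∧ ∀ i, 1 ≤ k i

variable {R} in
theorem isChainTuple_cons {q a : ℕ} {k : Fin (q + 1) → ℕ} :
    IsChainTuple R (Fin.cons a k : Fin (q + 2) → ℕ) ↔ 1 ≤ a ∧ R (k 0) a ∧ IsChainTuple R k := by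
  simp only [IsChainTuple, Fin.forall_fin_succ (n := q + 1), Fin.forall_fin_succ (n := q),
    Fin.cons_succ, Fin.castSucc_zero, Fin.cons_zero, ← Fin.succ_castSucc]
  tauto

variable [DecidableRel R]

/-- The tuples with first entry `a` whose successive entries are related by `R`. -/
def chainSet : (q : ℕ) → ℕ → Finset (Fin (q + 1) → ℕ)
  | 0, a => {fun _ => a}
  | q + 1, a => ((Finset.Icc 1 a).filter (R · a)).biUnion fun b =>
      (chainSet q b).image (Fin.cons (α := fun _ => ℕ) a)

variable {R}

/-- By `hR` the entries decrease weakly, so the range `1 ≤ b ≤ a` in `chainSet` misses no chain. The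
relations used are `≤` and `<`. -/
theorem mem_chainSet (hR : ∀ a b, R b a → b ≤ a) {q a : ℕ} (ha : 1 ≤ a) {k : Fin (q + 1) → ℕ} :
    k ∈ chainSet R q a ↔ k 0 = a ∧ IsChainTuple R k := by
  induction q generalizing a with
  | zero =>
    rw [chainSet, Finset.mem_singleton]
    constructor
    · rintro rfl
      exact ⟨rfl, fun i => i.elim0, fun _ => ha⟩
    · rintro ⟨rfl, -⟩
      funext i
      rw [Fin.fin_one_eq_zero i]
  | succ q ih =>
    simp only [chainSet, Finset.mem_biUnion, Finset.mem_filter, Finset.mem_Icc, Finset.mem_image]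
    constructor
    · rintro ⟨b, ⟨⟨hb1, -⟩, hba⟩, k', hk', rfl⟩
      obtain ⟨rfl, hk⟩ := (ih hb1).1 hk'
      exact ⟨rfl, isChainTuple_cons.2 ⟨ha, hba, hk⟩⟩
    · rintro ⟨rfl, hk⟩
      rw [← Fin.cons_self_tail k] at hk
      obtain ⟨h1, h2, h3⟩ := isChainTuple_cons.1 hk
      exact ⟨Fin.tail k 0, ⟨⟨h3.2 0, hR _ _ h2⟩, h2⟩, Fin.tail k, (ih (h3.2 0)).2 ⟨rfl, h3⟩,
        Fin.cons_self_tail k⟩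

variable (R) in
/-- The sum over the tuples with first entry `a` of a product of functions of their entries. -/
def chainSum {q : ℕ} (G : Fin (q + 1) → ℕ → ℂ) (a : ℕ) : ℂ :=
  ∑ k ∈ chainSet R q a, ∏ i, G i (k i)

theorem chainSum_zero (G : Fin 1 → ℕ → ℂ) (a : ℕ) : chainSum R G a = G 0 a := by
  simp [chainSum, chainSet]

theorem chainSum_succ (hR : ∀ a b, R b a → b ≤ a) {q : ℕ} (G : Fin (q + 2) → ℕ → ℂ) (a : ℕ) :
    chainSum R G a = G 0 a *
      ∑ b ∈ (Finset.Icc 1 a).filter (R · a), chainSum R (fun i => G i.succ) b := by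
  rw [chainSum, chainSet, Finset.sum_biUnion, Finset.mul_sum]
  · refine Finset.sum_congr rfl fun b _ => ?_
    rw [Finset.sum_image fun _ _ _ _ h => Fin.cons_right_injective (α := fun _ => ℕ) a h, chainSum,
      Finset.mul_sum]
    refine Finset.sum_congr rfl fun k _ => ?_
    rw [Fin.prod_univ_succ]
    simp
  · intro b hb c hc hbc
    refine Finset.disjoint_left.2 fun k hk hk' => hbc ?_
    obtain ⟨x, hx, rfl⟩ := Finset.mem_image.1 hk
    obtain ⟨y, hy, hxy⟩ := Finset.mem_image.1 hk'
    obtain rfl := Fin.cons_right_injective (α := fun _ => ℕ) a hxy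
    have hb1 : 1 ≤ b := (Finset.mem_Icc.1 (Finset.mem_filter.1 hb).1).1
    have hc1 : 1 ≤ c := (Finset.mem_Icc.1 (Finset.mem_filter.1 hc).1).1
    rw [← ((mem_chainSet hR hb1).1 hx).1, ← ((mem_chainSet hR hc1).1 hy).1]

/-- The chain tuples, sorted by their first entry. -/
noncomputable def chainEquiv (hR : ∀ a b, R b a → b ≤ a) (q : ℕ) :
    (Σ j : ℕ, chainSet R q (j + 1)) ≃ {k : Fin (q + 1) → ℕ // IsChainTuple R k} :=
  Equiv.ofBijective (fun x => ⟨x.2.1, ((mem_chainSet hR (Nat.le_add_left 1 x.1)).1 x.2.2).2⟩) <| by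
    constructor
    · rintro ⟨j, k, hk⟩ ⟨j', k', hk'⟩ h
      obtain rfl : k = k' := congrArg Subtype.val h
      obtain rfl : j = j' := by
        have h1 := ((mem_chainSet hR (Nat.le_add_left 1 j)).1 hk).1
        have h2 := ((mem_chainSet hR (Nat.le_add_left 1 j')).1 hk').1
        omega
      rfl
    · rintro ⟨k, hk⟩
      have h : k 0 - 1 + 1 = k 0 := Nat.sub_add_cancel (hk.2 0)
      exact ⟨⟨k 0 - 1, k, (mem_chainSet hR (Nat.le_add_left 1 _)).2 ⟨h.symm, hk⟩⟩, rfl⟩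

/-- By `hG` the values of `G` are nonnegative reals, so over the tuples with a given first entry the
sum of the norms is the norm of the sum. Absolute convergence thus reduces to that of one power
series. -/
theorem hasSum_chainTuple (hR : ∀ a b, R b a → b ≤ a) {q : ℕ} {G : Fin (q + 1) → ℕ → ℂ}
    (hG : ∀ i a, (‖G i a‖ : ℂ) = G i a) (hP : PolyBounded fun j => chainSum R G (j + 1)) {w : ℂ}
    (hw : ‖w‖ < 1) :
    HasSum (fun k : {k : Fin (q + 1) → ℕ // IsChainTuple R k} => w ^ k.1 0 * ∏ i, G i (k.1 i))
      (genFun (fun j => chainSum R G (j + 1)) w) := by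
  have hsum : ∀ j, ∑ k : chainSet R q (j + 1), w ^ k.1 0 * ∏ i, G i (k.1 i) =
      chainSum R G (j + 1) * w ^ (j + 1) := by
    intro j
    rw [Finset.sum_coe_sort (chainSet R q (j + 1)) fun k => w ^ k 0 * ∏ i, G i (k i), chainSum,
      Finset.sum_mul]
    refine Finset.sum_congr rfl fun k hk => ?_
    rw [((mem_chainSet hR (Nat.le_add_left 1 j)).1 hk).1, mul_comm]
  have hnorm : ∀ j, ∑ k : chainSet R q (j + 1), ‖w ^ k.1 0 * ∏ i, G i (k.1 i)‖ =
      ‖chainSum R G (j + 1) * w ^ (j + 1)‖ := by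
    intro j
    have h1 : chainSum R G (j + 1) =
        ((∑ k ∈ chainSet R q (j + 1), ∏ i, ‖G i (k i)‖ : ℝ) : ℂ) := by
      push_cast
      simp only [chainSum, hG]
    rw [Finset.sum_coe_sort (chainSet R q (j + 1)) fun k => ‖w ^ k 0 * ∏ i, G i (k i)‖, h1,
      norm_mul, Complex.norm_real, Real.norm_of_nonneg
        (Finset.sum_nonneg fun k _ => Finset.prod_nonneg fun i _ => norm_nonneg _), Finset.sum_mul]
    refine Finset.sum_congr rfl fun k hk => ?_
    rw [((mem_chainSet hR (Nat.le_add_left 1 j)).1 hk).1, mul_comm, norm_mul, norm_prod]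
  rw [← (chainEquiv hR q).hasSum_iff]
  have hs : Summable ((fun k : {k : Fin (q + 1) → ℕ // IsChainTuple R k} =>
      w ^ k.1 0 * ∏ i, G i (k.1 i)) ∘ chainEquiv hR q) := by
    refine Summable.of_norm ((summable_sigma_of_nonneg fun _ => norm_nonneg _).2 ⟨fun j => ?_, ?_⟩)
    · exact (hasSum_fintype _).summable
    · refine (hP.summable_norm hw).congr fun j => ?_
      rw [tsum_fintype, ← hnorm]
      rfl
  refine hs.hasSum_iff.2 ?_
  rw [hs.tsum_sigma' fun j => (hasSum_fintype _).summable]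
  refine tsum_congr fun j => ?_
  rw [tsum_fintype, ← hsum]
  rfl

end Tuples

/-! ### Words as multiple sums -/

section Comparison

theorem sumOp_eq_sum_Icc (f : ℕ → ℂ) (j : ℕ) :
    sumOp (fun i => f (i + 1)) j = ∑ b ∈ (Finset.Icc 1 (j + 1)).filter (· ≤ j + 1), f b := by
  rw [sumOp_apply]
  refine Finset.sum_nbij' (· + 1) (· - 1) ?_ ?_ ?_ ?_ fun i _ => rfl
  all_goals intro b hb; simp at hb ⊢; try omega

theorem shiftOp_sumOp_eq_sum_Icc (f : ℕ → ℂ) (j : ℕ) :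
    shiftOp (sumOp fun i => f (i + 1)) j =
      ∑ b ∈ (Finset.Icc 1 (j + 1)).filter (· < j + 1), f b := by
  rw [shiftOp_sumOp_apply]
  refine Finset.sum_nbij' (· + 1) (· - 1) ?_ ?_ ?_ ?_ fun i _ => rfl
  all_goals intro b hb; simp at hb ⊢; try omega

/-- This is why `base` is the indicator of `k = 1`: the innermost summation yields the constant 1.
-/
theorem sumOp_base (j : ℕ) : sumOp seqModule.base j = 1 := by
  rw [sumOp_apply, Finset.sum_range_succ']
  simp [seqModule]

/-- The function `k ^ e / (k)_{n+1} ^ A`. -/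
noncomputable def factorFun (f : ℕ × ℕ × ℕ) (k : ℕ) : ℂ :=
  (k : ℂ) ^ f.2.2 / ((ascPochhammer ℂ (f.2.1 + 1)).eval (k : ℂ)) ^ f.1

theorem prod_Y_apply (L : List ℕ) (u : ℕ → ℂ) (j : ℕ) :
    (L.map seqModule.Y).prod u j = u j / (L.map fun b : ℕ => (j : ℂ) + 1 + b).prod := by
  induction L with
  | nil => simp
  | cons b L ih =>
    rw [List.map_cons, List.prod_cons, List.map_cons, List.prod_cons, Module.End.mul_apply]
    change divOp b _ j = _
    rw [divOp_apply, ih, div_div, mul_comm]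

theorem X_pow_apply (e : ℕ) (u : ℕ → ℂ) (j : ℕ) :
    (seqModule.X ^ e) u j = ((j : ℂ) + 1) ^ e * u j := by
  induction e with
  | zero => simp
  | succ e ih =>
    rw [pow_succ', Module.End.mul_apply]
    change mulOp _ j = _
    rw [mulOp_apply, ih]
    ring

theorem prod_range_eq_ascPochhammer (n : ℕ) (x : ℂ) :
    ((List.range n).map fun b : ℕ => x + b).prod = (ascPochhammer ℂ n).eval x := by
  induction n with
  | zero => simp
  | succ n ih => rw [List.range_succ, List.map_append, List.prod_append, ih, ascPochhammer_succ_eval]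
                 simp

theorem seqModule_factor_apply (A n e : ℕ) (u : ℕ → ℂ) (j : ℕ) :
    (seqModule.X ^ e * ((SummationModule.shifts A n).map seqModule.Y).prod) u j =
      factorFun (A, n, e) (j + 1) * u j := by
  rw [Module.End.mul_apply, X_pow_apply, prod_Y_apply, SummationModule.shifts, List.map_flatten,
    List.prod_flatten, List.map_replicate, List.map_replicate, List.prod_replicate,
    prod_range_eq_ascPochhammer, factorFun]
  push_cast
  ring

theorem norm_factorFun (f : ℕ × ℕ × ℕ) (k : ℕ) : (‖factorFun f k‖ : ℂ) = factorFun f k := by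
  rw [factorFun, ascPochhammer_nat_eq_natCast_ascFactorial]
  simp

theorem nested_ofFn_apply {q : ℕ} (f : Fin (q + 1) → ℕ × ℕ × ℕ) (j : ℕ) :
    seqModule.nested (List.ofFn f) j =
      chainSum (fun b a => b ≤ a) (fun i => factorFun (f i)) (j + 1) := by
  induction q generalizing j with
  | zero =>
    rw [List.ofFn_succ, List.ofFn_zero, SummationModule.nested, seqModule_factor_apply,
      chainSum_zero]
    change _ * sumOp seqModule.base j = _
    rw [sumOp_base, mul_one]
  | succ q ih =>
    rw [List.ofFn_succ, SummationModule.nested, seqModule_factor_apply,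
      chainSum_succ fun _ _ h => h]
    congr 1
    change sumOp (seqModule.nested (List.ofFn fun i => f i.succ)) j = _
    rw [show seqModule.nested (List.ofFn fun i => f i.succ) = _ from funext (ih fun i => f i.succ),
      sumOp_eq_sum_Icc]

theorem Y_zero_pow_apply (s : ℕ) (u : ℕ → ℂ) (j : ℕ) :
    (seqModule.Y 0 ^ s) u j = (((j + 1 : ℕ) : ℂ) ^ s)⁻¹ * u j := by
  have := prod_Y_apply (List.replicate s 0) u j
  rw [List.map_replicate, List.prod_replicate, List.map_replicate, List.prod_replicate] at this
  rw [this, div_eq_inv_mul]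
  push_cast
  rw [add_zero]

theorem zetaVec_ofFn_apply {q : ℕ} (s : Fin (q + 1) → ℕ) (j : ℕ) :
    seqModule.zetaVec (List.ofFn s) j =
      chainSum (fun b a => b < a) (fun i k => ((k : ℂ) ^ s i)⁻¹) (j + 1) := by
  induction q generalizing j with
  | zero =>
    rw [List.ofFn_succ, List.ofFn_zero, SummationModule.zetaVec, Y_zero_pow_apply, chainSum_zero]
    change _ * sumOp seqModule.base j = _
    rw [sumOp_base, mul_one]
  | succ q ih =>
    have ih := funext (ih fun i => s i.succ)
    rw [List.ofFn_succ] at ih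
    rw [List.ofFn_succ, List.ofFn_succ, SummationModule.zetaVec, Y_zero_pow_apply,
      chainSum_succ fun _ _ h => le_of_lt h, ih]
    congr 1
    exact shiftOp_sumOp_eq_sum_Icc _ j

theorem polyBounded_nested (l : List (ℕ × ℕ × ℕ)) : PolyBounded (seqModule.nested l) := by
  rw [← SummationModule.eval_nestedWord]
  exact polyBounded_eval _

theorem polyBounded_zetaVec (s : List ℕ) : PolyBounded (seqModule.zetaVec s) := by
  rw [← SummationModule.eval_zetaWord]
  exact polyBounded_eval _

theorem firstEntry_succ {q : ℕ} (k : Fin (q + 1) → ℕ) : firstEntry k = k 0 :=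
  dif_pos (Nat.succ_pos q)

theorem polylog_eq_genFun {s : List ℕ} (hs : s ≠ []) {w : ℂ} (hw : ‖w‖ < 1) :
    polylog s w = genFun (seqModule.zetaVec s) w := by
  have h : ∀ (q : ℕ) (σ : Fin q → ℕ), 0 < q →
      ∑' k : {k : Fin q → ℕ // StrictAnti k ∧ ∀ i, 1 ≤ k i},
        w ^ firstEntry k.1 / ∏ i, (k.1 i : ℂ) ^ σ i = genFun (seqModule.zetaVec (List.ofFn σ)) w := by
    intro q σ hq
    obtain ⟨q, rfl⟩ := Nat.exists_eq_succ_of_ne_zero hq.ne'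
    have hz := funext (zetaVec_ofFn_apply σ)
    have := hasSum_chainTuple (R := fun b a => b < a) (fun _ _ h => le_of_lt h)
      (G := fun i k => ((k : ℂ) ^ σ i)⁻¹) (fun i a => by simp)
      (hz ▸ polyBounded_zetaVec _) hw
    rw [hz, ← this.tsum_eq]
    let e : {k : Fin (q + 1) → ℕ // StrictAnti k ∧ ∀ i, 1 ≤ k i} ≃
        {k : Fin (q + 1) → ℕ // IsChainTuple (fun b a => b < a) k} :=
      Equiv.subtypeEquivRight fun k => by rw [Fin.strictAnti_iff_succ_lt, IsChainTuple]
    rw [← e.tsum_eq]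
    refine tsum_congr fun k => ?_
    rw [firstEntry_succ, Finset.prod_inv_distrib]
    rfl
  have := h s.length s.get (List.length_pos_iff.2 hs)
  rw [List.ofFn_get] at this
  exact this

theorem polylog_nil (w : ℂ) : polylog [] w = 1 := by
  have : Unique {k : Fin ([] : List ℕ).length → ℕ // StrictAnti k ∧ ∀ i, 1 ≤ k i} :=
    { default := ⟨fun i => i.elim0, fun i => i.elim0, fun i => i.elim0⟩
      uniq := fun k => Subtype.ext (funext fun i => i.elim0) }
  rw [polylog, tsum_eq_single default fun k hk => absurd (Subsingleton.elim k _) hk]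
  simp [firstEntry]

theorem zetaVec_mem_logSpace {s : List ℕ} (hs : ∀ a ∈ s, 1 ≤ a) :
    seqModule.zetaVec s ∈ logSpace :=
  stdSpan_le_logSpace _ _ (seqModule.zetaVec_mem_stdSpan hs)

theorem regLinear_zetaVec {s : List ℕ} (hs : ∀ a ∈ s, 1 ≤ a) :
    regLinear (seqModule.zetaVec s) = zetaSh s := by
  rw [regLinear_apply (zetaVec_mem_logSpace hs), zetaSh]
  obtain ⟨-, Q, hQ⟩ := zetaVec_mem_logSpace hs
  -- For the empty list the functions differ: `polylog []` is 1, while `base` has generating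
  -- function `w`. Their expansions at 1 agree.
  by_cases h : s = []
  · subst h
    have h1 : IsLogExpansion (polylog []) 1 :=
      isLogExpansion_one.congr (Filter.Eventually.of_forall fun w => (polylog_nil w).symm)
    have h2 : IsLogExpansion (genFun (seqModule.zetaVec [])) 1 := by
      refine isLogExpansion_one.mul_self.congr (Filter.Eventually.of_forall fun w => ?_)
      change w * 1 = genFun seqModule.base w
      rw [genFun, tsum_eq_single 0]
      · simp [seqModule]
      · intro j hj
        simp [seqModule, hj]
    rw [h1.regValue_eq, h2.regValue_eq]
  · have h1 : IsLogExpansion (polylog s) Q := by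
      refine hQ.congr ?_
      filter_upwards [self_mem_nhdsWithin] with w hw
      exact (polylog_eq_genFun h (by simpa using hw)).symm
    rw [h1.regValue_eq, hQ.regValue_eq]

/-- The factors of the nested sum of a monomial. -/
def factors {p : ℕ} (A n e : Fin p → ℕ) : List (ℕ × ℕ × ℕ) := List.ofFn fun i => (A i, n i, e i)

theorem seriesTerm_eq {q : ℕ} (A n : Fin (q + 1) → ℕ) (P : MvPolynomial (Fin (q + 1)) ℚ) (w : ℂ)
    (k : WideTuple (q + 1)) : seriesTerm A n P w⁻¹ k =
      ∑ d ∈ P.support, ((P.coeff d : ℚ) : ℂ) *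
        (w ^ k.1 0 * ∏ i, factorFun (A i, n i, d i) (k.1 i)) := by
  rw [seriesTerm, firstEntry_succ, MvPolynomial.eval_eq', zpow_neg, inv_zpow, inv_inv,
    zpow_natCast]
  push_cast
  rw [Finset.sum_div, Finset.sum_mul]
  refine Finset.sum_congr rfl fun d _ => ?_
  simp only [factorFun, Finset.prod_div_distrib]
  have h : ∀ i, (((ascPochhammer ℚ (n i + 1)).eval (k.1 i : ℚ) : ℚ) : ℂ) =
      (ascPochhammer ℂ (n i + 1)).eval (k.1 i : ℂ) := fun i => by
    rw [ascPochhammer_nat_eq_natCast_ascFactorial, ascPochhammer_nat_eq_natCast_ascFactorial,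
      Rat.cast_natCast]
  simp only [h]
  ring

/-- The coefficients of the series, as a function of `1 / z`. -/
noncomputable def polySeq {p : ℕ} (A n : Fin p → ℕ) (P : MvPolynomial (Fin p) ℚ) : ℕ → ℂ :=
  ∑ d ∈ P.support, P.coeff d • seqModule.nested (factors A n d)

theorem hasSum_nested {q : ℕ} (f : Fin (q + 1) → ℕ × ℕ × ℕ) {w : ℂ} (hw : ‖w‖ < 1) :
    HasSum (fun k : WideTuple (q + 1) => w ^ k.1 0 * ∏ i, factorFun (f i) (k.1 i))
      (genFun (seqModule.nested (List.ofFn f)) w) := by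
  have hz := funext (nested_ofFn_apply f)
  have hP : PolyBounded fun j =>
      chainSum (fun b a => b ≤ a) (fun i => factorFun (f i)) (j + 1) := by
    rw [← hz]
    exact polyBounded_nested _
  have h := hasSum_chainTuple (R := fun b a => b ≤ a) (fun _ _ h => h)
    (G := fun i => factorFun (f i)) (fun i a => norm_factorFun _ _) hP hw
  rw [← hz] at h
  have e : ∀ k : Fin (q + 1) → ℕ, IsChainTuple (fun b a => b ≤ a) k ↔
      (Antitone k ∧ ∀ i, 1 ≤ k i) := fun k =>
    and_congr_left fun _ => Fin.antitone_iff_succ_le.symm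
  rw [← (Equiv.subtypeEquivRight e).hasSum_iff]
  exact h

/-- The argument runs monomial by monomial, since positivity holds for each `factorFun` but not for
`P`. -/
theorem hasSum_seriesTerm {q : ℕ} (A n : Fin (q + 1) → ℕ) (P : MvPolynomial (Fin (q + 1)) ℚ)
    {w : ℂ} (hw : ‖w‖ < 1) : HasSum (seriesTerm A n P w⁻¹) (genFun (polySeq A n P) w) := by
  have h1 : ∀ d : Fin (q + 1) →₀ ℕ, HasSum (fun k : WideTuple (q + 1) =>
      w ^ k.1 0 * ∏ i, factorFun (A i, n i, d i) (k.1 i))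
        (genFun (seqModule.nested (factors A n d)) w) := fun d => hasSum_nested _ hw
  have h2 : genFun (polySeq A n P) w =
      ∑ d ∈ P.support, ((P.coeff d : ℚ) : ℂ) * genFun (seqModule.nested (factors A n d)) w := by
    simp only [genFun, ← tsum_mul_left]
    rw [← Summable.tsum_finsetSum fun d _ => ((polyBounded_nested _).summable hw).mul_left _]
    refine tsum_congr fun j => ?_
    simp only [polySeq, Finset.sum_apply, Pi.smul_apply, Rat.smul_def, Finset.sum_mul, mul_assoc]
  rw [h2, show seriesTerm A n P w⁻¹ = _ from funext (seriesTerm_eq A n P w)]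
  exact hasSum_sum fun d _ => (h1 d).mul_left _

end Comparison

/-! ### Primitive recursive operations on words -/

section Primrec

variable {α β γ : Type*} [Primcodable α] [Primcodable β] [Primcodable γ]

theorem primrec_list_replicate : Primrec₂ (List.replicate : ℕ → α → List α) := by
  have : Primrec₂ fun (n : ℕ) (a : α) => (List.range n).map fun _ => a :=
    Primrec.list_map (Primrec.list_range.comp Primrec.fst) (Primrec.snd.comp Primrec.fst).to₂
  exact this.of_eq fun n a => by simp

theorem primrec_list_sum : Primrec (List.sum : List ℕ → ℕ) := by
  have : Primrec fun l : List ℕ => l.foldr (fun a s => a + s) 0 :=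
    Primrec.list_foldr Primrec.id (Primrec.const 0)
      (Primrec.nat_add.comp (Primrec.fst.comp Primrec.snd) (Primrec.snd.comp Primrec.snd)).to₂
  exact this.of_eq fun l => by rw [List.sum_eq_foldr]

theorem primrec_list_count [DecidableEq α] : Primrec₂ fun (l : List α) (a : α) => l.count a := by
  have h : Primrec₂ fun (p : List α × α) (q : α × ℕ) => if q.1 = p.2 then q.2 + 1 else q.2 :=
    Primrec.ite (Primrec.eq.comp (Primrec.fst.comp Primrec.snd) (Primrec.snd.comp Primrec.fst))
      (Primrec.succ.comp (Primrec.snd.comp Primrec.snd)) (Primrec.snd.comp Primrec.snd)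
  refine (Primrec.list_foldr Primrec.fst (Primrec.const 0) h).to₂.of_eq fun l a => ?_
  induction l with
  | nil => rfl
  | cons b l ih =>
    simp only [List.foldr_cons, List.count_cons, beq_iff_eq] at ih ⊢
    rw [ih]
    split_ifs <;> rfl

/-- Only elements of the two lists have to be counted, which bounds the quantifier. -/
theorem primrecRel_perm [DecidableEq α] : PrimrecRel fun l l' : List α => l.Perm l' := by
  have h : PrimrecRel fun (a : α) (p : List α × List α) => p.1.count a = p.2.count a :=
    Primrec.eq.comp (primrec_list_count.comp (Primrec.fst.comp Primrec.snd) Primrec.fst)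
      (primrec_list_count.comp (Primrec.snd.comp Primrec.snd) Primrec.fst)
  have h2 := (h.forall_mem_list).comp (Primrec.list_append.comp Primrec.fst Primrec.snd)
    (Primrec.id (α := List α × List α))
  change PrimrecPred fun p : List α × List α => p.1.Perm p.2
  refine h2.of_eq fun p => ?_
  rw [List.perm_iff_count]
  refine ⟨fun H a => ?_, fun H a _ => H a⟩
  by_cases ha : a ∈ p.1 ++ p.2
  · exact H a ha
  · rw [List.mem_append, not_or] at ha
    rw [List.count_eq_zero_of_not_mem ha.1, List.count_eq_zero_of_not_mem ha.2]

theorem primrec_int_neg : Primrec fun a : ℤ => -a := by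
  refine Primrec.encode_iff.1 ?_
  -- Integers are coded by `n ↦ 2 * n` and `-(n + 1) ↦ 2 * n + 1`; negation exchanges the codes `2 *
  -- n + 1` and `2 * n + 2` and fixes 0.
  have h : Primrec fun m : ℕ => bif m.bodd then m + 1 else m - 1 :=
    Primrec.cond Primrec.nat_bodd Primrec.succ Primrec.pred
  refine (h.comp Primrec.encode).of_eq fun a => ?_
  change (bif (Equiv.intEquivNat a).bodd then _ else _) = Equiv.intEquivNat (-a)
  rcases a with (_ | n) | n
  · rfl
  · have h1 : Equiv.intEquivNat (Int.ofNat (n + 1)) = 2 * (n + 1) := rfl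
    have h2 : Equiv.intEquivNat (-Int.ofNat (n + 1)) = 2 * n + 1 := rfl
    change (bif (2 * (n + 1)).bodd then 2 * (n + 1) + 1 else 2 * (n + 1) - 1) = 2 * n + 1
    simp
    omega
  · change (bif (2 * n + 1).bodd then 2 * n + 1 + 1 else 2 * n + 1 - 1) = 2 * (n + 1)
    simp
    omega

theorem primrec_stdWord : Primrec stdWord :=
  Primrec.list_flatMap Primrec.id (Primrec.list_append.comp
    (primrec_list_replicate.comp (Primrec.succ.comp (Primrec.snd.comp Primrec.snd))
      (Primrec.nat_add.comp (Primrec.fst.comp Primrec.snd) (Primrec.const 3)))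
    (Primrec.const [2])).to₂

theorem primrec_zetaWord : Primrec zetaWord := by
  have h : Primrec₂ fun (_ : List ℕ) (q : ℕ × List ℕ) =>
      List.replicate q.1 3 ++ if q.2 = [] then [2] else 1 :: 2 :: q.2 :=
    Primrec.list_append.comp
      (primrec_list_replicate.comp (Primrec.fst.comp Primrec.snd) (Primrec.const 3))
      (Primrec.ite (Primrec.eq.comp (Primrec.snd.comp Primrec.snd) (Primrec.const []))
        (Primrec.const [2]) (Primrec.list_cons.comp (Primrec.const 1)
          (Primrec.list_cons.comp (Primrec.const 2) (Primrec.snd.comp Primrec.snd))))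
  exact Primrec.list_foldr Primrec.id (Primrec.const []) h

theorem primrec_shifts : Primrec₂ SummationModule.shifts :=
  Primrec.list_flatten.comp (primrec_list_replicate.comp Primrec.fst
    (Primrec.list_range.comp (Primrec.succ.comp Primrec.snd)))

theorem primrec_nestedWord : Primrec nestedWord := by
  have h1 : Primrec fun f : ℕ × ℕ × ℕ => (SummationModule.shifts f.1 f.2.1).map (· + 3) :=
    Primrec.list_map (primrec_shifts.comp Primrec.fst (Primrec.fst.comp Primrec.snd))
      (Primrec.nat_add.comp Primrec.snd (Primrec.const 3)).to₂
  have h2 : Primrec fun f : ℕ × ℕ × ℕ => List.replicate f.2.2 0 ++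
      ((SummationModule.shifts f.1 f.2.1).map (· + 3) ++ [2]) :=
    Primrec.list_append.comp
      (primrec_list_replicate.comp (Primrec.snd.comp Primrec.snd) (Primrec.const 0))
      (Primrec.list_append.comp h1 (Primrec.const [2]))
  exact Primrec.list_flatMap Primrec.id (h2.comp Primrec.snd).to₂

theorem primrec_relations : Primrec relations := by
  have hl : Primrec fun p : (List ℕ × List ℕ) × ℕ × List (ℕ × ℕ) => p.1.1 :=
    Primrec.fst.comp Primrec.fst
  have hr : Primrec fun p : (List ℕ × List ℕ) × ℕ × List (ℕ × ℕ) => p.1.2 :=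
    Primrec.snd.comp Primrec.fst
  have ha : Primrec fun p : (List ℕ × List ℕ) × ℕ × List (ℕ × ℕ) => p.2.1 :=
    Primrec.fst.comp Primrec.snd
  have hm : Primrec fun p : (List ℕ × List ℕ) × ℕ × List (ℕ × ℕ) => stdWord p.2.2 :=
    primrec_stdWord.comp (Primrec.snd.comp Primrec.snd)
  have hY : Primrec fun p : (List ℕ × List ℕ) × ℕ × List (ℕ × ℕ) => p.2.1 + 3 :=
    Primrec.nat_add.comp ha (Primrec.const 3)
  have cons : ∀ {δ : Type} [Primcodable δ]
      {f : (List ℕ × List ℕ) × ℕ × List (ℕ × ℕ) → δ} {g : _ → List δ},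
      Primrec f → Primrec g → Primrec fun p => f p :: g p :=
    fun hf hg => Primrec.list_cons.comp hf hg
  have app : ∀ {δ : Type} [Primcodable δ]
      {f g : (List ℕ × List ℕ) × ℕ × List (ℕ × ℕ) → List δ},
      Primrec f → Primrec g → Primrec fun p => f p ++ g p :=
    fun hf hg => Primrec.list_append.comp hf hg
  have hlr := app hl hr
  have hrep := primrec_list_replicate.comp ha (app hl (cons hY hr))
  have one : ∀ i, Primrec fun p : (List ℕ × List ℕ) × ℕ × List (ℕ × ℕ) =>
      List.replicate (p.2.1 + i) 1 := fun i =>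
    primrec_list_replicate.comp (Primrec.nat_add.comp ha (Primrec.const i)) (Primrec.const 1)
  have c := fun i : ℕ => Primrec.const (α := (List ℕ × List ℕ) × ℕ × List (ℕ × ℕ)) i
  have nil := Primrec.const (α := (List ℕ × List ℕ) × ℕ × List (ℕ × ℕ)) ([] : List (List ℕ))
  have nil' := Primrec.const (α := (List ℕ × List ℕ) × ℕ × List (ℕ × ℕ))
    ([] : List (List ℕ × List (List ℕ)))
  exact cons (hlr.pair (cons (app hl (cons (c 0) (cons hY hr))) hrep))
    (cons (hlr.pair (cons (app hl (cons hY (cons (c 0) hr))) hrep))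
    (cons ((app hl (cons (c 2) hr)).pair
      (cons (app hl (cons (c 1) (cons (c 2) hr))) (cons hlr nil)))
    (cons ((app hl (cons (c 2) hr)).pair
      (cons (app hl (cons (c 2) (cons (c 1) hr))) (cons hlr nil)))
    (cons ((app hl (cons (c 0) (cons (c 1) hr))).pair
      (cons (app hl (cons (c 1) (cons (c 0) hr))) (cons (app hl (cons (c 1) hr)) nil)))
    (cons ((app hl (Primrec.const [0])).pair (cons hl nil))
    (cons ((app (one 1) hm).pair (cons (app (one 0) hm) nil)) nil'))))))

theorem primrec_relation : Primrec relation :=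
  (Primrec.list_getD _).comp (primrec_relations.comp Primrec.snd) Primrec.fst

theorem primrec_lhs : Primrec₂ Certificate.lhs := by
  have h1 : Primrec fun c : Certificate => c.2.1.2.map zetaWord :=
    Primrec.list_map (Primrec.snd.comp (Primrec.fst.comp Primrec.snd))
      (primrec_zetaWord.comp Primrec.snd).to₂
  have h2 : Primrec fun c : Certificate => c.2.2.1.flatMap fun q => (relation q).2 :=
    Primrec.list_flatMap (Primrec.fst.comp (Primrec.snd.comp Primrec.snd))
      (Primrec.snd.comp (primrec_relation.comp Primrec.snd)).to₂
  have h3 : Primrec fun c : Certificate => c.2.2.2.map fun q => (relation q).1 :=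
    Primrec.list_map (Primrec.snd.comp (Primrec.snd.comp Primrec.snd))
      (Primrec.fst.comp (primrec_relation.comp Primrec.snd)).to₂
  exact Primrec.list_append.comp
    (primrec_list_replicate.comp (Primrec.succ.comp (Primrec.fst.comp Primrec.snd)) Primrec.fst)
    ((Primrec.list_append.comp h1 (Primrec.list_append.comp h2 h3)).comp Primrec.snd)

theorem primrec_rhs : Primrec Certificate.rhs := by
  have h1 : Primrec fun c : Certificate => c.2.1.1.map zetaWord :=
    Primrec.list_map (Primrec.fst.comp (Primrec.fst.comp Primrec.snd))
      (primrec_zetaWord.comp Primrec.snd).to₂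
  have h2 : Primrec fun c : Certificate => c.2.2.1.map fun q => (relation q).1 :=
    Primrec.list_map (Primrec.fst.comp (Primrec.snd.comp Primrec.snd))
      (Primrec.fst.comp (primrec_relation.comp Primrec.snd)).to₂
  have h3 : Primrec fun c : Certificate => c.2.2.2.flatMap fun q => (relation q).2 :=
    Primrec.list_flatMap (Primrec.snd.comp (Primrec.snd.comp Primrec.snd))
      (Primrec.snd.comp (primrec_relation.comp Primrec.snd)).to₂
  exact Primrec.list_append.comp h1 (Primrec.list_append.comp h2 h3)

theorem primrec_excess : Primrec SummationModule.excess := by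
  have h : Primrec₂ fun (_ : List (ℕ × ℕ × ℕ)) (q : (ℕ × ℕ × ℕ) × ℕ) =>
      q.1.2.2 + 1 + q.2 - q.1.1 * (q.1.2.1 + 1) := by
    have hf : Primrec fun x : List (ℕ × ℕ × ℕ) × (ℕ × ℕ × ℕ) × ℕ => x.2.1 :=
      Primrec.fst.comp Primrec.snd
    exact Primrec.nat_sub.comp
      (Primrec.nat_add.comp (Primrec.succ.comp (Primrec.snd.comp (Primrec.snd.comp hf)))
        (Primrec.snd.comp Primrec.snd))
      (Primrec.nat_mul.comp (Primrec.fst.comp hf)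
        (Primrec.succ.comp (Primrec.fst.comp (Primrec.snd.comp hf))))
  refine (Primrec.list_foldr Primrec.id (Primrec.const 0) h).of_eq fun l => ?_
  induction l with
  | nil => rfl
  | cons f l ih => exact congrArg (fun r => f.2.2 + 1 + r - f.1 * (f.2.1 + 1)) ih

/-- The list of factors of a monomial, from the lists of the parameters. -/
def factorList (A n e : List ℕ) : List (ℕ × ℕ × ℕ) :=
  (List.range A.length).map fun i => (A.getD i 0, n.getD i 0, e.getD i 0)

theorem primrec_factorList :
    Primrec fun x : List ℕ × List ℕ × List ℕ => factorList x.1 x.2.1 x.2.2 := by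
  have hx : Primrec fun y : (List ℕ × List ℕ × List ℕ) × ℕ => y.1 := Primrec.fst
  exact Primrec.list_map (Primrec.list_range.comp (Primrec.list_length.comp Primrec.fst))
    (Primrec.pair ((Primrec.list_getD 0).comp (Primrec.fst.comp hx) Primrec.snd)
      (Primrec.pair
        ((Primrec.list_getD 0).comp (Primrec.fst.comp (Primrec.snd.comp hx)) Primrec.snd)
        ((Primrec.list_getD 0).comp (Primrec.snd.comp (Primrec.snd.comp hx)) Primrec.snd))).to₂

end Primrec

/-! ### Certified terms and unbounded search -/

/-- A term of a code, together with a certificate. -/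
abbrev CertifiedTerm : Type := ((ℤ × ℕ) × List ℕ) × Certificate

/-- The certificate of a term is correct, if the term satisfies the degree condition. -/
def IsCorrect (L : List ℕ × List ℕ) (x : CertifiedTerm) : Prop :=
  SummationModule.excess (factorList L.1 L.2 x.1.2) ≠ 0 ∨
    (Certificate.lhs (nestedWord (factorList L.1 L.2 x.1.2)) x.2).Perm x.2.rhs ∧
    ∀ s ∈ x.2.2.1.1 ++ x.2.2.1.2, s.length ≤ L.1.length ∧ (∀ a ∈ s, 1 ≤ a) ∧ s.sum ≤ L.1.sum

/-- The linear combination that is read off from a certified term. -/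
def termOutput (L : List ℕ × List ℕ) (x : CertifiedTerm) : Code :=
  if SummationModule.excess (factorList L.1 L.2 x.1.2) = 0 then
    x.2.2.1.1.map (fun s => ((x.1.1.1, (x.1.1.2 + 1) * (x.2.1 + 1) - 1), s)) ++
      x.2.2.1.2.map fun s => ((-x.1.1.1, (x.1.1.2 + 1) * (x.2.1 + 1) - 1), s)
  else []

theorem primrec_factorList_term : Primrec₂ fun (L : List ℕ × List ℕ) (x : CertifiedTerm) =>
    factorList L.1 L.2 x.1.2 :=
  primrec_factorList.comp (Primrec.pair (Primrec.fst.comp Primrec.fst) (Primrec.pair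
    (Primrec.snd.comp Primrec.fst) (Primrec.snd.comp (Primrec.fst.comp Primrec.snd))))

theorem primrecRel_excess_eq_zero : PrimrecRel fun (L : List ℕ × List ℕ) (x : CertifiedTerm) =>
    SummationModule.excess (factorList L.1 L.2 x.1.2) = 0 :=
  Primrec.eq.comp (primrec_excess.comp primrec_factorList_term) (Primrec.const 0)

theorem primrecRel_isCorrect : PrimrecRel IsCorrect := by
  have h1 : PrimrecRel fun (s : List ℕ) (L : List ℕ) =>
      s.length ≤ L.length ∧ (∀ a ∈ s, 1 ≤ a) ∧ s.sum ≤ L.sum := by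
    refine PrimrecPred.and ?_ (PrimrecPred.and ?_ ?_)
    · exact Primrec.nat_le.comp (Primrec.list_length.comp Primrec.fst)
        (Primrec.list_length.comp Primrec.snd)
    · have : PrimrecPred fun a : ℕ => 1 ≤ a := Primrec.nat_le.comp (Primrec.const 1) Primrec.id
      exact this.forall_mem_list.comp Primrec.fst
    · exact Primrec.nat_le.comp (primrec_list_sum.comp Primrec.fst)
        (primrec_list_sum.comp Primrec.snd)
  have hc : Primrec fun y : (List ℕ × List ℕ) × CertifiedTerm => y.2.2 :=
    Primrec.snd.comp Primrec.snd
  have hs : Primrec fun y : (List ℕ × List ℕ) × CertifiedTerm => y.2.2.2.1 :=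
    Primrec.fst.comp (Primrec.snd.comp hc)
  refine PrimrecPred.or (PrimrecPred.not primrecRel_excess_eq_zero) (PrimrecPred.and ?_ ?_)
  · exact primrecRel_perm.comp
      (primrec_lhs.comp (primrec_nestedWord.comp primrec_factorList_term) hc)
      (primrec_rhs.comp hc)
  · exact h1.forall_mem_list.comp
      (Primrec.list_append.comp (Primrec.fst.comp hs) (Primrec.snd.comp hs))
      (Primrec.fst.comp Primrec.fst)

theorem primrec_termOutput : Primrec₂ termOutput := by
  have hx : Primrec fun z : ((List ℕ × List ℕ) × CertifiedTerm) × List ℕ => z.1.2 :=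
    Primrec.snd.comp Primrec.fst
  have ht : Primrec fun z : ((List ℕ × List ℕ) × CertifiedTerm) × List ℕ => z.1.2.1.1 :=
    Primrec.fst.comp (Primrec.fst.comp hx)
  have hd : Primrec fun z : ((List ℕ × List ℕ) × CertifiedTerm) × List ℕ =>
      (z.1.2.1.1.2 + 1) * (z.1.2.2.1 + 1) - 1 :=
    Primrec.pred.comp (Primrec.nat_mul.comp (Primrec.succ.comp (Primrec.snd.comp ht))
      (Primrec.succ.comp (Primrec.fst.comp (Primrec.snd.comp hx))))
  have hs : Primrec fun y : (List ℕ × List ℕ) × CertifiedTerm => y.2.2.2.1 :=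
    Primrec.fst.comp (Primrec.snd.comp (Primrec.snd.comp Primrec.snd))
  exact Primrec.ite primrecRel_excess_eq_zero
    (Primrec.list_append.comp
      (Primrec.list_map (Primrec.fst.comp hs)
        (((Primrec.fst.comp ht).pair hd).pair Primrec.snd).to₂)
      (Primrec.list_map (Primrec.snd.comp hs)
        (((primrec_int_neg.comp (Primrec.fst.comp ht)).pair hd).pair Primrec.snd).to₂))
    (Primrec.const [])

/-- A list of certified terms is a correct certification of a code. -/
def Certifies (x : (List ℕ × List ℕ) × Code) (Z : List CertifiedTerm) : Prop :=
  Z.map Prod.fst = x.2 ∧ ∀ z ∈ Z, IsCorrect x.1 z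

theorem primrecRel_certifies : PrimrecRel Certifies := by
  have h1 : Primrec fun Z : List CertifiedTerm => Z.map Prod.fst :=
    Primrec.list_map Primrec.id (Primrec.fst.comp Primrec.snd).to₂
  refine PrimrecPred.and (Primrec.eq.comp (h1.comp Primrec.snd) (Primrec.snd.comp Primrec.fst)) ?_
  exact (PrimrecRel.swap primrecRel_isCorrect).forall_mem_list.comp Primrec.snd
    (Primrec.fst.comp Primrec.fst)

/-- A search that succeeds on all inputs can be performed by a computable function. -/
theorem exists_computable_choice {α β : Type*} [Primcodable α] [Primcodable β]
    {r : α → β → Prop} (hr : PrimrecRel r) (h : ∀ a, ∃ b, r a b) :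
    ∃ f : α → β, Computable f ∧ ∀ a, r a (f a) := by
  classical
  -- Candidates are enumerated by their codes and kept if they satisfy `r a`; `h` makes the search
  -- total.
  let g : α → ℕ → Option β := fun a n => (Encodable.decode (α := β) n).bind fun b =>
    if r a b then some b else none
  have hg : Primrec₂ g := by
    refine Primrec.option_bind (Primrec.decode.comp Primrec.snd) ?_
    exact Primrec.ite (hr.comp (Primrec.fst.comp Primrec.fst) Primrec.snd)
      (Primrec.option_some.comp Primrec.snd) (Primrec.const none)
  have hgr : ∀ a n b, b ∈ g a n → r a b := by
    intro a n b hb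
    obtain ⟨b', -, hb'⟩ := Option.bind_eq_some_iff.1 hb
    split_ifs at hb' with h1
    · cases hb'; exact h1
  have hdom : ∀ a, (Nat.rfindOpt (g a)).Dom := by
    intro a
    obtain ⟨b, hb⟩ := h a
    refine Nat.rfindOpt_dom.2 ⟨Encodable.encode b, b, ?_⟩
    simp [g, hb]
  refine ⟨fun a => (Nat.rfindOpt (g a)).get (hdom a), ?_, fun a => ?_⟩
  · exact (Partrec.rfindOpt hg.to_comp).of_eq fun a => (Part.some_get (hdom a)).symm
  · obtain ⟨n, hn⟩ := Nat.rfindOpt_spec (Part.get_mem (hdom a))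
    exact hgr a n _ hn

/-! ### The degree condition -/

section DegreeCondition

theorem sum_Iic_succ {M : Type*} [AddCommMonoid M] {p : ℕ} (f : Fin (p + 1) → M) (j : Fin p) :
    ∑ i ∈ Finset.Iic j.succ, f i = f 0 + ∑ i ∈ Finset.Iic j, f i.succ := by
  rw [← Finset.filter_ge_eq_Iic, ← Finset.filter_ge_eq_Iic, Finset.sum_filter, Finset.sum_filter,
    Fin.sum_univ_succ]
  simp

/-- Unfolded, `excess` is the largest sum of `e_i + 1 - A_i * (n_i + 1)` over initial segments, or
zero. The bound `c` is arbitrary so that the induction can hand the slack of the first factor to the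
tail. -/
theorem excess_factors_le {p : ℕ} {A n e : Fin p → ℕ} {c : ℕ}
    (h : ∀ j, ∑ i ∈ Finset.Iic j, (e i + 1) ≤ ∑ i ∈ Finset.Iic j, A i * (n i + 1) + c) :
    SummationModule.excess (factors A n e) ≤ c := by
  induction p generalizing c with
  | zero => exact Nat.zero_le _
  | succ p ih =>
    have h0 := h 0
    have hbot : Finset.Iic (0 : Fin (p + 1)) = {0} := by ext i; simp
    rw [hbot, Finset.sum_singleton, Finset.sum_singleton] at h0
    have := @ih (fun i => A i.succ) (fun i => n i.succ) (fun i => e i.succ)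
      (A 0 * (n 0 + 1) + c - (e 0 + 1)) fun j => by
        have := h j.succ
        rw [sum_Iic_succ, sum_Iic_succ] at this
        omega
    rw [factors, List.ofFn_succ, SummationModule.excess]
    rw [factors] at this
    omega

/-- `D_j + 1` is the sum of the `A_i * (n_i + 1)` minus the number of indices, so the condition
bounds sums of partial degrees plus one, hence of exponents plus one. -/
theorem DegreeCondition.excess_eq_zero {p : ℕ} {A n : Fin p → ℕ} {P : MvPolynomial (Fin p) ℚ}
    (h : DegreeCondition A n P) {d : Fin p →₀ ℕ} (hd : d ∈ P.support) :
    SummationModule.excess (factors A n d) = 0 := by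
  refine Nat.le_zero.1 (excess_factors_le fun j => ?_)
  have h1 := h j
  have h2 : ∑ i ∈ Finset.Iic j, (d i : ℤ) ≤ ∑ i ∈ Finset.Iic j, (P.degreeOf i : ℤ) :=
    Finset.sum_le_sum fun i _ => by exact_mod_cast MvPolynomial.monomial_le_degreeOf i hd
  rw [D] at h1
  zify
  rw [Finset.sum_add_distrib, Finset.sum_const, Fin.card_Iic]
  simp only [nsmul_eq_mul, mul_one]
  push_cast
  linarith

theorem length_factors {p : ℕ} (A n e : Fin p → ℕ) : (factors A n e).length = p :=
  List.length_ofFn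

theorem factorWeight_factors {p : ℕ} (A n e : Fin p → ℕ) :
    SummationModule.factorWeight (factors A n e) = ∑ i, A i := by
  rw [SummationModule.factorWeight, factors, List.map_ofFn, List.sum_ofFn]
  rfl

theorem factorList_ofFn {p : ℕ} (A n : Fin p → ℕ) (e : List ℕ) :
    factorList (List.ofFn A) (List.ofFn n) e = factors A n fun i => e.getD i 0 := by
  refine List.ext_getElem (by simp [factorList, factors]) fun i h1 h2 => ?_
  have hi : i < p := by simpa [factors] using h2
  simp [factorList, factors, hi]

end DegreeCondition

/-! ### The regularized value of the series -/

section RegularizedValue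

variable {p : ℕ} (A n : Fin p → ℕ)

/-- The regularized value of the series, as a linear function of the polynomial. Monomials whose
series is not at most logarithmically divergent are sent to `0`. -/
noncomputable def regPoly : MvPolynomial (Fin p) ℚ →ₗ[ℚ] ℂ :=
  (MvPolynomial.basisMonomials (Fin p) ℚ).constr ℚ fun d =>
    if SummationModule.excess (factors A n d) = 0 then
      regLinear (seqModule.nested (factors A n d))
    else 0

theorem regPoly_monomial (d : Fin p →₀ ℕ) (c : ℚ) :
    regPoly A n (MvPolynomial.monomial d c) =
      if SummationModule.excess (factors A n d) = 0 then
        (c : ℂ) * regLinear (seqModule.nested (factors A n d))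
      else 0 := by
  have h : MvPolynomial.monomial d c = c • MvPolynomial.basisMonomials (Fin p) ℚ d := by
    rw [MvPolynomial.coe_basisMonomials, MvPolynomial.smul_monomial, smul_eq_mul, mul_one]
  rw [h, map_smul, regPoly, Module.Basis.constr_basis]
  split_ifs
  · rw [Rat.smul_def]
  · rw [smul_zero]

variable {A n} {P : MvPolynomial (Fin p) ℚ}

/-- The degree condition passes to each monomial of `P`, so the default value of `regPoly` does not
intervene. -/
theorem regPoly_eq_regLinear (h : DegreeCondition A n P) :
    regPoly A n P = regLinear (polySeq A n P) := by
  conv_lhs => rw [← P.support_sum_monomial_coeff]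
  rw [polySeq, map_sum, map_sum]
  refine Finset.sum_congr rfl fun d hd => ?_
  rw [regPoly_monomial, if_pos (h.excess_eq_zero hd), map_smul, Rat.smul_def]

theorem polySeq_mem_logSpace (h : DegreeCondition A n P) : polySeq A n P ∈ logSpace :=
  Submodule.sum_mem _ fun _ hd => Submodule.smul_mem _ _
    (stdSpan_le_logSpace _ _ (seqModule.nested_mem_stdSpan (h.excess_eq_zero hd)))

theorem regLinear_nested_mem_span {d : Fin p → ℕ}
    (h : SummationModule.excess (factors A n d) = 0) :
    regLinear (seqModule.nested (factors A n d)) ∈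
      Submodule.span ℚ (zetaSh '' {s | Admissible A s}) := by
  have := seqModule.map_nested_mem_span_zetaVec (φ := regLinear)
    (fun j l => (seqModule_E_pow_std j l).2) h
  refine Submodule.span_mono ?_ this
  rintro _ ⟨s, ⟨h1, h2, h3⟩, rfl⟩
  rw [length_factors] at h1
  rw [factorWeight_factors] at h3
  exact ⟨s, ⟨h1, h2, h3⟩, (regLinear_zetaVec h2).symm⟩

theorem regPoly_mem_span (h : DegreeCondition A n P) :
    regPoly A n P ∈ Submodule.span ℚ (zetaSh '' {s | Admissible A s}) := by
  rw [regPoly_eq_regLinear h, polySeq, map_sum]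
  refine Submodule.sum_mem _ fun d hd => ?_
  rw [map_smul]
  exact Submodule.smul_mem _ _ (regLinear_nested_mem_span (h.excess_eq_zero hd))

theorem summable_seriesTerm (hp : 1 ≤ p) {z : ℂ} (hz : 1 < ‖z‖) :
    Summable (seriesTerm A n P z) := by
  obtain ⟨q, rfl⟩ := Nat.exists_eq_add_of_le' hp
  have h := (hasSum_seriesTerm A n P (w := z⁻¹)
    (by rw [norm_inv]; exact inv_lt_one_of_one_lt₀ hz)).summable
  rwa [inv_inv] at h

theorem exists_isLogExpansion_seriesInv (hp : 1 ≤ p) (h : DegreeCondition A n P) :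
    ∃ Q, IsLogExpansion (seriesInv A n P) Q ∧ Q.eval 0 = regPoly A n P := by
  obtain ⟨q, rfl⟩ := Nat.exists_eq_add_of_le' hp
  have hm := polySeq_mem_logSpace h
  obtain ⟨Q, hQ⟩ := hm.2
  refine ⟨Q, hQ.congr ?_, ?_⟩
  · filter_upwards [self_mem_nhdsWithin] with w hw
    exact (hasSum_seriesTerm A n P (by simpa using hw)).tsum_eq.symm
  · rw [regPoly_eq_regLinear h, regLinear_apply hm, hQ.regValue_eq]

theorem regValue_seriesInv (hp : 1 ≤ p) (h : DegreeCondition A n P) :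
    regValue (seriesInv A n P) = regPoly A n P := by
  obtain ⟨Q, hQ, h0⟩ := exists_isLogExpansion_seriesInv hp h
  rw [hQ.regValue_eq, h0]

end RegularizedValue

/-! ### The algorithm -/

section Algorithm

theorem zetaCombination_append (c c' : Code) :
    zetaCombination (c ++ c') = zetaCombination c + zetaCombination c' := by
  simp [zetaCombination]

theorem zetaCombination_map_pair (a : ℤ × ℕ) (L : List (List ℕ)) :
    zetaCombination (L.map fun s => (a, s)) = (ratOfCode a : ℂ) * (L.map zetaSh).sum := by
  rw [zetaCombination, List.map_map, ← List.sum_map_mul_left]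
  rfl

theorem polyOfCode_term (p : ℕ) (t : (ℤ × ℕ) × List ℕ) :
    MvPolynomial.C (ratOfCode t.1) * ∏ i : Fin p, MvPolynomial.X i ^ t.2.getD i 0 =
      MvPolynomial.monomial (Finsupp.equivFunOnFinite.symm fun i : Fin p => t.2.getD i 0)
        (ratOfCode t.1) := by
  rw [MvPolynomial.monomial_eq, Finsupp.prod_fintype _ _ fun i => pow_zero _]
  rfl

variable {p : ℕ} {A n : Fin p → ℕ}

theorem IsCorrect.regLinear_nested_eq {x : CertifiedTerm}
    (h : IsCorrect (List.ofFn A, List.ofFn n) x)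
    (h0 : SummationModule.excess (factors A n fun i => x.1.2.getD i 0) = 0) :
    ((x.2.1 : ℂ) + 1) * regLinear (seqModule.nested (factors A n fun i => x.1.2.getD i 0)) =
      (x.2.2.1.1.map zetaSh).sum - (x.2.2.1.2.map zetaSh).sum := by
  rw [IsCorrect, factorList_ofFn] at h
  obtain ⟨hc, hs⟩ := h.resolve_left fun h => h h0
  have := Certificate.sound (v := fun w => regLinear (seqModule.eval w))
    (seqModule.eval_relation fun j l => (seqModule_E_pow_std j l).2) hc
  simp only [SummationModule.eval_nestedWord, SummationModule.eval_zetaWord] at this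
  have hz : ∀ L : List (List ℕ), (∀ s ∈ L, s ∈ x.2.2.1.1 ++ x.2.2.1.2) →
      (L.map fun s => regLinear (seqModule.zetaVec s)) = L.map zetaSh := fun L hL =>
    List.map_congr_left fun s h => regLinear_zetaVec (hs s (hL s h)).2.1
  rw [hz _ fun s h => List.mem_append_left _ h, hz _ fun s h => List.mem_append_right _ h] at this
  rw [← this, nsmul_eq_mul]
  push_cast
  rfl

/-- A term of nonzero excess has empty output, and `regPoly` sends it to zero. Such terms can occur
in a code whose polynomial satisfies the degree condition, if they cancel. -/
theorem IsCorrect.zetaCombination_termOutput {x : CertifiedTerm}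
    (h : IsCorrect (List.ofFn A, List.ofFn n) x) :
    zetaCombination (termOutput (List.ofFn A, List.ofFn n) x) = regPoly A n
      (MvPolynomial.C (ratOfCode x.1.1) * ∏ i : Fin p, MvPolynomial.X i ^ x.1.2.getD i 0) := by
  rw [polyOfCode_term, regPoly_monomial, termOutput, factorList_ofFn]
  change _ = if SummationModule.excess (factors A n fun i => x.1.2.getD i 0) = 0 then
    _ * regLinear (seqModule.nested (factors A n fun i => x.1.2.getD i 0)) else 0
  split_ifs with h0
  -- `(a, b)` codes `a / (b + 1)`, so the product of the two denominators is stored minus one.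
  · have hb : (((x.1.1.2 + 1) * (x.2.1 + 1) - 1 : ℕ) : ℂ) + 1 =
        ((x.1.1.2 : ℂ) + 1) * ((x.2.1 : ℂ) + 1) := by
      rw [Nat.cast_sub (Nat.succ_le_of_lt (by positivity))]
      push_cast
      ring
    have hb1 : (x.1.1.2 : ℂ) + 1 ≠ 0 := Nat.cast_add_one_ne_zero _
    have hb2 : (x.2.1 : ℂ) + 1 ≠ 0 := Nat.cast_add_one_ne_zero _
    rw [zetaCombination_append, zetaCombination_map_pair, zetaCombination_map_pair]
    have key := h.regLinear_nested_eq h0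
    rw [← sub_eq_zero] at key ⊢
    simp only [ratOfCode]
    push_cast [hb]
    field_simp
    linear_combination (-(x.1.1.1 : ℂ)) * key
  · rfl

theorem IsCorrect.admissible {x : CertifiedTerm} (h : IsCorrect (List.ofFn A, List.ofFn n) x) :
    ∀ t ∈ termOutput (List.ofFn A, List.ofFn n) x, Admissible A t.2 := by
  intro t ht
  rw [termOutput] at ht
  split_ifs at ht with h0
  · obtain ⟨-, hs⟩ := h.resolve_left fun h => h h0
    have hmem : t.2 ∈ x.2.2.1.1 ++ x.2.2.1.2 := by
      rw [List.mem_append] at ht ⊢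
      refine ht.imp ?_ ?_ <;>
      · intro ht
        obtain ⟨s, hs, rfl⟩ := List.mem_map.1 ht
        exact hs
    obtain ⟨h1, h2, h3⟩ := hs _ hmem
    rw [List.length_ofFn] at h1
    rw [List.sum_ofFn] at h3
    exact ⟨h1, h2, h3⟩
  · cases ht

/-- Solvable also without the degree condition, so that the search is total. -/
theorem exists_isCorrect (L : List ℕ × List ℕ) (t : (ℤ × ℕ) × List ℕ) :
    ∃ c : Certificate, IsCorrect L (t, c) := by
  by_cases h : SummationModule.excess (factorList L.1 L.2 t.2) = 0
  · obtain ⟨c, hc, hs⟩ := exists_certificate h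
    refine ⟨c, Or.inr ⟨hc, fun s h => ?_⟩⟩
    obtain ⟨h1, h2, h3⟩ := hs s h
    have hA : (factorList L.1 L.2 t.2).map Prod.fst = L.1 :=
      List.ext_getElem (by simp [factorList]) fun i _ hi => by simp [factorList, hi]
    rw [SummationModule.factorWeight, hA] at h3
    exact ⟨by simpa [factorList] using h1, h2, h3⟩
  · exact ⟨default, Or.inl h⟩

theorem exists_certifies (x : (List ℕ × List ℕ) × Code) : ∃ Z, Certifies x Z := by
  choose c hc using exists_isCorrect x.1
  refine ⟨x.2.map fun t => (t, c t), by simp [Function.comp_def], fun z hz => ?_⟩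
  obtain ⟨t, -, rfl⟩ := List.mem_map.1 hz
  exact hc t

/-- Linearity of `regPoly` lets the terms be treated one by one, even if monomials repeat or cancel.
-/
theorem Certifies.zetaCombination_eq {c : Code} {Z : List CertifiedTerm}
    (h : Certifies ((List.ofFn A, List.ofFn n), c) Z) :
    zetaCombination (Z.flatMap (termOutput (List.ofFn A, List.ofFn n))) =
      regPoly A n (polyOfCode p c) := by
  obtain ⟨rfl, h⟩ := h
  induction Z with
  | nil => simp [polyOfCode, zetaCombination]
  | cons z Z ih =>
    obtain ⟨hz, hZ⟩ := List.forall_mem_cons.1 h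
    rw [List.flatMap_cons, zetaCombination_append, ih hZ, hz.zetaCombination_termOutput, ← map_add]
    rfl

theorem primrec_flatMap_termOutput :
    Primrec₂ fun (x : (List ℕ × List ℕ) × Code) (Z : List CertifiedTerm) =>
      Z.flatMap (termOutput x.1) := by
  have hL : Primrec fun z : (((List ℕ × List ℕ) × Code) × List CertifiedTerm) × CertifiedTerm =>
      z.1.1.1 := Primrec.fst.comp (Primrec.fst.comp Primrec.fst)
  have h : Primrec₂ fun (y : ((List ℕ × List ℕ) × Code) × List CertifiedTerm)
      (x : CertifiedTerm) => termOutput y.1.1 x := primrec_termOutput.comp hL Primrec.snd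
  exact Primrec.list_flatMap Primrec.snd h

theorem exists_algorithm : ∃ algorithm : (List ℕ × List ℕ) × Code → Code, Computable algorithm ∧
    ∀ (p : ℕ) (A n : Fin p → ℕ) (c : Code),
      (∀ t ∈ algorithm ((List.ofFn A, List.ofFn n), c), Admissible A t.2) ∧
        zetaCombination (algorithm ((List.ofFn A, List.ofFn n), c)) =
          regPoly A n (polyOfCode p c) := by
  obtain ⟨f, hf, hc⟩ := exists_computable_choice primrecRel_certifies exists_certifies
  refine ⟨fun x => (f x).flatMap (termOutput x.1),
    primrec_flatMap_termOutput.to_comp.comp Computable.id hf, fun p A n c => ⟨?_, ?_⟩⟩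
  · intro t ht
    obtain ⟨z, hz, ht⟩ := List.mem_flatMap.1 ht
    exact ((hc ((List.ofFn A, List.ofFn n), c)).2 z hz).admissible t ht
  · exact (hc ((List.ofFn A, List.ofFn n), c)).zetaCombination_eq

end Algorithm

end HypergeomMZV

theorem mainTheorem5 :
    (∀ (p : ℕ), 1 ≤ p → ∀ (A n : Fin p → ℕ), (∀ j, 1 ≤ A j) →
      ∀ (P : MvPolynomial (Fin p) ℚ), HypergeomMZV.DegreeCondition A n P →
        (∀ z : ℂ, 1 < ‖z‖ → Summable (HypergeomMZV.seriesTerm A n P z)) ∧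
        HypergeomMZV.AtMostLogDivergent (HypergeomMZV.seriesInv A n P) ∧
        HypergeomMZV.regValue (HypergeomMZV.seriesInv A n P) ∈
          Submodule.span ℚ (HypergeomMZV.zetaSh '' {s | HypergeomMZV.Admissible A s})) ∧
    (∃ algorithm : (List ℕ × List ℕ) × HypergeomMZV.Code → HypergeomMZV.Code,
      Computable algorithm ∧
      ∀ (p : ℕ), 1 ≤ p → ∀ (A n : Fin p → ℕ), (∀ j, 1 ≤ A j) →
        ∀ (c : HypergeomMZV.Code),
          HypergeomMZV.DegreeCondition A n (HypergeomMZV.polyOfCode p c) →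
            (∀ t ∈ algorithm ((List.ofFn A, List.ofFn n), c), HypergeomMZV.Admissible A t.2) ∧
            HypergeomMZV.regValue
                (HypergeomMZV.seriesInv A n (HypergeomMZV.polyOfCode p c)) =
              HypergeomMZV.zetaCombination (algorithm ((List.ofFn A, List.ofFn n), c))) := by
  refine ⟨fun p hp A n _ P h => ⟨fun z hz => HypergeomMZV.summable_seriesTerm hp hz, ?_, ?_⟩, ?_⟩
  · obtain ⟨Q, hQ, -⟩ := HypergeomMZV.exists_isLogExpansion_seriesInv hp h
    exact ⟨Q, hQ⟩
  · rw [HypergeomMZV.regValue_seriesInv hp h]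
    exact HypergeomMZV.regPoly_mem_span h
  · obtain ⟨f, hf, hc⟩ := HypergeomMZV.exists_algorithm
    exact ⟨f, hf, fun p hp A n _ c h =>
      ⟨(hc p A n c).1, (HypergeomMZV.regValue_seriesInv hp h).trans (hc p A n c).2.symm⟩⟩
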